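/- Conventions. Let $\mathbb{K}=\mathbb{Q}(q,t)$. For $m\ge 1$ put $X_{i+km}=q^{-k}X_i$ ($1\le i\le m$, $k\in\mathbb{Z}$). Let $\mathscr{H}_m$ be the affine Hecke algebra of $GL_m$: the $\mathbb{K}$-algebra generated by $T_i$ ($i\in\mathbb{Z}/m\mathbb{Z}$; no $T_i$ if $m=1$) and $\Pi^{\pm1}$ with relations $(T_i-t)(T_i+1)=0$, $T_iT_{i+1}T_i=T_{i+1}T_iT_{i+1}$ if $m>2$, $T_iT_j=T_jT_i$ if $j\ne i\pm1$, and $\Pi T_i=T_{i+1}\Pi$. It acts on $\mathbb{K}[X_1^{\pm1},\dots,X_m^{\pm1}]$ (level one representation, written $\bullet$) by $$T_i\bullet F=t\,s_i(F)+(t-1)\frac{F-s_i(F)}{1-X_iX_{i+1}^{-1}},\qquad \Pi\bullet F=X_1F(X_2,\dots,X_m,X_{m+1}),$$ where $s_i$ exchanges $X_i$ and $X_{i+1}$ for $1\le i\le m-1$ and $s_0(F)=X_1X_0^{-1}F(X_0,X_2,\dots,X_{m-1},X_{m+1})$. Put $Y_i=t^{m-i}T_{i-1}\cdots T_1\Pi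 T_{m-1}^{-1}\cdots T_i^{-1}\in\mathscr{H}_m$ for $1\le i\le m$. The $Y_i$ are invertible and commute, and $F\mapsto F(Y)$ embeds the Laurent polynomial ring $\mathbb{K}[Y^{\pm1}]_{(m)}$ in $\mathscr{H}_m$ as a subalgebra. Define $\mathsf{q}_{(m)}:\mathbb{K}[Y^{\pm1}]_{(m)}\to\mathbb{K}[X^{\pm1}]_{(m)}$ by $\mathsf{q}_{(m)}(F(Y))=F(Y)\bullet 1$. For $0<m'<m$ let $\pi_{m,m'}$ be the truncation of polynomials that sets the variables with index $>m'$ to $0$; let $\mathbb{K}[X]_{(\infty)}$ be the projective limit of the rings $\mathbb{K}[X_1,\dots,X_m]$ under the $\pi_{m,m'}$ in the category of graded vector spaces, $\Lambda_{q,t}\subset\mathbb{K}[X]_{(\infty)}$ the subring of symmetric functions, $e_r$ the $r$-th elementary symmetric function and $e_\lambda=\prod_i e_{\lambda_i}$; similarly with $Y$ in place of $X$. For integers $0\le \mathsf{e}(1)\le\dots\le\mathsf{e}(n)$ with $\mathsf{e}(i)<i$, let $\Gamma$ be the unit interval graph with vertices $1,\dots,n$ and oriented edges $j\to i$ for $\mathsf{e}(i)<j<i$.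 Its chromatic quasisymmetric function is $\mathbf{X}_\Gamma(t)=\sum_\kappa t^{\mathrm{asc}(\kappa)}\prod_v X_{\kappa(v)}$, summed over the proper colourings $\kappa$ of $\Gamma$ by positive integers, where $\mathrm{asc}(\kappa)$ is the number of edges $v\to w$ with $\kappa(v)<\kappa(w)$; written in the $Y$-variables it is $\mathbf{Y}_\Gamma(t)$. Its $(q,t)$-chromatic symmetric function $\mathbf{X}_\Gamma(q,t)$ is the element of $\Lambda_{q,t}$ whose truncation to $m$ variables is, for every $m\geq 1$, $$t^{n(m-1)}\,\mathsf{S}^{(m)}_{1,\mathsf{e}(1)}\cdots\mathsf{S}^{(m)}_{n,\mathsf{e}(n)}\Pi^n\bullet 1,\qquad \mathsf{S}^{(m)}_{i,e}=1+T_i^{-1}+T_{i+1}^{-1}T_i^{-1}+\dots+T_{m+e-1}^{-1}\cdots T_i^{-1},$$ where $\mathsf{S}^{(m)}_{i,e}=0$ if $e<i-m$. Theorem B. (i) For every $m\ge1$ the map $\mathsf{q}_{(m)}$ is an isomorphism of $\mathbb{K}$-vector spaces; it maps $\mathbb{K}[Y]_{(m)}$ onto $\mathbb{K}[X]_{(m)}$,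 and $\mathsf{q}_{(m')}(\pi_{m,m'}(F(Y)))=\pi_{m,m'}(\mathsf{q}_{(m)}(F(Y)))$ for all $0<m'<m$ and $F(Y)\in\mathbb{K}[Y]_{(m)}$. In particular the maps $\mathsf{q}_{(m)}$ induce a well-defined linear isomorphism $\mathsf{q}:\mathbb{K}[Y]_{(\infty)}\to\mathbb{K}[X]_{(\infty)}$. (ii) The multiplication $F\star G:=\mathsf{q}(\mathsf{q}^{-1}(F)\cdot\mathsf{q}^{-1}(G))$ on $\mathbb{K}[X]_{(\infty)}$ is commutative and associative and preserves $\Lambda_{q,t}$. It reduces to the usual multiplication at $q=1$ if one of the factors is in $\Lambda_{q,t}$: if $F$ or $G$ lies in $\Lambda_{q,t}$ and no coefficient of $F$ or $G$ has a pole at $q=1$, then no coefficient of $F\star G$ has a pole at $q=1$, and $F\star G$ and $FG$ have the same specialization at $q=1$. (iii) For every unit interval graph $\Gamma$ as above, $\mathbf{X}_\Gamma(q,t)$ is well-defined and $\mathbf{X}_\Gamma(q,t)=\mathsf{q}(\mathbf{Y}_\Gamma(t))$. (iv) For every partition $\lambda=(\lambda_1,\dots,\lambda_l)$, the $(q,t)$-elementary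 symmetric function $e^{(q,t)}_\lambda(X):=e_{\lambda_1}(X)\star\cdots\star e_{\lambda_l}(X)$ lies in $\Lambda_{q,t}$ and $\mathsf{q}(e_\lambda(Y))=t^{\sum_i\lambda_i(\lambda_i-1)/2}\,e^{(q,t)}_\lambda(X)$. -/

import Mathlib

namespace QTChrom

section Laurent

variable {k : Type*} [CommRing k]

/-- The Laurent polynomial ring in `m` variables over `k`: the group algebra of `ℤ^m`. -/
abbrev Laurent (k : Type*) [CommRing k] (m : ℕ) : Type _ := AddMonoidAlgebra k (Fin m → ℤ)

/-- The monomial with exponent vector `a`, as a unit. -/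
noncomputable def monoUnit {m : ℕ} (a : Fin m → ℤ) : (Laurent k m)ˣ where
  val := AddMonoidAlgebra.single a 1
  inv := AddMonoidAlgebra.single (-a) 1
  val_inv := by rw [AddMonoidAlgebra.single_mul_single]; simp [AddMonoidAlgebra.one_def]
  inv_val := by rw [AddMonoidAlgebra.single_mul_single]; simp [AddMonoidAlgebra.one_def]

/-- The variable `X_{r+1}` (the index set `Fin m` starts at `0`), as a unit. -/
noncomputable def varUnit {m : ℕ} (r : Fin m) : (Laurent k m)ˣ :=
  monoUnit (Pi.single r 1)

/-- A scalar unit, as a unit of the Laurent polynomial ring. -/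
noncomputable def scal {m : ℕ} (c : kˣ) : (Laurent k m)ˣ :=
  Units.map (algebraMap k (Laurent k m)).toMonoidHom c

theorem modIndex_lt {m : ℕ} [NeZero m] (j : ℤ) : (j % (m : ℤ)).toNat < m := by
  have hm : (0 : ℤ) < m := by exact_mod_cast Nat.pos_of_ne_zero (NeZero.ne m)
  have h1 := Int.emod_lt_of_pos j hm
  have h2 := Int.emod_nonneg j hm.ne'
  omega

/-- `X_j` for every `j ∈ ℤ`, with the convention `X_{i + l m} = q^{-l} X_i` for `1 ≤ i ≤ m`. -/
noncomputable def varZ {m : ℕ} [NeZero m] (q : kˣ) (j : ℤ) : (Laurent k m)ˣ :=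
  scal (q ^ (-((j - 1) / (m : ℤ)))) * varUnit ⟨((j - 1) % (m : ℤ)).toNat, modIndex_lt (j - 1)⟩

/-- The substitution `F ↦ F(f_1, …, f_m)`, for units `f_1, …, f_m`. -/
noncomputable def subst {m : ℕ} (f : Fin m → (Laurent k m)ˣ) : Laurent k m →ₐ[k] Laurent k m :=
  AddMonoidAlgebra.lift k (Laurent k m) (Fin m → ℤ)
    { toFun := fun c => ((∏ r, f r ^ (Multiplicative.toAdd c r) : (Laurent k m)ˣ) : Laurent k m)
      map_one' := by simp
      map_mul' := fun _ _ => by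
        rw [← Units.val_mul, ← Finset.prod_mul_distrib]
        simp [zpow_add] }

/-- The substitution `X_j ↦ X_{w j}` for `1 ≤ j ≤ m`. -/
noncomputable def act {m : ℕ} [NeZero m] (q : kˣ) (w : ℤ → ℤ) : Laurent k m →ₐ[k] Laurent k m :=
  subst fun r => varZ q (w ((r : ℤ) + 1))

theorem subst_varUnit {m : ℕ} (f : Fin m → (Laurent k m)ˣ) (r : Fin m) :
    subst f (varUnit r : (Laurent k m)ˣ) = (f r : Laurent k m) := by
  classical
  simp only [subst, varUnit, monoUnit, AddMonoidAlgebra.lift_single, one_smul, MonoidHom.coe_mk,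
    OneHom.coe_mk, toAdd_ofAdd]
  congr 1
  rw [Finset.prod_eq_single r]
  · simp
  · intro b _ hb
    simp [Pi.single_eq_of_ne hb]
  · simp

theorem monoUnit_add {m : ℕ} (a b : Fin m → ℤ) :
    (monoUnit (a + b) : (Laurent k m)ˣ) = monoUnit a * monoUnit b := by
  ext1
  simp [monoUnit, AddMonoidAlgebra.single_mul_single]

/-- `a ↦ X^a` as a group homomorphism. -/
noncomputable def monoHom (k : Type*) [CommRing k] (m : ℕ) :
    Multiplicative (Fin m → ℤ) →* (Laurent k m)ˣ :=
  MonoidHom.mk' (fun a => monoUnit (Multiplicative.toAdd a)) fun _ _ => monoUnit_add _ _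

theorem monoUnit_eq_prod {m : ℕ} (a : Fin m → ℤ) :
    (monoUnit a : (Laurent k m)ˣ) = ∏ r, varUnit r ^ a r := by
  classical
  have h1 : Multiplicative.ofAdd a
      = ∏ r : Fin m, (Multiplicative.ofAdd (Pi.single r (1 : ℤ) : Fin m → ℤ)) ^ a r := by
    apply Multiplicative.toAdd.injective
    rw [toAdd_prod]
    simp only [toAdd_ofAdd, toAdd_zpow]
    ext s
    simp [Finset.sum_apply, Pi.single_apply]
  have h2 := congrArg (monoHom k m) h1
  rw [map_prod] at h2
  simp only [map_zpow] at h2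
  exact h2

theorem algHom_ext_var {m : ℕ} {B : Type*} [CommRing B] [Algebra k B]
    (f g : Laurent k m →ₐ[k] B)
    (h : ∀ r : Fin m, f (varUnit r : (Laurent k m)ˣ) = g (varUnit r : (Laurent k m)ˣ)) :
    f = g := by
  apply AddMonoidAlgebra.algHom_ext
  · intro a
    have h1 : ∀ r : Fin m, Units.map (f : Laurent k m →* B) (varUnit r)
        = Units.map (g : Laurent k m →* B) (varUnit r) := fun r => Units.ext (h r)
    have h2 : Units.map (f : Laurent k m →* B) (monoUnit a)
        = Units.map (g : Laurent k m →* B) (monoUnit a) := by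
      rw [monoUnit_eq_prod, map_prod, map_prod]
      simp only [map_zpow, h1]
    exact congrArg Units.val h2
  · exact Subsingleton.elim _ _

variable {m : ℕ} [NeZero m] (q : kˣ)

theorem varZ_of (r : Fin m) (l : ℤ) :
    (varZ q ((r : ℤ) + 1 + m * l) : (Laurent k m)ˣ) = scal (q ^ (-l)) * varUnit r := by
  have hm : (m : ℤ) ≠ 0 := by exact_mod_cast NeZero.ne m
  have hr : (r : ℤ) < m := by exact_mod_cast r.2
  have e : (r : ℤ) + 1 + m * l - 1 = r + m * l := by ring
  unfold varZ
  have h1 : ((r : ℤ) + 1 + m * l - 1) / (m : ℤ) = l := by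
    rw [e, Int.add_mul_ediv_left _ _ hm, Int.ediv_eq_zero_of_lt (by positivity) hr, zero_add]
  have h2 : ((r : ℤ) + 1 + m * l - 1) % (m : ℤ) = r := by
    rw [e, Int.add_mul_emod_self_left, Int.emod_eq_of_lt (by positivity) hr]
  rw [h1]
  congr 2
  ext
  simp [h2]

theorem exists_rep (m : ℕ) [NeZero m] (j : ℤ) : ∃ (r : Fin m) (l : ℤ), j = (r : ℤ) + 1 + m * l := by
  refine ⟨⟨((j - 1) % (m : ℤ)).toNat, modIndex_lt _⟩, (j - 1) / m, ?_⟩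
  have hm : (m : ℤ) ≠ 0 := by exact_mod_cast NeZero.ne m
  have h2 := Int.emod_nonneg (j - 1) hm
  have h3 := Int.emod_add_mul_ediv (j - 1) m
  simp only [Int.toNat_of_nonneg h2]
  linarith

theorem varZ_add (j l : ℤ) :
    (varZ q (j + m * l) : (Laurent k m)ˣ) = scal (q ^ (-l)) * varZ q j := by
  obtain ⟨r, l', rfl⟩ := exists_rep m j
  rw [show (r : ℤ) + 1 + m * l' + m * l = r + 1 + m * (l' + l) by ring, varZ_of, varZ_of,
    ← mul_assoc]
  simp only [scal, ← map_mul, ← zpow_add]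
  congr 4
  ring

theorem act_varUnit (w : ℤ → ℤ) (r : Fin m) :
    act q w (varUnit r : (Laurent k m)ˣ) = ((varZ q (w ((r : ℤ) + 1)) : (Laurent k m)ˣ) : Laurent k m) :=
  subst_varUnit _ r

/-- A map `w : ℤ → ℤ` that commutes with the translation by `m`. -/
def IsPer (m : ℕ) (w : ℤ → ℤ) : Prop := ∀ j, w (j + m) = w j + m

theorem IsPer.mul {m : ℕ} {w : ℤ → ℤ} (hw : IsPer m w) (j l : ℤ) : w (j + m * l) = w j + m * l := by
  induction l using Int.induction_on with
  | zero => simp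
  | succ i ih =>
    rw [show j + (m : ℤ) * (i + 1) = j + m * i + m by ring, hw, ih]; ring
  | pred i ih =>
    have := hw (j + m * (-(i : ℤ) - 1))
    rw [show j + (m : ℤ) * (-(i : ℤ) - 1) + m = j + m * -(i : ℤ) by ring, ih] at this
    linarith

theorem act_varZ {w : ℤ → ℤ} (hw : IsPer m w) (j : ℤ) :
    Units.map ((act q w : Laurent k m →ₐ[k] Laurent k m) : Laurent k m →* Laurent k m) (varZ q j) = varZ q (w j) := by
  obtain ⟨r, l, rfl⟩ := exists_rep m j
  rw [varZ_of, hw.mul, varZ_add, map_mul]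
  congr 1
  · ext1
    exact (act q w).commutes _
  · ext1
    exact act_varUnit q w r

theorem act_comp {w w' : ℤ → ℤ} (hw : IsPer m w) (F : Laurent k m) :
    act q w (act q w' F) = act q (w ∘ w') F := by
  have : (act q w).comp (act q w') = (act q (w ∘ w') : Laurent k m →ₐ[k] Laurent k m) := by
    apply algHom_ext_var
    intro r
    simp only [AlgHom.comp_apply, act_varUnit]
    exact congrArg Units.val (act_varZ q hw _)
  exact DFunLike.congr_fun this F

theorem act_id (F : Laurent k m) : act q id F = F := by
  have : act q id = AlgHom.id k (Laurent k m) := by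
    apply algHom_ext_var
    intro r
    rw [act_varUnit]
    have := varZ_of (k := k) q r 0
    simp only [mul_zero, add_zero, neg_zero, zpow_zero] at this
    rw [id, this]
    simp [scal]
  exact DFunLike.congr_fun this F

/-- The ratio `X_j X_{j+1}⁻¹`. -/
noncomputable def ratioZ (j : ℤ) : (Laurent k m)ˣ := varZ q j * (varZ q (j + 1))⁻¹

theorem ratioZ_add (j l : ℤ) : (ratioZ q (j + m * l) : (Laurent k m)ˣ) = ratioZ q j := by
  unfold ratioZ
  rw [show j + (m : ℤ) * l + 1 = j + 1 + m * l by ring, varZ_add, varZ_add, mul_inv]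
  rw [mul_mul_mul_comm, mul_inv_cancel, one_mul]

theorem exists_add_of_cast_eq {m : ℕ} {a b : ℤ} (h : (a : ZMod m) = b) :
    ∃ l : ℤ, a = b + m * l := by
  rw [ZMod.intCast_eq_intCast_iff_dvd_sub] at h
  obtain ⟨c, hc⟩ := h
  exact ⟨-c, by linarith⟩

theorem ratioZ_congr {a b : ℤ} (h : (a : ZMod m) = b) :
    (ratioZ q a : (Laurent k m)ˣ) = ratioZ q b := by
  obtain ⟨l, rfl⟩ := exists_add_of_cast_eq h
  exact ratioZ_add q b l

/-- The ratio `X_i X_{i+1}⁻¹`, which depends only on `i` modulo `m`. -/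
noncomputable def ratio (i : ZMod m) : (Laurent k m)ˣ := ratioZ q (i.val : ℤ)

theorem val_cast (i : ZMod m) : (((i.val : ℤ)) : ZMod m) = i := by
  simp

theorem ratio_cast (j : ℤ) : (ratio q (j : ZMod m) : (Laurent k m)ˣ) = ratioZ q j :=
  ratioZ_congr q (val_cast _)

/-- The affine transposition `s_i` as a permutation of `ℤ`. -/
def sperm (m : ℕ) (i : ZMod m) (j : ℤ) : ℤ :=
  if (j : ZMod m) = i then j + 1 else if (j : ZMod m) = i + 1 then j - 1 else j

theorem sperm_isPer (m : ℕ) (i : ZMod m) : IsPer m (sperm m i) := by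
  intro j
  unfold sperm
  have : ((j + (m : ℤ) : ℤ) : ZMod m) = j := by simp
  rw [this]
  split_ifs <;> ring

theorem one_ne_zero_zmod {m : ℕ} (hm : 2 ≤ m) : (1 : ZMod m) ≠ 0 := by
  have : Fact (1 < m) := ⟨hm⟩
  exact one_ne_zero

theorem sperm_left {m : ℕ} {i : ZMod m} {j : ℤ} (h : (j : ZMod m) = i) : sperm m i j = j + 1 := by
  simp [sperm, h]

theorem sperm_right {m : ℕ} (hm : 2 ≤ m) {i : ZMod m} {j : ℤ} (h : (j : ZMod m) = i + 1) :
    sperm m i j = j - 1 := by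
  simp [sperm, h, one_ne_zero_zmod hm]

theorem sperm_other {m : ℕ} {i : ZMod m} {j : ℤ} (h : (j : ZMod m) ≠ i)
    (h' : (j : ZMod m) ≠ i + 1) : sperm m i j = j := by
  simp [sperm, h, h']

theorem sperm_sperm {m : ℕ} (hm : 2 ≤ m) (i : ZMod m) (j : ℤ) : sperm m i (sperm m i j) = j := by
  by_cases h : (j : ZMod m) = i
  · rw [sperm_left h, sperm_right hm (by simp [h])]; ring
  · by_cases h' : (j : ZMod m) = i + 1
    · rw [sperm_right hm h', sperm_left (by simp [h'])]; ring
    · rw [sperm_other h h', sperm_other h h']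

/-- The factor `X_1 X_0⁻¹` that occurs in the action of `s_0`. -/
noncomputable def pref (i : ZMod m) : (Laurent k m)ˣ :=
  if i = 0 then varZ q 1 * (varZ q 0)⁻¹ else 1

/-- The level one action of `s_i`: `s_i(F) = F(…, X_{i+1}, X_i, …)` for `i ≠ 0` and
`s_0(F) = X_1 X_0⁻¹ F(X_0, X_2, …, X_{m-1}, X_{m+1})`. -/
noncomputable def sOp (i : ZMod m) (F : Laurent k m) : Laurent k m :=
  (pref q i : (Laurent k m)ˣ) * act q (sperm m i) F

/-- The quotient `a / b` in a domain, if `b` divides `a` and `b ≠ 0`. -/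
noncomputable def exactDiv {R : Type*} [CommRing R] (a b : R) : R :=
  open Classical in if h : b ∣ a then h.choose else 0

theorem mul_exactDiv {R : Type*} [CommRing R] {a b : R} (h : b ∣ a) : b * exactDiv a b = a := by
  rw [exactDiv, dif_pos h]
  exact h.choose_spec.symm

/-- `T_i • F = t s_i(F) + (t - 1) (F - s_i(F)) / (1 - X_i X_{i+1}⁻¹)`. -/
noncomputable def topFun (t : kˣ) (i : ZMod m) (F : Laurent k m) : Laurent k m :=
  (t : k) • sOp q i F +
    ((t : k) - 1) • exactDiv (F - sOp q i F) (1 - (ratio q i : (Laurent k m)ˣ))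

/-- `Π • F = X_1 F(X_2, …, X_m, X_{m+1})`. -/
noncomputable def piFun (F : Laurent k m) : Laurent k m :=
  (varZ q 1 : (Laurent k m)ˣ) * act q (fun j => j + 1) F

theorem act_ratioZ {w : ℤ → ℤ} (hw : IsPer m w) (j : ℤ) :
    Units.map ((act q w : Laurent k m →ₐ[k] Laurent k m) : Laurent k m →* Laurent k m) (ratioZ q j)
      = varZ q (w j) * (varZ q (w (j + 1)))⁻¹ := by
  rw [ratioZ, map_mul, map_inv, act_varZ q hw, act_varZ q hw]

theorem pref_eq (i : ZMod m) :
    (pref q i : (Laurent k m)ˣ) = if i = 0 then (ratio q i)⁻¹ else 1 := by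
  unfold pref
  split_ifs with h
  · subst h
    simp [ratio, ratioZ]
  · rfl

/-- Every Laurent polynomial is congruent to its image under `s_i` modulo `1 - X_i X_{i+1}⁻¹`. -/
theorem dvd_sub_sOp (hm : 2 ≤ m) (i : ZMod m) (F : Laurent k m) :
    (1 - ((ratio q i : (Laurent k m)ˣ) : Laurent k m)) ∣ F - sOp q i F := by
  set u : (Laurent k m)ˣ := ratio q i with hu
  set I : Ideal (Laurent k m) := Ideal.span {1 - (u : Laurent k m)} with hI
  let π := Ideal.Quotient.mkₐ k I
  have hπu : π u = 1 := by
    have : π (1 - (u : Laurent k m)) = 0 :=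
      Ideal.Quotient.eq_zero_iff_mem.mpr (Ideal.mem_span_singleton_self _)
    rw [map_sub, map_one] at this
    exact (sub_eq_zero.mp this).symm
  have hstep : ∀ j : ℤ, (j : ZMod m) = i →
      π (varZ q j : (Laurent k m)ˣ) = π (varZ q (j + 1) : (Laurent k m)ˣ) := by
    intro j hj
    have h1 : (varZ q j : (Laurent k m)ˣ) = u * varZ q (j + 1) := by
      rw [hu, ← hj, ratio_cast, ratioZ]; simp
    rw [h1, Units.val_mul, map_mul, hπu, one_mul]
  have hact : π.comp (act q (sperm m i)) = π := by
    apply algHom_ext_var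
    intro r
    rw [AlgHom.comp_apply, act_varUnit]
    have h0 : (varUnit r : (Laurent k m)ˣ) = varZ q ((r : ℤ) + 1) := by
      have := varZ_of (k := k) q r 0
      simp only [mul_zero, add_zero, neg_zero, zpow_zero] at this
      rw [this]; simp [scal]
    rw [h0]
    generalize (r : ℤ) + 1 = j
    by_cases h : (j : ZMod m) = i
    · rw [sperm_left h, hstep j h]
    · by_cases h' : (j : ZMod m) = i + 1
      · rw [sperm_right hm h', hstep (j - 1) (by simp [h'])]
        simp
      · rw [sperm_other h h']
  have hpref : π (pref q i : (Laurent k m)ˣ) = 1 := by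
    rw [pref_eq]
    split_ifs
    · have h2 : π ((u⁻¹ : (Laurent k m)ˣ) : Laurent k m) * π (u : Laurent k m) = 1 := by
        rw [← map_mul, Units.inv_mul, map_one]
      rw [hπu, mul_one] at h2
      exact h2
    · simp
  have hF : π (sOp q i F) = π F := by
    rw [sOp, map_mul, hpref, one_mul]
    exact DFunLike.congr_fun hact F
  rw [← Ideal.mem_span_singleton, ← Ideal.Quotient.eq_zero_iff_mem]
  change π (F - sOp q i F) = 0
  rw [map_sub, hF, sub_self]

theorem one_sub_ratio_ne_zero [Nontrivial k] (hm : 2 ≤ m) (i : ZMod m) :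
    1 - ((ratio q i : (Laurent k m)ˣ) : Laurent k m) ≠ 0 := by
  intro h
  have h1 : (ratio q i : (Laurent k m)ˣ) = 1 := Units.ext (sub_eq_zero.mp h).symm
  obtain ⟨r, l, hr⟩ := exists_rep m (i.val : ℤ)
  obtain ⟨r', l', hr'⟩ := exists_rep m ((i.val : ℤ) + 1)
  have hne : r ≠ r' := by
    rintro rfl
    have : (m : ℤ) ∣ 1 := ⟨l' - l, by linarith⟩
    have := Int.le_of_dvd one_pos this
    omega
  rw [ratio, ratioZ, hr', hr, varZ_of, varZ_of, mul_inv_eq_one] at h1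
  have h2 := congrArg Units.val h1
  have h3 : ∀ (c : kˣ) (r : Fin m), ((scal c * varUnit r : (Laurent k m)ˣ) : Laurent k m)
      = AddMonoidAlgebra.single (Pi.single r 1) (c : k) := by
    intro c r
    simp [scal, varUnit, monoUnit, AddMonoidAlgebra.single_mul_single]
  rw [h3, h3, AddMonoidAlgebra.single_inj] at h2
  rcases h2 with ⟨h2, -⟩ | ⟨h2, -⟩
  · have := congrFun h2 r
    simp [hne] at this
  · exact Units.ne_zero _ h2

theorem topFun_key (hm : 2 ≤ m) (t : kˣ) (i : ZMod m) (F : Laurent k m) :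
    (1 - ((ratio q i : (Laurent k m)ˣ) : Laurent k m)) * topFun q t i F
      = (1 - algebraMap k _ (t : k) * ((ratio q i : (Laurent k m)ˣ) : Laurent k m)) * sOp q i F
        + (algebraMap k _ (t : k) - 1) * F := by
  have h := mul_exactDiv (dvd_sub_sOp q hm i F)
  simp only [topFun, Algebra.smul_def, map_sub, map_one]
  linear_combination (algebraMap k (Laurent k m) (t : k) - 1) * h

theorem sOp_add (i : ZMod m) (F G : Laurent k m) : sOp q i (F + G) = sOp q i F + sOp q i G := by
  simp only [sOp, map_add, mul_add]

theorem sOp_mul (i : ZMod m) (F G : Laurent k m) :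
    sOp q i (F * G) = act q (sperm m i) F * sOp q i G := by
  simp only [sOp, map_mul]
  ring

theorem sOp_smul (i : ZMod m) (c : k) (F : Laurent k m) : sOp q i (c • F) = c • sOp q i F := by
  simp only [sOp, map_smul, mul_smul_comm]

theorem sOp_key (i : ZMod m) (c : k) {a a' x y z : Laurent k m}
    (h : (1 - a) * x = (1 - algebraMap k _ c * a) * y + (algebraMap k _ c - 1) * z)
    (ha : act q (sperm m i) a = a') :
    (1 - a') * sOp q i x = (1 - algebraMap k _ c * a') * sOp q i y
      + (algebraMap k _ c - 1) * sOp q i z := by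
  have h1 := congrArg (sOp q i) h
  simp only [sOp_add, sOp_mul, map_sub, map_one, map_mul, AlgHom.commutes, ha] at h1
  exact h1

theorem act_unit_eq {w : ℤ → ℤ} {a b : (Laurent k m)ˣ}
    (h : Units.map ((act q w : Laurent k m →ₐ[k] Laurent k m) : Laurent k m →* Laurent k m) a = b) :
    act q w (a : Laurent k m) = (b : Laurent k m) := congrArg Units.val h

theorem act_ratio_self (hm : 2 ≤ m) (i : ZMod m) :
    Units.map ((act q (sperm m i) : Laurent k m →ₐ[k] Laurent k m) : Laurent k m →* Laurent k m)
      (ratio q i) = (ratio q i)⁻¹ := by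
  rw [ratio, act_ratioZ q (sperm_isPer m i), sperm_left (val_cast i),
    sperm_right hm (by simp), ratioZ]
  simp

theorem act_ratio_succ (hm : 2 < m) (i : ZMod m) :
    Units.map ((act q (sperm m i) : Laurent k m →ₐ[k] Laurent k m) : Laurent k m →* Laurent k m)
      (ratio q (i + 1)) = ratio q i * ratio q (i + 1) := by
  have h1 := one_ne_zero_zmod hm.le
  have h2 : (2 : ZMod m) ≠ 0 := by
    intro h
    have := (ZMod.natCast_eq_zero_iff 2 m).mp (by exact_mod_cast h)
    exact absurd (Nat.le_of_dvd two_pos this) (by omega)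
  have e : i + 1 = (((i.val : ℤ) + 1 : ℤ) : ZMod m) := by simp
  rw [e, ratio_cast, act_ratioZ q (sperm_isPer m i), sperm_right hm.le (by simp),
    sperm_other (j := (i.val : ℤ) + 1 + 1), ratio, ratioZ, ratioZ]
  · simp
  · intro h
    apply h2
    have h' : i + 1 + 1 = i := by simpa using h
    linear_combination h'
  · intro h
    apply h1
    have h' : i + 1 + 1 = i + 1 := by simpa using h
    linear_combination h'

theorem act_ratio_pred (hm : 2 < m) (i : ZMod m) :
    Units.map ((act q (sperm m (i + 1)) : Laurent k m →ₐ[k] Laurent k m) :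
      Laurent k m →* Laurent k m) (ratio q i) = ratio q i * ratio q (i + 1) := by
  have h1 := one_ne_zero_zmod hm.le
  have h2 : (2 : ZMod m) ≠ 0 := by
    intro h
    have := (ZMod.natCast_eq_zero_iff 2 m).mp (by exact_mod_cast h)
    exact absurd (Nat.le_of_dvd two_pos this) (by omega)
  have e : ratio q (i + 1) = (ratioZ q ((i.val : ℤ) + 1) : (Laurent k m)ˣ) := by
    rw [← ratio_cast]; simp
  rw [e, ratio, act_ratioZ q (sperm_isPer m _), sperm_left (j := (i.val : ℤ) + 1) (by simp),
    sperm_other (j := (i.val : ℤ)), ratioZ, ratioZ]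
  · simp
  · intro h
    apply h1
    have h' : i = i + 1 := by simpa using h
    linear_combination -h'
  · intro h
    apply h2
    have h' : i = i + 1 + 1 := by simpa using h
    linear_combination -h'

theorem act_ratio_far {i j : ZMod m} (h0 : j ≠ i) (h1 : j ≠ i + 1) (h2 : j ≠ i - 1) :
    Units.map ((act q (sperm m i) : Laurent k m →ₐ[k] Laurent k m) : Laurent k m →* Laurent k m)
      (ratio q j) = ratio q j := by
  rw [ratio, act_ratioZ q (sperm_isPer m i), sperm_other (j := (j.val : ℤ)),
    sperm_other (j := (j.val : ℤ) + 1), ratioZ]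
  · intro h
    apply h2
    have h' : j + 1 = i := by simpa using h
    linear_combination h'
  · intro h
    apply h0
    have h' : j + 1 = i + 1 := by simpa using h
    linear_combination h'
  · simpa using h0
  · simpa using h1

theorem sOp_def (i : ZMod m) (F : Laurent k m) :
    sOp q i F = (pref q i : (Laurent k m)ˣ) * act q (sperm m i) F := rfl

theorem sOp_comp (i : ZMod m) (w : ℤ → ℤ) (p : (Laurent k m)ˣ) (F : Laurent k m) :
    sOp q i (p * act q w F)
      = (pref q i * Units.map ((act q (sperm m i) : Laurent k m →ₐ[k] Laurent k m) :
          Laurent k m →* Laurent k m) p : (Laurent k m)ˣ) * act q (sperm m i ∘ w) F := by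
  rw [sOp, map_mul, act_comp q (sperm_isPer m i), ← mul_assoc]
  rfl

theorem sOp_sOp (hm : 2 ≤ m) (i : ZMod m) (F : Laurent k m) : sOp q i (sOp q i F) = F := by
  have hw : sperm m i ∘ sperm m i = id := funext (sperm_sperm hm i)
  rw [sOp_def q i F, sOp_comp, hw, act_id, pref_eq]
  split_ifs with h
  · rw [map_inv, act_ratio_self q hm]
    simp
  · simp

theorem sperm_far {m : ℕ} (hm : 2 ≤ m) {i j : ZMod m} (h0 : j ≠ i) (h1 : j ≠ i + 1)
    (h2 : j ≠ i - 1) (x : ℤ) : sperm m i (sperm m j x) = sperm m j (sperm m i x) := by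
  have hone := one_ne_zero_zmod hm
  have a1 : j + 1 ≠ i := fun h => h2 (by linear_combination h)
  have a2 : j + 1 ≠ i + 1 := fun h => h0 (by linear_combination h)
  by_cases c1 : (x : ZMod m) = i
  · have e1 : (x : ZMod m) ≠ j := by rw [c1]; exact h0.symm
    have e2 : (x : ZMod m) ≠ j + 1 := by rw [c1]; exact a1.symm
    rw [sperm_other e1 e2, sperm_left c1, sperm_other (i := j)]
    · simpa [c1] using h1.symm
    · simpa [c1] using h0.symm
  by_cases c2 : (x : ZMod m) = i + 1
  · have e1 : (x : ZMod m) ≠ j := by rw [c2]; exact h1.symm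
    have e2 : (x : ZMod m) ≠ j + 1 := by rw [c2]; exact a2.symm
    rw [sperm_other e1 e2, sperm_right hm c2, sperm_other (i := j)]
    · simpa [c2] using h0.symm
    · simpa [c2] using a1.symm
  rw [sperm_other c1 c2]
  by_cases d1 : (x : ZMod m) = j
  · rw [sperm_left d1, sperm_other]
    · simpa [d1] using a1
    · simpa [d1] using h0
  by_cases d2 : (x : ZMod m) = j + 1
  · rw [sperm_right hm d2, sperm_other]
    · simpa [d2] using h0
    · simpa [d2] using h1
  rw [sperm_other d1 d2, sperm_other c1 c2]

theorem sperm_braid {m : ℕ} (hm : 2 < m) (i : ZMod m) (x : ℤ) :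
    sperm m i (sperm m (i + 1) (sperm m i x)) = sperm m (i + 1) (sperm m i (sperm m (i + 1) x)) := by
  have h1 := one_ne_zero_zmod hm.le
  have h2 : (2 : ZMod m) ≠ 0 := by
    intro h
    have := (ZMod.natCast_eq_zero_iff 2 m).mp (by exact_mod_cast h)
    exact absurd (Nat.le_of_dvd two_pos this) (by omega)
  have b1 : i ≠ i + 1 := fun h => h1 (by linear_combination -h)
  have b2 : i ≠ i + 1 + 1 := fun h => h2 (by linear_combination -h)
  have b3 : i + 1 ≠ i + 1 + 1 := fun h => h1 (by linear_combination -h)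
  by_cases c1 : (x : ZMod m) = i
  · have e1 : ((x + 1 : ℤ) : ZMod m) = i + 1 := by simp [c1]
    have e2 : ((x + 1 + 1 : ℤ) : ZMod m) = i + 1 + 1 := by simp [c1]
    rw [sperm_left c1, sperm_left e1,
      sperm_other (j := x + 1 + 1) (by rw [e2]; exact b2.symm) (by rw [e2]; exact b3.symm),
      sperm_other (i := i + 1) (j := x) (by rw [c1]; exact b1) (by rw [c1]; exact b2),
      sperm_left c1, sperm_left e1]
  by_cases c2 : (x : ZMod m) = i + 1
  · have e1 : ((x - 1 : ℤ) : ZMod m) = i := by simp [c2]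
    have e2 : ((x + 1 : ℤ) : ZMod m) = i + 1 + 1 := by simp [c2]
    rw [sperm_right hm.le c2,
      sperm_other (i := i + 1) (j := x - 1) (by rw [e1]; exact b1) (by rw [e1]; exact b2),
      sperm_left e1, sperm_left c2,
      sperm_other (j := x + 1) (by rw [e2]; exact b2.symm) (by rw [e2]; exact b3.symm),
      sperm_right hm.le e2]
    ring
  rw [sperm_other c1 c2]
  by_cases c3 : (x : ZMod m) = i + 1 + 1
  · have e1 : ((x - 1 : ℤ) : ZMod m) = i + 1 := by simp [c3]
    have e2 : ((x - 1 - 1 : ℤ) : ZMod m) = i := by simp [c3]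
    rw [sperm_right hm.le c3, sperm_right hm.le e1,
      sperm_other (i := i + 1) (by rw [e2]; exact b1) (by rw [e2]; exact b2)]
  rw [sperm_other (i := i + 1) c2 c3, sperm_other c1 c2, sperm_other c2 c3]

theorem sOp_far (hm : 2 ≤ m) {i j : ZMod m} (h0 : j ≠ i) (h1 : j ≠ i + 1) (h2 : j ≠ i - 1)
    (F : Laurent k m) : sOp q i (sOp q j F) = sOp q j (sOp q i F) := by
  have g1 : i ≠ j + 1 := fun h => h2 (by linear_combination -h)
  have g2 : i ≠ j - 1 := fun h => h1 (by linear_combination -h)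
  rw [sOp_def q j F, sOp_def q i F, sOp_comp, sOp_comp,
    show sperm m i ∘ sperm m j = sperm m j ∘ sperm m i from funext (sperm_far hm h0 h1 h2)]
  congr 2
  rw [pref_eq, pref_eq]
  split_ifs with e1 e2 e2
  · exact absurd (e2.trans e1.symm) h0
  · rw [map_one, map_inv, act_ratio_far q h0.symm g1 g2]; simp
  · rw [map_one, map_inv, act_ratio_far q h0 h1 h2]; simp
  · simp

theorem sOp_braid (hm : 2 < m) (i : ZMod m) (F : Laurent k m) :
    sOp q i (sOp q (i + 1) (sOp q i F)) = sOp q (i + 1) (sOp q i (sOp q (i + 1) F)) := by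
  have h1 := one_ne_zero_zmod hm.le
  rw [sOp_def q i F, sOp_def q (i + 1) F, sOp_comp, sOp_comp, sOp_comp,
    sOp_comp, show sperm m i ∘ sperm m (i + 1) ∘ sperm m i
      = sperm m (i + 1) ∘ sperm m i ∘ sperm m (i + 1) from funext (sperm_braid hm i)]
  refine congrArg (fun p : (Laurent k m)ˣ => (p : Laurent k m) * act q _ F) ?_
  rw [pref_eq, pref_eq]
  split_ifs with e1 e2 e2
  · exfalso; apply h1; linear_combination e2 - e1
  · simp only [map_mul, map_one, map_inv, act_ratio_self q hm.le, act_ratio_succ q hm,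
      act_ratio_pred q hm, one_mul, mul_one]
    generalize ratio q i = a
    generalize ratio q (i + 1) = b
    simp [mul_comm]
  · simp only [map_mul, map_one, map_inv, act_ratio_self q hm.le, act_ratio_succ q hm,
      act_ratio_pred q hm, one_mul, mul_one]
    generalize ratio q i = a
    generalize ratio q (i + 1) = b
    simp
  · simp

theorem quad_alg {R : Type*} [CommRing R] [IsDomain R] {u u' c F sF f sf g : R} (hu : 1 - u ≠ 0)
    (huu : u * u' = 1) (h1 : (1 - u) * f = (1 - c * u) * sF + (c - 1) * F)
    (h2 : (1 - u') * sf = (1 - c * u') * F + (c - 1) * sF)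
    (h3 : (1 - u) * g = (1 - c * u) * sf + (c - 1) * f) : g = (c - 1) * f + c * F := by
  have h2' : (u - 1) * sf = (u - c) * F + (c - 1) * u * sF := by
    linear_combination u * h2 + (sf - c * F) * huu
  apply mul_left_cancel₀ (mul_ne_zero hu hu)
  linear_combination (1 - u) * h3 - (1 - c * u) * h2' + (c - 1) * u * h1

theorem braid_alg {R : Type*} [CommRing R] [IsDomain R]
    {u u' v v' w c F sF rF srF rsF srsF f1 f2 f3 sf1 rf1 srf1 sf2 g1 g2 g3 sg1 rg1 rsg1 rg2 : R}
    (hu : 1 - u ≠ 0) (hv : 1 - v ≠ 0) (hw : 1 - w ≠ 0)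
    (huu : u * u' = 1) (hvv : v * v' = 1) (huv : w = u * v)
    (f1e : (1 - u) * f1 = (1 - c * u) * sF + (c - 1) * F)
    (f2e : (1 - v) * f2 = (1 - c * v) * rf1 + (c - 1) * f1)
    (f3e : (1 - u) * f3 = (1 - c * u) * sf2 + (c - 1) * f2)
    (rf1e : (1 - w) * rf1 = (1 - c * w) * rsF + (c - 1) * rF)
    (sf2e : (1 - w) * sf2 = (1 - c * w) * srf1 + (c - 1) * sf1)
    (sf1e : (1 - u') * sf1 = (1 - c * u') * F + (c - 1) * sF)
    (srf1e : (1 - v) * srf1 = (1 - c * v) * srsF + (c - 1) * srF)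
    (g1e : (1 - v) * g1 = (1 - c * v) * rF + (c - 1) * F)
    (g2e : (1 - u) * g2 = (1 - c * u) * sg1 + (c - 1) * g1)
    (g3e : (1 - v) * g3 = (1 - c * v) * rg2 + (c - 1) * g2)
    (sg1e : (1 - w) * sg1 = (1 - c * w) * srF + (c - 1) * sF)
    (rg2e : (1 - w) * rg2 = (1 - c * w) * rsg1 + (c - 1) * rg1)
    (rg1e : (1 - v') * rg1 = (1 - c * v') * F + (c - 1) * rF)
    (rsg1e : (1 - u) * rsg1 = (1 - c * u) * srsF + (c - 1) * rsF) : f3 = g3 := by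
  have sf1e' : (u - 1) * sf1 = (u - c) * F + (c - 1) * u * sF := by
    linear_combination u * sf1e + (sf1 - c * F) * huu
  have rg1e' : (v - 1) * rg1 = (v - c) * F + (c - 1) * v * rF := by
    linear_combination v * rg1e + (rg1 - c * F) * hvv
  subst huv
  apply mul_left_cancel₀ (mul_ne_zero (mul_ne_zero (mul_ne_zero hu hu) (mul_ne_zero hv hv)) hw)
  linear_combination (1 - u) * (1 - v) ^ 2 * (1 - u * v) * f3e
    + (1 - u) * (1 - v) ^ 2 * (1 - c * u) * sf2e
    + (1 - u) * (1 - v) * (1 - c * u) * (1 - c * (u * v)) * srf1e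
    - (1 - v) ^ 2 * (1 - c * u) * (c - 1) * sf1e'
    + (1 - u) * (1 - v) * (1 - u * v) * (c - 1) * f2e
    + (1 - u) * (1 - v) * (c - 1) * (1 - c * v) * rf1e
    + (1 - v) * (1 - u * v) * (c - 1) ^ 2 * f1e
    - (1 - v) * (1 - u) ^ 2 * (1 - u * v) * g3e
    - (1 - v) * (1 - u) ^ 2 * (1 - c * v) * rg2e
    - (1 - v) * (1 - u) * (1 - c * v) * (1 - c * (u * v)) * rsg1e
    + (1 - u) ^ 2 * (1 - c * v) * (c - 1) * rg1e'
    - (1 - v) * (1 - u) * (1 - u * v) * (c - 1) * g2e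
    - (1 - v) * (1 - u) * (c - 1) * (1 - c * u) * sg1e
    - (1 - u) * (1 - u * v) * (c - 1) ^ 2 * g1e

section Domain

set_option linter.unusedSectionVars false

variable [IsDomain k] (t : kˣ)

theorem topFun_quad (hm : 2 ≤ m) (i : ZMod m) (F : Laurent k m) :
    topFun q t i (topFun q t i F) = ((t : k) - 1) • topFun q t i F + (t : k) • F := by
  have h1 := topFun_key q hm t i F
  have h2 := sOp_key q i _ h1 (act_unit_eq q (act_ratio_self q hm i))
  rw [sOp_sOp q hm] at h2
  have h3 := topFun_key q hm t i (topFun q t i F)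
  have := quad_alg (one_sub_ratio_ne_zero q hm i) (Units.mul_inv _) h1 h2 h3
  rw [this]
  simp only [Algebra.smul_def, map_sub, map_one]

theorem topFun_far (hm : 2 ≤ m) {i j : ZMod m} (h1 : j ≠ i + 1) (h2 : j ≠ i - 1)
    (F : Laurent k m) : topFun q t i (topFun q t j F) = topFun q t j (topFun q t i F) := by
  by_cases h0 : j = i
  · rw [h0]
  have g1 : i ≠ j + 1 := fun h => h2 (by linear_combination -h)
  have g2 : i ≠ j - 1 := fun h => h1 (by linear_combination -h)
  have kf := topFun_key q hm t j F
  have kg := topFun_key q hm t i F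
  have ksf := sOp_key q i _ kf (act_unit_eq q (act_ratio_far q h0 h1 h2))
  have krg := sOp_key q j _ kg (act_unit_eq q (act_ratio_far q (Ne.symm h0) g1 g2))
  have kT := topFun_key q hm t i (topFun q t j F)
  have kS := topFun_key q hm t j (topFun q t i F)
  rw [sOp_far q hm h0 h1 h2] at ksf
  apply mul_left_cancel₀ (mul_ne_zero (one_sub_ratio_ne_zero q hm i) (one_sub_ratio_ne_zero q hm j))
  set c := algebraMap k (Laurent k m) (t : k)
  set u := ((ratio q i : (Laurent k m)ˣ) : Laurent k m)
  set v := ((ratio q j : (Laurent k m)ˣ) : Laurent k m)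
  linear_combination (1 - v) * kT + (1 - c * u) * ksf + (c - 1) * kf - (1 - u) * kS
    - (1 - c * v) * krg - (c - 1) * kg

theorem topFun_braid (hm : 2 < m) (i : ZMod m) (F : Laurent k m) :
    topFun q t i (topFun q t (i + 1) (topFun q t i F))
      = topFun q t (i + 1) (topFun q t i (topFun q t (i + 1) F)) := by
  have hsu := act_unit_eq q (act_ratio_self q hm.le i)
  have hrv := act_unit_eq q (act_ratio_self q hm.le (i + 1))
  have hsv := act_unit_eq q (act_ratio_succ q hm i)
  have hru := act_unit_eq q (act_ratio_pred q hm i)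
  have hsw : act q (sperm m i) ((ratio q i * ratio q (i + 1) : (Laurent k m)ˣ) : Laurent k m)
      = ((ratio q (i + 1) : (Laurent k m)ˣ) : Laurent k m) := by
    rw [Units.val_mul, map_mul, hsu, hsv, Units.val_mul, Units.inv_mul_cancel_left]
  have hrw : act q (sperm m (i + 1)) ((ratio q i * ratio q (i + 1) : (Laurent k m)ˣ) : Laurent k m)
      = ((ratio q i : (Laurent k m)ˣ) : Laurent k m) := by
    rw [Units.val_mul, map_mul, hru, hrv, Units.val_mul, Units.mul_inv_cancel_right]
  have f1e := topFun_key q hm.le t i F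
  have f2e := topFun_key q hm.le t (i + 1) (topFun q t i F)
  have f3e := topFun_key q hm.le t i (topFun q t (i + 1) (topFun q t i F))
  have rf1e := sOp_key q (i + 1) _ f1e hru
  have sf2e := sOp_key q i _ f2e hsv
  have sf1e := sOp_key q i _ f1e hsu
  have srf1e := sOp_key q i _ rf1e hsw
  have g1e := topFun_key q hm.le t (i + 1) F
  have g2e := topFun_key q hm.le t i (topFun q t (i + 1) F)
  have g3e := topFun_key q hm.le t (i + 1) (topFun q t i (topFun q t (i + 1) F))
  have sg1e := sOp_key q i _ g1e hsv
  have rg2e := sOp_key q (i + 1) _ g2e hru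
  have rg1e := sOp_key q (i + 1) _ g1e hrv
  have rsg1e := sOp_key q (i + 1) _ sg1e hrw
  rw [sOp_sOp q hm.le] at sf1e rg1e
  rw [← sOp_braid q hm] at rsg1e
  have hw : 1 - ((ratio q i * ratio q (i + 1) : (Laurent k m)ˣ) : Laurent k m) ≠ 0 := by
    intro h
    have h' := congrArg (act q (sperm m i)) h
    rw [map_sub, map_one, map_zero, hsw] at h'
    exact one_sub_ratio_ne_zero q hm.le (i + 1) h'
  exact braid_alg (one_sub_ratio_ne_zero q hm.le i) (one_sub_ratio_ne_zero q hm.le (i + 1)) hw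
    (Units.mul_inv _) (Units.mul_inv _) (Units.val_mul _ _)
    f1e f2e f3e rf1e sf2e sf1e srf1e g1e g2e g3e sg1e rg2e rg1e rsg1e

theorem topFun_add (hm : 2 ≤ m) (i : ZMod m) (F G : Laurent k m) :
    topFun q t i (F + G) = topFun q t i F + topFun q t i G := by
  apply mul_left_cancel₀ (one_sub_ratio_ne_zero q hm i)
  rw [mul_add, topFun_key q hm, topFun_key q hm, topFun_key q hm, sOp_add]
  ring

theorem topFun_smul (hm : 2 ≤ m) (i : ZMod m) (c : k) (F : Laurent k m) :
    topFun q t i (c • F) = c • topFun q t i F := by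
  apply mul_left_cancel₀ (one_sub_ratio_ne_zero q hm i)
  rw [mul_smul_comm, topFun_key q hm, topFun_key q hm, sOp_smul]
  simp only [Algebra.smul_def]
  ring

theorem shift_isPer (m : ℕ) (c : ℤ) : IsPer m (fun j => j + c) := fun j => by ring

theorem piFun_sOp (hm : 2 ≤ m) (i : ZMod m) (F : Laurent k m) :
    piFun q (sOp q i F) = sOp q (i + 1) (piFun q F) := by
  have hone := one_ne_zero_zmod hm
  have hcomp : (fun j : ℤ => j + 1) ∘ sperm m i = sperm m (i + 1) ∘ fun j : ℤ => j + 1 := by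
    funext j
    simp only [Function.comp, sperm, Int.cast_add, Int.cast_one, add_left_inj]
    split_ifs <;> ring
  rw [show piFun q F = (varZ q 1 : (Laurent k m)ˣ) * act q (fun j => j + 1) F from rfl, sOp_comp,
    act_varZ q (sperm_isPer m _), piFun, sOp_def, map_mul, act_comp q (shift_isPer m 1), hcomp,
    ← mul_assoc]
  have hp : ((varZ q 1 : (Laurent k m)ˣ) : Laurent k m)
      * act q (fun j => j + 1) ((pref q i : (Laurent k m)ˣ) : Laurent k m)
      = ((varZ q 1 * Units.map ((act q (fun j => j + 1) : Laurent k m →ₐ[k] Laurent k m) :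
          Laurent k m →* Laurent k m) (pref q i) : (Laurent k m)ˣ) : Laurent k m) := rfl
  rw [hp]
  refine congrArg (fun p : (Laurent k m)ˣ => (p : Laurent k m) * act q _ F) ?_
  unfold pref
  by_cases h0 : i = 0
  · subst h0
    rw [if_pos rfl, if_neg (by simpa using hone), map_mul, map_inv, act_varZ q (shift_isPer m 1),
      act_varZ q (shift_isPer m 1), sperm_left (by simp)]
    simp
  · rw [if_neg h0, map_one]
    by_cases h1 : i + 1 = 0
    · rw [if_pos h1, sperm_right hm (by simp [h1])]
      simp
    · rw [if_neg h1, sperm_other]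
      · simp
      · intro h
        apply h0
        have h' : (1 : ZMod m) = i + 1 := by simpa using h
        linear_combination -h'
      · intro h
        apply h1
        have h' : (1 : ZMod m) = i + 1 + 1 := by simpa using h
        linear_combination -h'

theorem act_shift_ratio (i : ZMod m) :
    Units.map ((act q (fun j => j + 1) : Laurent k m →ₐ[k] Laurent k m) :
      Laurent k m →* Laurent k m) (ratio q i) = ratio q (i + 1) := by
  have e : ratio q (i + 1) = (ratioZ q ((i.val : ℤ) + 1) : (Laurent k m)ˣ) := by
    rw [← ratio_cast]; simp
  rw [e, ratio, act_ratioZ q (shift_isPer m 1), ratioZ]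

theorem piFun_add (F G : Laurent k m) : piFun q (F + G) = piFun q F + piFun q G := by
  simp only [piFun, map_add, mul_add]

theorem piFun_mul (F G : Laurent k m) :
    piFun q (F * G) = act q (fun j => j + 1) F * piFun q G := by
  simp only [piFun, map_mul]
  ring

theorem piFun_smul (c : k) (F : Laurent k m) : piFun q (c • F) = c • piFun q F := by
  simp only [piFun, map_smul, mul_smul_comm]

theorem piFun_topFun (hm : 2 ≤ m) (i : ZMod m) (F : Laurent k m) :
    piFun q (topFun q t i F) = topFun q t (i + 1) (piFun q F) := by
  apply mul_left_cancel₀ (one_sub_ratio_ne_zero q hm (i + 1))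
  have h := congrArg (piFun q) (topFun_key q hm t i F)
  simp only [piFun_add, piFun_mul, map_sub, map_one, map_mul, AlgHom.commutes,
    act_unit_eq q (act_shift_ratio q i)] at h
  rw [h, topFun_key q hm, piFun_sOp q hm]

/-- The inverse of the action of `Π`. -/
noncomputable def piInvFun (F : Laurent k m) : Laurent k m :=
  act q (fun j => j + -1) (((varZ q 1 : (Laurent k m)ˣ)⁻¹ : (Laurent k m)ˣ) * F)

theorem piInvFun_piFun (F : Laurent k m) : piInvFun q (piFun q F) = F := by
  rw [piInvFun, piFun, Units.inv_mul_cancel_left, act_comp q (shift_isPer m (-1)),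
    show (fun j : ℤ => j + -1) ∘ (fun j => j + 1) = id from funext fun j => by simp, act_id]

theorem piFun_piInvFun (F : Laurent k m) : piFun q (piInvFun q F) = F := by
  rw [piInvFun, piFun, act_comp q (shift_isPer m 1),
    show (fun j : ℤ => j + 1) ∘ (fun j => j + -1) = id from funext fun j => by simp, act_id,
    Units.mul_inv_cancel_left]

/-- The operator `T_i` of the level one representation, as a linear map. -/
noncomputable def topLin (hm : 2 ≤ m) (i : ZMod m) : Module.End k (Laurent k m) where
  toFun := topFun q t i
  map_add' := topFun_add q t hm i
  map_smul' := topFun_smul q t hm i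

end Domain

/-- The operator `Π` of the level one representation, as a linear map. -/
noncomputable def piLin : Module.End k (Laurent k m) where
  toFun := piFun q
  map_add' F G := by simp only [piFun, map_add, mul_add]
  map_smul' c F := by simp only [piFun, map_smul, mul_smul_comm, RingHom.id_apply]

/-- The operator `Π⁻¹` of the level one representation, as a linear map. -/
noncomputable def piInvLin : Module.End k (Laurent k m) where
  toFun := piInvFun q
  map_add' F G := by simp only [piInvFun, map_add, mul_add]
  map_smul' c F := by simp only [piInvFun, map_smul, mul_smul_comm, RingHom.id_apply]

end Laurent

section Hecke

variable {k : Type*} [CommRing k]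

/-- The generators `T_i` (`i ∈ ℤ/m`), `Π`, `Π⁻¹` of the affine Hecke algebra of `GL_m`; for `m = 1`
there are no `T_i`. -/
inductive HeckeGen (m : ℕ) : Type
  | T (i : ZMod m) (hm : 2 ≤ m)
  | Pi
  | PiInv

/-- The free algebra on the generators. -/
abbrev HeckeFree (k : Type*) [CommRing k] (m : ℕ) : Type _ := FreeAlgebra k (HeckeGen m)

/-- The generators, in the free algebra. -/
abbrev hgen (k : Type*) [CommRing k] {m : ℕ} (g : HeckeGen m) : HeckeFree k m :=
  FreeAlgebra.ι k g

/-- The defining relations of the affine Hecke algebra of `GL_m`. -/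
inductive HeckeRel (t : kˣ) (m : ℕ) : HeckeFree k m → HeckeFree k m → Prop
  | quad (i : ZMod m) (hm : 2 ≤ m) :
      HeckeRel t m ((hgen k (.T i hm) - algebraMap k _ (t : k)) * (hgen k (.T i hm) + 1)) 0
  | braid (i : ZMod m) (hm : 2 < m) :
      HeckeRel t m
        (hgen k (.T i hm.le) * hgen k (.T (i + 1) hm.le) * hgen k (.T i hm.le))
        (hgen k (.T (i + 1) hm.le) * hgen k (.T i hm.le) * hgen k (.T (i + 1) hm.le))
  | comm (i j : ZMod m) (hm : 2 ≤ m) (h1 : j ≠ i + 1) (h2 : j ≠ i - 1) :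
      HeckeRel t m (hgen k (.T i hm) * hgen k (.T j hm)) (hgen k (.T j hm) * hgen k (.T i hm))
  | pi_T (i : ZMod m) (hm : 2 ≤ m) :
      HeckeRel t m (hgen k .Pi * hgen k (.T i hm)) (hgen k (.T (i + 1) hm) * hgen k .Pi)
  | pi_inv : HeckeRel t m (hgen k .Pi * hgen k .PiInv) 1
  | inv_pi : HeckeRel t m (hgen k .PiInv * hgen k .Pi) 1

/-- The affine Hecke algebra of `GL_m` over `k` with parameter `t`. -/
abbrev HeckeAlg (t : kˣ) (m : ℕ) : Type _ := RingQuot (HeckeRel t m)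

/-- The images of the generators in the affine Hecke algebra. -/
noncomputable def HeckeAlg.gen (t : kˣ) {m : ℕ} (g : HeckeGen m) : HeckeAlg t m :=
  RingQuot.mkAlgHom k (HeckeRel t m) (hgen k g)

/-- The invertible element `Π`. -/
noncomputable def HeckeAlg.Pi (t : kˣ) (m : ℕ) : (HeckeAlg t m)ˣ where
  val := HeckeAlg.gen t .Pi
  inv := HeckeAlg.gen t .PiInv
  val_inv := by
    rw [HeckeAlg.gen, HeckeAlg.gen, ← map_mul, RingQuot.mkAlgHom_rel k HeckeRel.pi_inv, map_one]
  inv_val := by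
    rw [HeckeAlg.gen, HeckeAlg.gen, ← map_mul, RingQuot.mkAlgHom_rel k HeckeRel.inv_pi, map_one]

theorem HeckeAlg.gen_quad (t : kˣ) {m : ℕ} (i : ZMod m) (hm : 2 ≤ m) :
    (HeckeAlg.gen t (.T i hm) - algebraMap k _ (t : k)) * (HeckeAlg.gen t (.T i hm) + 1) = 0 := by
  have h := RingQuot.mkAlgHom_rel k (HeckeRel.quad (t := t) i hm)
  simp only [map_mul, map_sub, map_add, map_one, map_zero, AlgHom.commutes] at h
  exact h

/-- The invertible element `T_i`, with `T_i⁻¹ = t⁻¹ (T_i + 1 - t)`. (There are no `T_i` for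
`m = 1`; the value `1` given in that case is never used.) -/
noncomputable def HeckeAlg.T (t : kˣ) {m : ℕ} (i : ZMod m) : (HeckeAlg t m)ˣ :=
  if hm : 2 ≤ m then
    { val := HeckeAlg.gen t (.T i hm)
      inv := ((t⁻¹ : kˣ) : k) • (HeckeAlg.gen t (.T i hm) + 1 - algebraMap k _ (t : k))
      val_inv := by
        have h := HeckeAlg.gen_quad t i hm
        have hc := Algebra.commutes (t : k) (HeckeAlg.gen t (.T i hm))
        rw [mul_smul_comm]
        have : HeckeAlg.gen t (.T i hm) * (HeckeAlg.gen t (.T i hm) + 1 - algebraMap k _ (t : k))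
            = algebraMap k _ (t : k) := by
          rw [← sub_eq_zero, ← h]
          rw [mul_sub, sub_mul, mul_add, mul_add, mul_one, mul_one, ← hc]
          abel
        rw [this, Algebra.smul_def, ← map_mul, Units.inv_mul, map_one]
      inv_val := by
        have h := HeckeAlg.gen_quad t i hm
        rw [smul_mul_assoc]
        have : (HeckeAlg.gen t (.T i hm) + 1 - algebraMap k _ (t : k)) * HeckeAlg.gen t (.T i hm)
            = algebraMap k _ (t : k) := by
          rw [← sub_eq_zero, ← h]
          noncomm_ring
        rw [this, Algebra.smul_def, ← map_mul, Units.inv_mul, map_one] }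
  else 1

/-- The product `T_{a+n-1} ⋯ T_{a+1} T_a` of `n` factors. -/
noncomputable def HeckeAlg.descT (t : kˣ) (m : ℕ) (a : ℤ) : ℕ → (HeckeAlg t m)ˣ
  | 0 => 1
  | n + 1 => HeckeAlg.T t ((a + n : ℤ) : ZMod m) * HeckeAlg.descT t m a n

/-- The product `T_{a+n-1}⁻¹ ⋯ T_{a+1}⁻¹ T_a⁻¹` of `n` factors. -/
noncomputable def HeckeAlg.descTInv (t : kˣ) (m : ℕ) (a : ℤ) : ℕ → (HeckeAlg t m)ˣ
  | 0 => 1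
  | n + 1 => (HeckeAlg.T t ((a + n : ℤ) : ZMod m))⁻¹ * HeckeAlg.descTInv t m a n

/-- `Y_i = t^{m-i} T_{i-1} ⋯ T_1 Π T_{m-1}⁻¹ ⋯ T_i⁻¹` for `1 ≤ i ≤ m`. -/
noncomputable def HeckeAlg.Y (t : kˣ) (m : ℕ) (i : ℕ) : (HeckeAlg t m)ˣ :=
  Units.map (algebraMap k (HeckeAlg t m)).toMonoidHom (t ^ (m - i)) *
    HeckeAlg.descT t m 1 (i - 1) * HeckeAlg.Pi t m * HeckeAlg.descTInv t m i (m - i)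

/-- `F ↦ F(Y)`: the linear map from Laurent polynomials to the affine Hecke algebra that sends
`X^a` to `Y_1^{a_1} ⋯ Y_m^{a_m}`. -/
noncomputable def evalY (t : kˣ) (m : ℕ) : Laurent k m →ₗ[k] HeckeAlg t m :=
  (Finsupp.linearCombination k fun a : Fin m → ℤ =>
    (((List.ofFn fun r : Fin m => HeckeAlg.Y t m (r + 1) ^ a r).prod : (HeckeAlg t m)ˣ) :
      HeckeAlg t m)) ∘ₗ (AddMonoidAlgebra.coeffLinearEquiv k).toLinearMap

/-- The element `S_{i,e} = 1 + T_i⁻¹ + T_{i+1}⁻¹ T_i⁻¹ + ⋯ + T_{m+e-1}⁻¹ ⋯ T_i⁻¹`, which has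
`m + e - i + 1` terms, for `e ≥ i - m`, and `S_{i,e} = 0` for `e < i - m`. -/
noncomputable def HeckeAlg.S (t : kˣ) (m : ℕ) (i e : ℤ) : HeckeAlg t m :=
  if i - m ≤ e then
    ∑ n ∈ Finset.range (m + e - i + 1).toNat, (HeckeAlg.descTInv t m i n : HeckeAlg t m)
  else 0

/-- `S_e = t^{n(m-1)} S_{1,e(1)} S_{2,e(2)} ⋯ S_{n,e(n)} Π^n`, where `e(i)` is written `e (i - 1)`
since `Fin n` starts at `0`. -/
noncomputable def HeckeAlg.SE (t : kˣ) (m : ℕ) {n : ℕ} (e : Fin n → ℕ) : HeckeAlg t m :=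
  ((t : k) ^ (n * (m - 1))) •
    ((List.ofFn fun r : Fin n => HeckeAlg.S t m ((r : ℤ) + 1) (e r)).prod *
      (HeckeAlg.Pi t m : HeckeAlg t m) ^ n)

variable [IsDomain k]

/-- The images of the generators under the level one representation. -/
noncomputable def levelOneGen (q t : kˣ) (m : ℕ) [NeZero m] :
    HeckeGen m → Module.End k (Laurent k m)
  | .T i hm => topLin q t hm i
  | .Pi => piLin q
  | .PiInv => piInvLin q

/-- The level one polynomial representation of the affine Hecke algebra of `GL_m`. -/
noncomputable def levelOne (q t : kˣ) (m : ℕ) [NeZero m] :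
    HeckeAlg t m →ₐ[k] Module.End k (Laurent k m) :=
  RingQuot.liftAlgHom k ⟨FreeAlgebra.lift k (levelOneGen q t m), by
    intro x y h
    induction h with
    | quad i hm =>
      simp only [map_mul, map_sub, map_add, map_one, map_zero, AlgHom.commutes,
        FreeAlgebra.lift_ι_apply, levelOneGen]
      refine LinearMap.ext fun F => ?_
      have h := topFun_quad q t hm i F
      have ha := topFun_add q t hm i (topFun q t i F) F
      change topFun q t i (topFun q t i F + F) - (t : k) • (topFun q t i F + F) = 0
      rw [ha, h, sub_smul, one_smul, smul_add]
      abel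
    | braid i hm =>
      simp only [map_mul, FreeAlgebra.lift_ι_apply, levelOneGen]
      refine LinearMap.ext fun F => ?_
      exact topFun_braid q t hm i F
    | comm i j hm h1 h2 =>
      simp only [map_mul, FreeAlgebra.lift_ι_apply, levelOneGen]
      refine LinearMap.ext fun F => ?_
      exact topFun_far q t hm h1 h2 F
    | pi_T i hm =>
      simp only [map_mul, FreeAlgebra.lift_ι_apply, levelOneGen]
      refine LinearMap.ext fun F => ?_
      exact piFun_topFun q t hm i F
    | pi_inv =>
      simp only [map_mul, map_one, FreeAlgebra.lift_ι_apply, levelOneGen]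
      refine LinearMap.ext fun F => ?_
      exact piFun_piInvFun q F
    | inv_pi =>
      simp only [map_mul, map_one, FreeAlgebra.lift_ι_apply, levelOneGen]
      refine LinearMap.ext fun F => ?_
      exact piInvFun_piFun q F⟩

/-- The map `q_(m)`: `F(Y) ↦ F(Y) • 1`. -/
noncomputable def qMap (q t : kˣ) (m : ℕ) [NeZero m] : Laurent k m →ₗ[k] Laurent k m :=
  LinearMap.applyₗ (1 : Laurent k m) ∘ₗ (levelOne q t m).toLinearMap ∘ₗ evalY t m

end Hecke

section Families

variable {k : Type*} [CommRing k]

/-- The inclusion of the polynomial ring in the Laurent polynomial ring. -/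
noncomputable def toLaurent (k : Type*) [CommRing k] (m : ℕ) :
    MvPolynomial (Fin m) k →ₐ[k] Laurent k m :=
  MvPolynomial.aeval fun r => ((varUnit r : (Laurent k m)ˣ) : Laurent k m)

/-- The truncation `π_{m,m'}`: substitute `X_i = 0` for `i > m'`. -/
noncomputable def trunc (k : Type*) [CommRing k] (m m' : ℕ) :
    MvPolynomial (Fin m) k →ₐ[k] MvPolynomial (Fin m') k :=
  MvPolynomial.aeval fun r => if h : (r : ℕ) < m' then MvPolynomial.X ⟨r, h⟩ else 0

/-- The ring `k[X]_(∞)`: the projective limit of the rings `k[X_1, …, X_m]`, `m ≥ 1`, in the category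
of graded vector spaces, i.e. the families of polynomials that are compatible with the truncations and
whose degrees are bounded. -/
noncomputable def QInf (k : Type*) [CommRing k] :
    Subalgebra k (∀ m : ℕ+, MvPolynomial (Fin m) k) where
  carrier := {F | (∀ m' m : ℕ+, m' < m → trunc k m m' (F m) = F m') ∧
    ∃ D : ℕ, ∀ m, (F m).totalDegree ≤ D}
  mul_mem' := by
    rintro F G ⟨hF, D, hD⟩ ⟨hG, E, hE⟩
    refine ⟨fun m' m h => ?_, D + E, fun m => ?_⟩
    · rw [Pi.mul_apply, map_mul, hF m' m h, hG m' m h, Pi.mul_apply]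
    · exact (MvPolynomial.totalDegree_mul _ _).trans (add_le_add (hD m) (hE m))
  add_mem' := by
    rintro F G ⟨hF, D, hD⟩ ⟨hG, E, hE⟩
    refine ⟨fun m' m h => ?_, max D E, fun m => ?_⟩
    · rw [Pi.add_apply, map_add, hF m' m h, hG m' m h, Pi.add_apply]
    · exact (MvPolynomial.totalDegree_add _ _).trans (max_le_max (hD m) (hE m))
  algebraMap_mem' := by
    intro c
    refine ⟨fun m' m _ => ?_, 0, fun m => ?_⟩
    · rw [Pi.algebraMap_apply, AlgHom.commutes, Pi.algebraMap_apply]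
    · rw [Pi.algebraMap_apply, MvPolynomial.algebraMap_eq, MvPolynomial.totalDegree_C]

/-- The subring `Λ` of symmetric functions. -/
noncomputable def Lam (k : Type*) [CommRing k] : Subalgebra k (QInf k) where
  carrier := {F | ∀ m : ℕ+, (F.1 m).IsSymmetric}
  mul_mem' := fun hF hG m => (hF m).mul (hG m)
  add_mem' := fun hF hG m => (hF m).add (hG m)
  algebraMap_mem' := fun c _ => MvPolynomial.IsSymmetric.C c

theorem trunc_X_castLE {m m' : ℕ} (h : m' ≤ m) (r : Fin m') :
    trunc k m m' (MvPolynomial.X (Fin.castLE h r)) = MvPolynomial.X r := by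
  simp [trunc]

theorem trunc_X_of_le {m m' : ℕ} (r : Fin m) (hr : m' ≤ r) :
    trunc k m m' (MvPolynomial.X r) = 0 := by
  simp [trunc, hr]

/-- The elementary symmetric function `e_r`. -/
noncomputable def elemSymm (k : Type*) [CommRing k] (r : ℕ) : QInf k :=
  ⟨fun m => MvPolynomial.esymm (Fin m) k r, by
    refine ⟨fun m' m h => ?_, r, fun m => ?_⟩
    · have hle : (m' : ℕ) ≤ m := h.le
      simp only [MvPolynomial.esymm, map_sum, map_prod]
      symm
      refine Finset.sum_of_injOn (fun s => s.map (Fin.castLEEmb hle)) ?_ ?_ ?_ ?_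
      · exact fun a _ b _ hab => Finset.map_injective _ hab
      · intro s hs
        simpa using hs
      · intro s hs hs'
        have : ∃ x ∈ s, (m' : ℕ) ≤ x := by
          by_contra hcon
          push Not at hcon
          apply hs'
          refine ⟨Finset.univ.filter fun y : Fin m' => Fin.castLE hle y ∈ s, ?_, ?_⟩
          · have hs2 : (Finset.univ.filter fun y : Fin m' => Fin.castLE hle y ∈ s).map
                (Fin.castLEEmb hle) = s := by
              ext x
              simp only [Finset.mem_map, Finset.mem_filter, Finset.mem_univ, true_and]
              constructor
              · rintro ⟨y, hy, rfl⟩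
                exact hy
              · intro hx
                exact ⟨⟨x, hcon x hx⟩, hx, rfl⟩
            have hc := congrArg Finset.card hs2
            rw [Finset.card_map] at hc
            simp only [Finset.mem_powersetCard, Finset.subset_univ, true_and] at hs
            simp [hc, hs]
          · ext x
            simp only [Finset.mem_map, Finset.mem_filter, Finset.mem_univ, true_and]
            constructor
            · rintro ⟨y, hy, rfl⟩
              exact hy
            · intro hx
              exact ⟨⟨x, hcon x hx⟩, hx, rfl⟩
        obtain ⟨x, hx, hxm⟩ := this
        exact Finset.prod_eq_zero hx (trunc_X_of_le x hxm)
      · intro s _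
        rw [Finset.prod_map]
        exact Finset.prod_congr rfl fun x _ => (trunc_X_castLE hle x).symm
    · unfold MvPolynomial.esymm
      refine (MvPolynomial.totalDegree_finsetSum_le fun s hs => ?_)
      refine (MvPolynomial.totalDegree_finsetProd _ _).trans ?_
      refine (Finset.sum_le_card_nsmul _ _ 1 fun i _ => ?_).trans ?_
      · exact (MvPolynomial.totalDegree_monomial_le _ _).trans (by simp)
      · simp [(Finset.mem_powersetCard.mp hs).2]⟩

/-- A map `κ` from the vertices of an oriented graph to `{1, …, m}` is a proper colouring if
`κ v ≠ κ w` for every edge `v → w`. -/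
def IsProper {V : Type*} (Γ : Digraph V) {m : ℕ} (κ : V → Fin m) : Prop :=
  ∀ v w, Γ.Adj v w → κ v ≠ κ w

/-- The number of edges `v → w` with `κ v < κ w`. -/
noncomputable def asc {V : Type*} (Γ : Digraph V) {m : ℕ} (κ : V → Fin m) : ℕ :=
  Set.ncard {p : V × V | Γ.Adj p.1 p.2 ∧ κ p.1 < κ p.2}

/-- The chromatic quasisymmetric function `∑_κ t^{asc κ} ∏_v X_{κ v}` of a finite oriented graph,
the sum being over all proper colourings by positive integers. Its truncation to `m` variables is the
sum over the proper colourings with values in `{1, …, m}`. -/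
noncomputable def chromQS {V : Type*} [Fintype V] (t : k) (Γ : Digraph V) : QInf k :=
  open Classical in
  ⟨fun m => ∑ κ : V → Fin m with IsProper Γ κ,
      MvPolynomial.C (t ^ asc Γ κ) * ∏ v, MvPolynomial.X (κ v), by
    refine ⟨fun m' m h => ?_, Fintype.card V, fun m => ?_⟩
    · have hle : (m' : ℕ) ≤ m := h.le
      have hC : ∀ c : k, trunc k m m' (MvPolynomial.C c) = MvPolynomial.C c :=
        fun c => (trunc k m m').commutes c
      simp only [map_sum, map_prod, map_mul, hC]
      symm
      refine Finset.sum_of_injOn (fun κ v => Fin.castLE hle (κ v)) ?_ ?_ ?_ ?_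
      · intro a _ b _ hab
        funext v
        exact Fin.castLE_injective hle (congrFun hab v)
      · intro κ hκ
        simp only [Finset.coe_filter, Finset.mem_univ, true_and, Set.mem_ofPred_eq] at hκ ⊢
        exact fun v w hvw he => hκ v w hvw (Fin.castLE_injective hle he)
      · intro κ hκ hκ'
        have : ∃ v, (m' : ℕ) ≤ κ v := by
          by_contra hcon
          push Not at hcon
          apply hκ'
          refine ⟨fun v => ⟨κ v, hcon v⟩, ?_, rfl⟩
          simp only [Finset.coe_filter, Finset.mem_filter, Finset.mem_univ, true_and,
            Set.mem_ofPred_eq] at hκ ⊢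
          intro v w hvw he
          exact hκ v w hvw (Fin.ext (Fin.mk.inj_iff.mp he))
        obtain ⟨v, hv⟩ := this
        rw [Finset.prod_eq_zero (Finset.mem_univ v) (trunc_X_of_le _ hv), mul_zero]
      · intro κ _
        congr 1
        exact Finset.prod_congr rfl fun v _ => (trunc_X_castLE hle _).symm
    · refine (MvPolynomial.totalDegree_finsetSum_le fun κ _ => ?_)
      refine (MvPolynomial.totalDegree_mul _ _).trans ?_
      rw [MvPolynomial.totalDegree_C, zero_add]
      refine (MvPolynomial.totalDegree_finsetProd _ _).trans ?_
      refine (Finset.sum_le_card_nsmul _ _ 1 fun i _ => ?_).trans ?_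
      · exact (MvPolynomial.totalDegree_monomial_le _ _).trans (by simp)
      · simp⟩

/-- The set `𝔼_n` of sequences `(e(1), …, e(n))` with `0 ≤ e(i) < i` and `e(i) ≤ e(i+1)`; here `e(i)`
is written `e (i - 1)`, since `Fin n` starts at `0`. -/
def IsE {n : ℕ} (e : Fin n → ℕ) : Prop := (∀ r, e r < (r : ℕ) + 1) ∧ Monotone e

/-- The unit interval graph of `e ∈ 𝔼_n`: the vertices are `1, …, n`, and the edges are `j → i` for
`e(i) < j < i`. Vertices and indices are shifted by one, since `Fin n` starts at `0`. -/
def unitIntervalGraph {n : ℕ} (e : Fin n → ℕ) : Digraph (Fin n) where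
  Adj j i := e i < (j : ℕ) + 1 ∧ j < i

/-- The product `F ⋆ G = φ(φ⁻¹(F) · φ⁻¹(G))` transported by a linear isomorphism `φ`. -/
noncomputable def qStar (φ : QInf k ≃ₗ[k] QInf k) (F G : QInf k) : QInf k :=
  φ (φ.symm F * φ.symm G)

/-- The elementary symmetric function `e_λ = e_{λ_1} ⋯ e_{λ_l}` of a partition. -/
noncomputable def elemPart (k : Type*) [CommRing k] {n : ℕ} (lam : n.Partition) : QInf k :=
  ((lam.parts.sort (· ≥ ·)).map (elemSymm k)).prod

/-- The product `e_{λ_1} ⋆ ⋯ ⋆ e_{λ_l}` of a partition, for the multiplication transported by `φ`. -/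
noncomputable def elemPartStar (φ : QInf k ≃ₗ[k] QInf k) {n : ℕ} (lam : n.Partition) : QInf k :=
  ((lam.parts.sort (· ≥ ·)).map (elemSymm k)).foldr (qStar φ) 1

end Families

section Base

/-- The field `ℚ(t)`. -/
abbrev Qt : Type := RatFunc ℚ

/-- The field `ℚ(q,t) = ℚ(t)(q)`. -/
abbrev Qqt : Type := RatFunc Qt

/-- The parameter `q`. -/
noncomputable def qv : Qqtˣ := Units.mk0 RatFunc.X RatFunc.X_ne_zero

/-- The parameter `t`. -/
noncomputable def tv : Qqtˣ :=
  Units.mk0 (RatFunc.C (RatFunc.X : Qt))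
    ((map_ne_zero_iff _ RatFunc.C_injective).mpr RatFunc.X_ne_zero)

/-- The element has no pole at `q = 1`. -/
def RegularAtOne (c : Qqt) : Prop := c.denom.eval 1 ≠ 0

/-- The value in `ℚ(t)` at `q = 1` of an element without pole at `q = 1`. -/
noncomputable def valueAtOne (c : Qqt) : Qt := c.eval (RingHom.id Qt) 1

/-- All coefficients of `F` can be specialized at `q = 1`. -/
def QInf.RegularAtOne (F : QInf Qqt) : Prop :=
  ∀ (m : ℕ+) (d : Fin m →₀ ℕ), QTChrom.RegularAtOne ((F.1 m).coeff d)

/-- `F` and `G` have the same specialization at `q = 1`. -/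
def QInf.AgreeAtOne (F G : QInf Qqt) : Prop :=
  ∀ (m : ℕ+) (d : Fin m →₀ ℕ), valueAtOne ((F.1 m).coeff d) = valueAtOne ((G.1 m).coeff d)

end Base

end QTChrom

open QTChrom

/-! Multiplication by X_j and the operator Y_j satisfy the same exchange relations with the finite
generators T_i of the Hecke algebra (`IsBernstein`), and T_i • 1 = t. The map q_(m) fixes 1 and
turns multiplication by X_j into Y_j, hence it commutes with every T_i (`qPoly_pT`). Almost
everything below is a comparison of operators built from the T_i, from Π and from one of these two
families. In the code the indices of T, X and Y in these families are counted from 0. That the Y_j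
commute is a computation of Jucys–Murphy type with braid generators and Π.

Bijectivity. On polynomials q_(m) preserves degrees, so surjectivity suffices. The range is stable
under the T_i, and under Π, which is a scalar times Y_1 T_1 ⋯ T_{m-1}. Moreover X_1 F is Π applied
to a polynomial of the same degree as F, and X_{j+1} = t⁻¹ T_j X_j T_j, so the degree can be raised
by induction (`pX_mem_range`). For Laurent polynomials, injectivity follows by clearing denominators
with a power of X_1 ⋯ X_m. Surjectivity follows because the range is also stable under Π⁻¹, while
Π^m multiplies a monomial by X_1 ⋯ X_m up to a scalar. Compatibility with truncation reduces to Y_1,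
and there to the fact that t Π T_{m-1}⁻¹ in m variables truncates to Π in m - 1 variables
(`trunc_pPi_tInv`).

The product. A polynomial is symmetric exactly if T_i F = t F for all i, so q_(m) preserves and
reflects symmetry. At q = 1 the substitution in Π is a cyclic permutation of the variables. Then all
operators are linear over symmetric polynomials, and q_(m) is multiplicative as soon as the image of
one factor is symmetric (`qPoly_one_mul`). Nothing up to this point needs a field: q_(m) is
bijective over every domain in which q and t are units, in particular over the ring of functions
regular at q = 1. So no pole at q = 1 can arise, and the specialization can be computed on
preimages.

Chromatic functions. The generating function `colourSum` of proper colourings makes sense for any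
family with the exchange relations. The heart is `T_colourSum`: T_i exchanges the colours i and i +
1 of the vertices already coloured, up to a factor t, if each occurrence of i is followed by one of
i + 1. With the X_j this shows that the chromatic function is symmetric. With the Y_j it shows that
a factor S Π, up to a power of t, adds one vertex (`sum_descInv_colourSum`). So S_e • 1 is the
generating function in the Y_j applied to 1, which is the image under q_(m) of the one in the X_j.

Elementary functions. Square-free monomials are eigenvectors of q_(m) (`qPoly_prod`), with an
eigenvalue that depends only on the degree. -/

open QTChrom

namespace QTChrom

/-! ### Braid relations and the commutation of Bernstein elements in a group -/

section BraidGroup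

variable {G : Type*} [Group G]

/-- The product `g_{n-1} ⋯ g_1 g_0`. -/
def descProd (g : ℕ → G) : ℕ → G
  | 0 => 1
  | n + 1 => g n * descProd g n

/-- The sequence `g_0, …, g_{N-1}` satisfies the braid relations of type `A_N`. -/
structure IsBraid (g : ℕ → G) (N : ℕ) : Prop where
  braid : ∀ i, i + 1 < N → g i * g (i + 1) * g i = g (i + 1) * g i * g (i + 1)
  far : ∀ i j, i + 1 < j → j < N → Commute (g i) (g j)

theorem IsBraid.inv {g : ℕ → G} {N : ℕ} (h : IsBraid g N) : IsBraid (fun i => (g i)⁻¹) N where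
  braid i hi := by
    have := congrArg (·⁻¹) (h.braid i hi)
    simpa [mul_assoc] using this
  far i j hij hj := (h.far i j hij hj).inv_inv

theorem IsBraid.commute_descProd {g : ℕ → G} {N : ℕ} (h : IsBraid g N) {j n : ℕ} (hn : n < j)
    (hj : j < N) : Commute (g j) (descProd g n) := by
  induction n with
  | zero => exact Commute.one_right _
  | succ n ih => exact (h.far n j hn hj).symm.mul_right (ih (by omega))

/-- Factors above g_{j+1} commute with g_j, and factors below g_j commute with g_{j+1}. Between them
a single braid relation raises the index. -/
theorem IsBraid.mul_descProd {g : ℕ → G} {N : ℕ} (h : IsBraid g N) {j n : ℕ} (hj : j + 1 < n)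
    (hn : n ≤ N) : g j * descProd g n = descProd g n * g (j + 1) := by
  induction n with
  | zero => omega
  | succ n ih =>
    by_cases hjn : j + 1 < n
    · rw [descProd, ← mul_assoc, (h.far j n hjn (by omega)).eq, mul_assoc, ih hjn (by omega),
        mul_assoc]
    · obtain rfl : n = j + 1 := by omega
      have h1 := h.commute_descProd (j := j + 1) (n := j) (by omega) (by omega)
      rw [descProd, descProd]
      calc g j * (g (j + 1) * (g j * descProd g j))
          = g j * g (j + 1) * g j * descProd g j := by group
        _ = g (j + 1) * g j * (g (j + 1) * descProd g j) := by rw [h.braid j (by omega)]; group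
        _ = g (j + 1) * (g j * descProd g j) * g (j + 1) := by rw [h1.eq]; group

theorem descProd_succ' (g : ℕ → G) (n : ℕ) :
    descProd g (n + 1) = descProd (fun i => g (i + 1)) n * g 0 := by
  induction n with
  | zero => simp [descProd]
  | succ n ih => rw [descProd, ih, descProd, mul_assoc]

/-- By `mul_descProd`, each shifted generator lowers its index by one when it passes to the left of
the long product. -/
theorem IsBraid.descProd_mul_shift {g : ℕ → G} {N : ℕ} (h : IsBraid g N) {n : ℕ} (hn : n + 1 ≤ N) :
    descProd g (n + 1) * descProd (fun i => g (i + 1)) n = descProd g n * descProd g (n + 1) := by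
  have key : ∀ l ≤ n, descProd g (n + 1) * descProd (fun i => g (i + 1)) l
      = descProd g l * descProd g (n + 1) := by
    intro l hl
    induction l with
    | zero => simp [descProd]
    | succ l ih =>
      rw [show descProd (fun i => g (i + 1)) (l + 1)
        = g (l + 1) * descProd (fun i => g (i + 1)) l from rfl, ← mul_assoc,
        ← h.mul_descProd (j := l) (by omega) hn, mul_assoc, ih (by omega), ← mul_assoc]
      rfl
  exact key n le_rfl

theorem mul_descProd_of_shift {g g' : ℕ → G} {p : G} (n : ℕ)
    (hp : ∀ i < n, p * g i = g' i * p) : p * descProd g n = descProd g' n * p := by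
  induction n with
  | zero => simp [descProd]
  | succ n ih =>
    rw [descProd, ← mul_assoc, hp n (by omega), mul_assoc, ih fun i hi => hp i (by omega),
      descProd, mul_assoc]

/-- The first Bernstein element commutes with all but the first of the generators. -/
theorem IsBraid.commute_bernstein {g : ℕ → G} {N : ℕ} {p : G} (h : IsBraid g N)
    (hp : ∀ i, i + 1 < N → p * g i = g (i + 1) * p) {j : ℕ} (h0 : 0 < j) (hj : j < N) :
    Commute (g j) (p * descProd (fun i => (g i)⁻¹) N) := by
  obtain ⟨j, rfl⟩ : ∃ i, j = i + 1 := ⟨j - 1, by omega⟩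
  have h1 := h.inv.mul_descProd (j := j) hj le_rfl
  have h2 : g j * descProd (fun i => (g i)⁻¹) N = descProd (fun i => (g i)⁻¹) N * g (j + 1) := by
    rw [← mul_inv_eq_iff_eq_mul, mul_assoc, ← h1, mul_inv_cancel_left]
  change _ = _
  rw [← mul_assoc, ← hp j hj, mul_assoc, h2, mul_assoc]

/-- The first two Bernstein elements commute. -/
theorem IsBraid.commute_bernstein_conj {g : ℕ → G} {N : ℕ} {p : G} (h : IsBraid g (N + 1))
    (hp : ∀ i, i < N → p * g i = g (i + 1) * p) (hp2 : g 0 * (p * p) = p * p * g N) :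
    Commute (p * descProd (fun i => (g i)⁻¹) (N + 1))
      (g 0 * (p * descProd (fun i => (g i)⁻¹) (N + 1)) * g 0) := by
  set f : ℕ → G := fun i => (g i)⁻¹ with hf
  set D := descProd f (N + 1) with hD
  set D' := descProd f N with hD'
  set E := descProd (fun i => f (i + 1)) N with hE
  have e1 : D * g 0 = E := by
    rw [hD, descProd_succ']; simp [hf, hE]
  have e2 : E * p = p * D' := by
    refine (mul_descProd_of_shift N fun i hi => ?_).symm
    simp only [hf]
    rw [mul_inv_eq_iff_eq_mul, mul_assoc, hp i hi, inv_mul_cancel_left]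
  have e3 : D * E = D' * D := h.inv.descProd_mul_shift le_rfl
  have e4 : D = (g N)⁻¹ * D' := rfl
  have e5 : g N * D' * D = D' * E := by
    rw [mul_assoc, ← e3, e4]; group
  change _ = _
  -- Cancelling `g 0` turns `D` into its tail `E`, and sliding `p` turns `E` into `D'`. The exchange
  -- `e5` then creates the factor `g N`, which `p * p` carries to `g 0`.
  calc p * D * (g 0 * (p * D) * g 0)
      = p * (D * g 0) * p * (D * g 0) := by group
    _ = p * (E * p) * E := by rw [e1]; group
    _ = p * p * (D' * E) := by rw [e2]; group
    _ = p * p * g N * D' * D := by rw [← e5]; group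
    _ = g 0 * p * (p * D') * D := by rw [← hp2]; group
    _ = g 0 * p * (E * p) * D := by rw [e2]
    _ = g 0 * (p * D) * g 0 * (p * D) := by rw [← e1]; group

/-! ### Elements defined by the Jucys–Murphy recursion -/

section Jucys

variable {g y : ℕ → G} {c : G} {N : ℕ} (h : IsBraid g N) (hc : ∀ x : G, Commute c x)
  (hy : ∀ i < N, y (i + 1) = c * (g i * y i * g i)) (h0 : ∀ j, 0 < j → j < N → Commute (g j) (y 0))
include h hc hy h0

theorem IsBraid.commute_of_lt {i j : ℕ} (hij : i < j) (hj : j < N) : Commute (g j) (y i) := by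
  induction i with
  | zero => exact h0 j hij hj
  | succ i ih =>
    have h1 := (h.far i j hij hj).symm
    rw [hy i (by omega)]
    exact (hc _).symm.mul_right ((h1.mul_right (ih (by omega))).mul_right h1)

/-- The core is j = i + 2: there y_j is c² g_{i+1} g_i y_i g_i g_{i+1}, and two braid relations
carry g_i across because g_{i+1} commutes with y_i. Larger j only add conjugating generators far
from g_i. -/
theorem IsBraid.commute_of_gt {i j : ℕ} (hij : i + 1 < j) (hj : j ≤ N) : Commute (g i) (y j) := by
  induction j with
  | zero => omega
  | succ j ih =>
    rw [hy j (by omega)]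
    by_cases hij' : i + 1 < j
    · have h1 := h.far i j hij' (by omega)
      exact (hc _).symm.mul_right ((h1.mul_right (ih hij' (by omega))).mul_right h1)
    · obtain rfl : j = i + 1 := by omega
      rw [hy i (by omega)]
      refine (hc _).symm.mul_right ?_
      have h1 : Commute (g (i + 1)) (y i) :=
        IsBraid.commute_of_lt h hc hy h0 (by omega) (by omega)
      have hb := h.braid i (by omega)
      have hcc := (hc (g (i + 1))).eq
      have hci := (hc (g i)).eq
      change _ = _
      calc g i * (g (i + 1) * (c * (g i * y i * g i)) * g (i + 1))
          = g i * ((g (i + 1) * c) * (g i * y i * g i) * g (i + 1)) := by group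
        _ = (g i * c) * g (i + 1) * g i * y i * g i * g (i + 1) := by rw [← hcc]; group
        _ = c * (g i * g (i + 1) * g i) * y i * g i * g (i + 1) := by rw [← hci]; group
        _ = c * g (i + 1) * g i * (g (i + 1) * y i) * g i * g (i + 1) := by rw [hb]; group
        _ = c * g (i + 1) * g i * y i * (g (i + 1) * g i * g (i + 1)) := by rw [h1.eq]; group
        _ = (c * g (i + 1)) * g i * y i * g i * g (i + 1) * g i := by rw [← hb]; group
        _ = g (i + 1) * (c * (g i * y i * g i)) * g (i + 1) * g i := by rw [hcc]; group

/-- The recursion reduces every pair to y_0 and y_1: the generators that it inserts commute with the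
other element of the pair. -/
theorem IsBraid.commute_bernstein_all (h1 : 0 < N → Commute (y 0) (y 1)) {i j : ℕ} (hij : i < j)
    (hj : j ≤ N) : Commute (y i) (y j) := by
  induction i with
  | zero =>
    induction j with
    | zero => omega
    | succ j ih =>
      rcases Nat.eq_zero_or_pos j with rfl | hj0
      · exact h1 (by omega)
      · rw [hy j (by omega)]
        have h2 := (h0 j hj0 (by omega)).symm
        exact (hc _).symm.mul_right ((h2.mul_right (ih (by omega) hj0)).mul_right h2)
  | succ i ih =>
    rw [hy i (by omega)]
    have h2 : Commute (g i) (y j) := IsBraid.commute_of_gt h hc hy h0 hij hj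
    exact (hc _).mul_left ((h2.mul_left (ih (by omega))).mul_left h2)

end Jucys

/-- Products of powers of commuting elements add the exponents. -/
theorem prod_ofFn_zpow_add {n : ℕ} (y : Fin n → G) (hy : ∀ i j, Commute (y i) (y j))
    (a b : Fin n → ℤ) :
    (List.ofFn fun r => y r ^ (a r + b r)).prod
      = (List.ofFn fun r => y r ^ a r).prod * (List.ofFn fun r => y r ^ b r).prod := by
  induction n with
  | zero => simp
  | succ n ih =>
    simp only [List.ofFn_succ, List.prod_cons]
    rw [ih (fun i => y i.succ) (fun i j => hy _ _), zpow_add]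
    have : Commute (y 0 ^ b 0) (List.ofFn fun r : Fin n => y r.succ ^ a r.succ).prod := by
      refine Commute.list_prod_right _ _ fun x hx => ?_
      obtain ⟨r, rfl⟩ := List.mem_ofFn.mp hx
      exact ((hy _ _).zpow_left _).zpow_right _
    simp only [mul_assoc]
    congr 1
    rw [← mul_assoc, ← mul_assoc, this.eq]

end BraidGroup

/-! ### Bernstein presentation of the affine Hecke algebra -/

namespace HeckeAlg

variable {k : Type*} [CommRing k] (t : kˣ) {m : ℕ}

/-- The generator that exchanges the variables with indices `r` and `r + 1`, counted from `0`. -/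
noncomputable abbrev simple (t : kˣ) (m : ℕ) (r : ℕ) : (HeckeAlg t m)ˣ :=
  HeckeAlg.T t ((1 + r : ℤ) : ZMod m)

/-- A scalar, as a unit of the Hecke algebra. -/
noncomputable abbrev scalar (t : kˣ) (m : ℕ) (c : kˣ) : (HeckeAlg t m)ˣ :=
  Units.map (algebraMap k (HeckeAlg t m)).toMonoidHom c

theorem commute_scalar (c : kˣ) (x : (HeckeAlg t m)ˣ) : Commute (scalar t m c) x :=
  Units.ext (Algebra.commutes (c : k) (x : HeckeAlg t m))

theorem T_val (hm : 2 ≤ m) (i : ZMod m) : (T t i : HeckeAlg t m) = gen t (.T i hm) := by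
  rw [T, dif_pos hm]

theorem T_of_lt (hm : ¬ 2 ≤ m) (i : ZMod m) : T t i = 1 := by
  rw [T, dif_neg hm]

theorem T_braid (hm : 2 < m) (i : ZMod m) : T t i * T t (i + 1) * T t i
    = T t (i + 1) * T t i * T t (i + 1) := by
  ext1
  have h := RingQuot.mkAlgHom_rel k (HeckeRel.braid (t := t) i hm)
  rw [map_mul, map_mul, map_mul, map_mul] at h
  simp only [Units.val_mul, T_val t hm.le]
  exact h

theorem T_commute {i j : ZMod m} (h1 : j ≠ i + 1) (h2 : j ≠ i - 1) : Commute (T t i) (T t j) := by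
  by_cases hm : 2 ≤ m
  · ext1
    have h := RingQuot.mkAlgHom_rel k (HeckeRel.comm (t := t) i j hm h1 h2)
    rw [map_mul, map_mul] at h
    simp only [Units.val_mul, T_val t hm]
    exact h
  · rw [T_of_lt t hm]; exact Commute.one_left _

theorem Pi_mul_T (i : ZMod m) : Pi t m * T t i = T t (i + 1) * Pi t m := by
  by_cases hm : 2 ≤ m
  · ext1
    have h := RingQuot.mkAlgHom_rel k (HeckeRel.pi_T (t := t) i hm)
    rw [map_mul, map_mul] at h
    simp only [Units.val_mul, T_val t hm]
    exact h
  · simp [T_of_lt t hm]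

theorem sq_eq_of_quad {A : Type*} [Ring A] [Algebra k A] {x : A} {c : k}
    (h : (x - algebraMap k A c) * (x + 1) = 0) : x * x = (c - 1) • x + c • (1 : A) := by
  rw [sub_mul, mul_add, ← Algebra.smul_def, smul_add, mul_one] at h
  rw [sub_smul, one_smul]
  rw [eq_sub_of_add_eq (sub_eq_zero.mp h)]
  abel

theorem mul_add_eq_of_sq {A : Type*} [Ring A] [Algebra k A] {x : A} {c : k}
    (h : x * x = (c - 1) • x + c • (1 : A)) : x * (x + (1 - c) • 1) = c • (1 : A) := by
  rw [mul_add, h, mul_smul_comm, mul_one, sub_smul, sub_smul]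
  abel

/-- The factor x + (1 - c) is c x⁻¹, so it cancels the last x of z = c⁻¹ x y x. The companion
relation `bernstein_down` comes from expanding x² in x z. -/
theorem bernstein_up {A : Type*} [Ring A] [Algebra k A] {x y z : A} {c : kˣ}
    (h : x * x = ((c : k) - 1) • x + (c : k) • (1 : A))
    (hz : z = algebraMap k A ((c⁻¹ : kˣ) : k) * (x * y * x)) :
    x * y = z * (x + (1 - (c : k)) • 1) := by
  rw [← Algebra.smul_def] at hz
  rw [hz, smul_mul_assoc, mul_assoc (x * y), mul_add_eq_of_sq h, mul_smul_comm, mul_one, smul_smul,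
    Units.inv_mul, one_smul]

theorem bernstein_down {A : Type*} [Ring A] [Algebra k A] {x y z : A} {c : kˣ}
    (h : x * x = ((c : k) - 1) • x + (c : k) • (1 : A))
    (hz : z = algebraMap k A ((c⁻¹ : kˣ) : k) * (x * y * x)) :
    x * z = y * x + ((c : k) - 1) • z := by
  rw [← Algebra.smul_def] at hz
  have e : x * (x * y * x) = ((c : k) - 1) • (x * y * x) + (c : k) • (y * x) := by
    rw [← mul_assoc, ← mul_assoc, h, add_mul, add_mul, smul_mul_assoc, smul_mul_assoc,
      smul_mul_assoc, smul_mul_assoc, one_mul]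
  rw [hz, mul_smul_comm, e, smul_add, smul_smul ((c⁻¹ : kˣ) : k) (c : k), Units.inv_mul, one_smul,
    smul_comm, add_comm]

theorem T_sq (hm : 2 ≤ m) (i : ZMod m) : (T t i : HeckeAlg t m) * T t i
    = ((t : k) - 1) • (T t i : HeckeAlg t m) + (t : k) • (1 : HeckeAlg t m) := by
  rw [T_val t hm]
  exact sq_eq_of_quad (gen_quad t i hm)

theorem intCast_ne {m : ℕ} {a b : ℤ} (h1 : a - b < m) (h2 : b - a < m) (h : a ≠ b) :
    (a : ZMod m) ≠ b := by
  intro hab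
  rw [ZMod.intCast_eq_intCast_iff_dvd_sub] at hab
  obtain ⟨c, hc⟩ := hab
  rcases lt_trichotomy c 0 with h0 | rfl | h0
  · nlinarith
  · simp at hc; omega
  · nlinarith

theorem isBraid_simple (t : kˣ) (m : ℕ) : IsBraid (simple t m) (m - 1) where
  braid i hi := by
    have h := T_braid t (m := m) (by omega) ((1 + i : ℤ) : ZMod m)
    have e : ((1 + (i + 1 : ℕ) : ℤ) : ZMod m) = ((1 + i : ℤ) : ZMod m) + 1 := by push_cast; ring
    rwa [simple, simple, e]
  far i j hij hj := by
    apply T_commute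
    · have := intCast_ne (m := m) (a := 1 + j) (b := 1 + i + 1) (by omega) (by omega) (by omega)
      simpa using this
    · have := intCast_ne (m := m) (a := 1 + j) (b := 1 + i - 1) (by omega) (by omega) (by omega)
      simpa using this

theorem Pi_mul_simple (i : ℕ) : Pi t m * simple t m i = simple t m (i + 1) * Pi t m := by
  have e : ((1 + (i + 1 : ℕ) : ℤ) : ZMod m) = ((1 + i : ℤ) : ZMod m) + 1 := by push_cast; ring
  rw [simple, simple, e, Pi_mul_T]

/-- Two conjugations by Π move the index m - 1 to m + 1, which is 1 modulo m. -/
theorem simple_zero_mul_Pi_sq {N : ℕ} (hm : m = N + 2) :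
    simple t m 0 * (Pi t m * Pi t m) = Pi t m * Pi t m * simple t m N := by
  have e : ((1 + (0 : ℕ) : ℤ) : ZMod m) = ((1 + N : ℤ) : ZMod m) + 1 + 1 := by
    have : ((N : ZMod m) + 2) = 0 := by
      rw [hm]; exact_mod_cast ZMod.natCast_self (N + 2)
    push_cast
    linear_combination -this
  rw [simple, simple, e, mul_assoc (Pi t m), Pi_mul_T, ← mul_assoc (Pi t m), Pi_mul_T,
    mul_assoc]

theorem descTInv_eq (a : ℤ) (n : ℕ) :
    descTInv t m a n = descProd (fun i => (T t ((a + i : ℤ) : ZMod m))⁻¹) n := by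
  induction n with
  | zero => rfl
  | succ n ih => rw [descTInv, ih, descProd]

theorem descTInv_succ' (a : ℤ) (n : ℕ) :
    descTInv t m a (n + 1) = descTInv t m (a + 1) n * (T t (a : ZMod m))⁻¹ := by
  rw [descTInv_eq, descProd_succ', descTInv_eq]
  congr 2
  · funext i; congr 3; push_cast; ring
  · simp

theorem Y_one_eq : Y t m 1 = scalar t m (t ^ (m - 1)) *
    (Pi t m * descProd (fun i => (simple t m i)⁻¹) (m - 1)) := by
  rw [Y, descT, mul_one, Nat.cast_one, descTInv_eq, mul_assoc]

/-- The left T_r lengthens the descending product before Π, the right one cancels the last inverse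
generator after Π, and t⁻¹ adjusts the power of t. This is the recursion to which the Jucys–Murphy
argument applies. -/
theorem Y_succ_eq {r : ℕ} (hr : r + 1 < m) :
    Y t m (r + 1 + 1) = scalar t m t⁻¹ * (simple t m r * Y t m (r + 1) * simple t m r) := by
  obtain ⟨n, hn⟩ : ∃ n, m - (r + 1) = n + 1 := ⟨m - (r + 1) - 1, by omega⟩
  have hn' : m - (r + 1 + 1) = n := by omega
  have h1 : scalar t m (t ^ (n + 1)) = scalar t m (t ^ n) * scalar t m t := by
    rw [pow_succ]; exact map_mul _ _ _
  have h2 : scalar t m t⁻¹ * scalar t m t = 1 := by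
    refine (map_mul _ _ _).symm.trans ?_
    rw [inv_mul_cancel]; exact map_one _
  have e : (((r + 1 : ℕ) : ℤ) : ZMod m) = ((1 + r : ℤ) : ZMod m) := by push_cast; ring
  rw [Y, Y, hn, hn', descTInv_succ', e, Nat.add_sub_cancel, Nat.add_sub_cancel, descT]
  change scalar t m (t ^ n) * (simple t m r * _) * _ * _
    = scalar t m t⁻¹ * (simple t m r * (scalar t m (t ^ (n + 1)) * _ * _ * (_ * (simple t m r)⁻¹))
      * simple t m r)
  rw [h1]
  have c1 := (commute_scalar t (t ^ n) (simple t m r)).eq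
  have c2 := (commute_scalar t t (simple t m r * scalar t m (t ^ n))).eq
  have c3 : ((r + 1 : ℕ) : ℤ) + 1 = ((r + 1 + 1 : ℕ) : ℤ) := by push_cast; ring
  rw [c3]
  generalize descTInv t m _ n = D
  generalize descT t m 1 r = E
  calc scalar t m (t ^ n) * (simple t m r * E) * Pi t m * D
      = (scalar t m (t ^ n) * simple t m r) * E * Pi t m * D := by group
    _ = (scalar t m t⁻¹ * scalar t m t) * (simple t m r * scalar t m (t ^ n)) * E * Pi t m * D := by
      rw [h2, c1]; group
    _ = scalar t m t⁻¹ * (scalar t m t * (simple t m r * scalar t m (t ^ n))) * E * Pi t m * D := by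
      group
    _ = _ := by rw [c2]; group

theorem Y_commute (i j : ℕ) (hi : i < m) (hj : j < m) : Commute (Y t m (i + 1)) (Y t m (j + 1)) := by
  have h := isBraid_simple t m
  have hp : ∀ i, Pi t m * simple t m i = simple t m (i + 1) * Pi t m := Pi_mul_simple t
  have hc := commute_scalar t (m := m) t⁻¹
  have hy : ∀ i < m - 1, (fun i => Y t m (i + 1)) (i + 1)
      = scalar t m t⁻¹ * (simple t m i * (fun i => Y t m (i + 1)) i * simple t m i) :=
    fun i hi => Y_succ_eq t (by omega)
  have h0 : ∀ j, 0 < j → j < m - 1 → Commute (simple t m j) ((fun i => Y t m (i + 1)) 0) := by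
    intro j h0 hj
    simp only [Nat.zero_add, Y_one_eq]
    exact (commute_scalar t _ _).symm.mul_right (h.commute_bernstein (fun i _ => hp i) h0 hj)
  have h1 : 0 < m - 1 → Commute ((fun i => Y t m (i + 1)) 0) ((fun i => Y t m (i + 1)) 1) := by
    intro hm
    obtain ⟨N, rfl⟩ : ∃ N, m = N + 2 := ⟨m - 2, by omega⟩
    rw [hy 0 hm]
    simp only [Nat.zero_add, Y_one_eq]
    refine (commute_scalar t _ _).symm.mul_right ((commute_scalar t _ _).mul_left ?_)
    have := IsBraid.commute_bernstein_conj (N := N) h (fun i _ => hp i)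
      (simple_zero_mul_Pi_sq t rfl)
    have e : simple t (N + 2) 0 * (scalar t (N + 2) (t ^ (N + 2 - 1)) *
        (Pi t (N + 2) * descProd (fun i => (simple t (N + 2) i)⁻¹) (N + 2 - 1))) *
          simple t (N + 2) 0 = scalar t (N + 2) (t ^ (N + 2 - 1)) * (simple t (N + 2) 0 *
        (Pi t (N + 2) * descProd (fun i => (simple t (N + 2) i)⁻¹) (N + 2 - 1)) *
          simple t (N + 2) 0) := by
      rw [← mul_assoc (simple t (N + 2) 0), ← (commute_scalar t _ (simple t (N + 2) 0)).eq]
      group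
    rw [e]
    exact (commute_scalar t _ _).symm.mul_right this
  rcases lt_trichotomy i j with hij | rfl | hij
  · exact IsBraid.commute_bernstein_all (y := fun i => Y t m (i + 1)) h hc hy h0 h1 hij (by omega)
  · exact Commute.refl _
  · exact (IsBraid.commute_bernstein_all (y := fun i => Y t m (i + 1)) h hc hy h0 h1 hij (by omega)).symm

theorem simple_commute_Y {r j : ℕ} (hr : r + 1 < m) (hj : j < m) (h1 : j ≠ r) (h2 : j ≠ r + 1) :
    Commute (simple t m r) (Y t m (j + 1)) := by
  have h := isBraid_simple t m
  have hc := commute_scalar t (m := m) t⁻¹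
  have hy : ∀ i < m - 1, (fun i => Y t m (i + 1)) (i + 1)
      = scalar t m t⁻¹ * (simple t m i * (fun i => Y t m (i + 1)) i * simple t m i) :=
    fun i hi => Y_succ_eq t (by omega)
  have h0 : ∀ j, 0 < j → j < m - 1 → Commute (simple t m j) ((fun i => Y t m (i + 1)) 0) := by
    intro j h0 hj
    simp only [Nat.zero_add, Y_one_eq]
    exact (commute_scalar t _ _).symm.mul_right
      (h.commute_bernstein (fun i _ => Pi_mul_simple t i) h0 hj)
  rcases lt_or_gt_of_ne h1 with hij | hij
  · exact IsBraid.commute_of_lt (y := fun i => Y t m (i + 1)) h hc hy h0 hij (by omega)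
  · exact IsBraid.commute_of_gt (y := fun i => Y t m (i + 1)) h hc hy h0 (by omega) (by omega)

theorem simple_mul_Y {r : ℕ} (hr : r + 1 < m) :
    (simple t m r : HeckeAlg t m) * Y t m (r + 1)
      = Y t m (r + 1 + 1) * ((simple t m r : HeckeAlg t m) + (1 - (t : k)) • 1) := by
  exact bernstein_up (T_sq t (by omega) _) (congrArg Units.val (Y_succ_eq t hr))

theorem simple_mul_Y_succ {r : ℕ} (hr : r + 1 < m) :
    (simple t m r : HeckeAlg t m) * Y t m (r + 1 + 1)
      = Y t m (r + 1) * (simple t m r : HeckeAlg t m) + ((t : k) - 1) • (Y t m (r + 1 + 1) : HeckeAlg t m) := by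
  exact bernstein_down (T_sq t (by omega) _) (congrArg Units.val (Y_succ_eq t hr))

end HeckeAlg

/-! ### Evaluation of Laurent polynomials at the Y_i -/

section EvalY

variable {k : Type*} [CommRing k] (t : kˣ) (m : ℕ)

theorem evalY_single (a : Fin m → ℤ) (c : k) :
    evalY t m (AddMonoidAlgebra.single a c) = c •
      (((List.ofFn fun r : Fin m => HeckeAlg.Y t m (r + 1) ^ a r).prod : (HeckeAlg t m)ˣ) :
        HeckeAlg t m) := by
  simp [evalY, Finsupp.linearCombination_single]

/-- On monomials, multiplicativity is the commutativity of the Y_i, since the value is an ordered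
product. -/
theorem evalY_mul (F G : Laurent k m) : evalY t m (F * G) = evalY t m F * evalY t m G := by
  induction F using AddMonoidAlgebra.induction_linear with
  | zero => simp
  | add F F' h h' => rw [add_mul, map_add, h, h', map_add, add_mul]
  | single a c =>
    induction G using AddMonoidAlgebra.induction_linear with
    | zero => simp
    | add F F' h h' => rw [mul_add, map_add, h, h', map_add, mul_add]
    | single b d =>
      rw [AddMonoidAlgebra.single_mul_single, evalY_single, evalY_single, evalY_single,
        smul_mul_smul_comm, ← Units.val_mul]
      rw [← prod_ofFn_zpow_add _ fun i j => HeckeAlg.Y_commute t i j i.2 j.2]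
      rfl

theorem evalY_one : evalY t m 1 = 1 := by
  rw [AddMonoidAlgebra.one_def, evalY_single]
  simp

theorem evalY_varUnit (r : Fin m) :
    evalY t m (varUnit r : (Laurent k m)ˣ) = (HeckeAlg.Y t m (r + 1) : HeckeAlg t m) := by
  classical
  change evalY t m (AddMonoidAlgebra.single _ 1) = _
  rw [evalY_single, one_smul]
  congr 1
  have h : ∀ n (y : Fin n → (HeckeAlg t m)ˣ) (r : Fin n),
      (List.ofFn fun s => y s ^ (Pi.single r (1 : ℤ) : Fin n → ℤ) s).prod = y r := by
    intro n
    induction n with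
    | zero => exact fun _ r => r.elim0
    | succ n ih =>
      intro y r
      rw [List.ofFn_succ, List.prod_cons]
      refine Fin.cases ?_ (fun r => ?_) r
      · have : (List.ofFn fun i : Fin n => y i.succ ^ (Pi.single 0 (1 : ℤ) : Fin (n + 1) → ℤ) i.succ)
            = List.replicate n 1 := by
          rw [List.eq_replicate_iff]
          refine ⟨by simp, fun x hx => ?_⟩
          obtain ⟨s, rfl⟩ := List.mem_ofFn.mp hx
          simp
        rw [this]
        simp
      · rw [Pi.single_eq_of_ne (Fin.succ_ne_zero r).symm, zpow_zero, one_mul]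
        refine Eq.trans ?_ (ih (fun s => y s.succ) r)
        congr 2
        funext s
        congr 1
        simp [Pi.single_apply]
  exact h m _ r

end EvalY

/-! ### The exchange relations as an abstract structure on a module -/

section Bernstein

variable {k V : Type*} [CommRing k] [AddCommGroup V] [Module k V]

/-- The relations of the affine Hecke algebra of `GL_m` between the finite generators `T_r`
(`r + 1 < m`) and the operators `Y_j` (`j < m`), in a module. -/
structure IsBernstein (t : kˣ) (m : ℕ) (T Y : ℕ → Module.End k V) : Prop where
  quad : ∀ r, r + 1 < m → ∀ v, T r (T r v) = ((t : k) - 1) • T r v + (t : k) • v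
  up : ∀ r, r + 1 < m → ∀ v, T r (Y r v) = Y (r + 1) (T r v + (1 - (t : k)) • v)
  down : ∀ r, r + 1 < m → ∀ v, T r (Y (r + 1) v) = Y r (T r v) + ((t : k) - 1) • Y (r + 1) v
  far : ∀ r j, r + 1 < m → j < m → j ≠ r → j ≠ r + 1 → ∀ v, T r (Y j v) = Y j (T r v)

/-- The inverse of `T_r`. -/
noncomputable def tInv (t : kˣ) (T : ℕ → Module.End k V) (r : ℕ) : Module.End k V :=
  ((t⁻¹ : kˣ) : k) • (T r + (1 - (t : k)) • 1)

/-- The product `T_{n-1}⁻¹ ⋯ T_0⁻¹`. -/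
noncomputable def descInv (t : kˣ) (T : ℕ → Module.End k V) : ℕ → Module.End k V
  | 0 => 1
  | n + 1 => tInv t T n * descInv t T n

/-- The product `T_0 ⋯ T_{n-1}`. -/
noncomputable def ascProd (T : ℕ → Module.End k V) : ℕ → Module.End k V
  | 0 => 1
  | n + 1 => ascProd T n * T n

theorem tInv_apply (t : kˣ) (T : ℕ → Module.End k V) (r : ℕ) (v : V) :
    tInv t T r v = ((t⁻¹ : kˣ) : k) • (T r v + (1 - (t : k)) • v) := rfl

theorem descInv_succ (t : kˣ) (T : ℕ → Module.End k V) (n : ℕ) (v : V) :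
    descInv t T (n + 1) v = tInv t T n (descInv t T n v) := rfl

theorem ascProd_succ (T : ℕ → Module.End k V) (n : ℕ) (v : V) :
    ascProd T (n + 1) v = ascProd T n (T n v) := rfl

variable {t : kˣ} {m : ℕ} {T Y : ℕ → Module.End k V}

namespace IsBernstein

variable (h : IsBernstein t m T Y)
include h

theorem tInv_T {r : ℕ} (hr : r + 1 < m) (v : V) : tInv t T r (T r v) = v := by
  rw [tInv_apply, h.quad r hr]
  have : ((t : k) - 1) • T r v + (t : k) • v + (1 - (t : k)) • T r v = (t : k) • v := by
    module
  rw [this, smul_smul, Units.inv_mul, one_smul]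

theorem T_tInv {r : ℕ} (hr : r + 1 < m) (v : V) : T r (tInv t T r v) = v := by
  rw [tInv_apply, map_smul, map_add, map_smul, h.quad r hr]
  have : ((t : k) - 1) • T r v + (t : k) • v + (1 - (t : k)) • T r v = (t : k) • v := by
    module
  rw [this, smul_smul, Units.inv_mul, one_smul]

theorem T_injective {r : ℕ} (hr : r + 1 < m) : Function.Injective (T r) :=
  Function.LeftInverse.injective (h.tInv_T hr)

theorem descInv_ascProd {n : ℕ} (hn : n ≤ m - 1) (v : V) : descInv t T n (ascProd T n v) = v := by
  induction n generalizing v with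
  | zero => rfl
  | succ n ih => rw [descInv_succ, ascProd_succ, ih (by omega), h.tInv_T (by omega)]

theorem Y_succ {r : ℕ} (hr : r + 1 < m) (v : V) :
    Y (r + 1) v = ((t⁻¹ : kˣ) : k) • T r (Y r (T r v)) := by
  rw [h.up r hr, h.quad r hr]
  have : ((t : k) - 1) • T r v + (t : k) • v + (1 - (t : k)) • T r v = (t : k) • v := by
    module
  rw [this, map_smul, smul_smul, Units.inv_mul, one_smul]

/-- `T_r⁻¹ Y_r = Y_{r+1} T_r⁻¹ + (t⁻¹ - 1) Y_r`. -/
theorem tInv_Y {r : ℕ} (hr : r + 1 < m) (v : V) :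
    tInv t T r (Y r v) = Y (r + 1) (tInv t T r v) + (((t⁻¹ : kˣ) : k) - 1) • Y r v := by
  rw [tInv_apply, h.up r hr, tInv_apply, map_smul, smul_add, smul_smul, mul_sub, Units.inv_mul,
    mul_one]

/-- `T_r⁻¹ Y_{r+1} = t⁻¹ Y_r T_r`. -/
theorem tInv_Y_succ {r : ℕ} (hr : r + 1 < m) (v : V) :
    tInv t T r (Y (r + 1) v) = ((t⁻¹ : kˣ) : k) • Y r (T r v) := by
  rw [tInv_apply, h.down r hr]
  congr 1
  module

theorem tInv_far {r j : ℕ} (hr : r + 1 < m) (hj : j < m) (h1 : j ≠ r) (h2 : j ≠ r + 1) (v : V) :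
    tInv t T r (Y j v) = Y j (tInv t T r v) := by
  rw [tInv_apply, h.far r j hr hj h1 h2, tInv_apply, map_smul, map_add, map_smul]

end IsBernstein

theorem tInv_eigen {r : ℕ} {v : V} (hv : T r v = (t : k) • v) :
    tInv t T r v = ((t⁻¹ : kˣ) : k) • v := by
  rw [tInv_apply, hv]
  congr 1
  module

/-- A linear map that intertwines the operators `Y_j` also intertwines the operators `T_r` on the
vectors generated from a vector where it does. -/
theorem IsBernstein.intertwine {V' : Type*} [AddCommGroup V'] [Module k V']
    {T' Y' : ℕ → Module.End k V'} (h : IsBernstein t m T Y) (h' : IsBernstein t m T' Y')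
    (f : V →ₗ[k] V') (hf : ∀ j < m, ∀ v, f (Y j v) = Y' j (f v)) {r : ℕ} (hr : r + 1 < m) {v : V}
    (hv : f (T r v) = T' r (f v)) {j : ℕ} (hj : j < m) : f (T r (Y j v)) = T' r (f (Y j v)) := by
  by_cases h1 : j = r
  · subst h1
    rw [h.up j hr, hf _ hr, hf _ hj, h'.up j hr, map_add, map_smul, hv]
  by_cases h2 : j = r + 1
  · subst h2
    rw [h.down r hr, hf _ hj, h'.down r hr, map_add, map_smul, hf _ (by omega), hf _ hj, hv]
  rw [h.far r j hr hj h1 h2, hf _ hj, hf _ hj, h'.far r j hr hj h1 h2, hv]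

end Bernstein

theorem varUnit_eq_varZ {k : Type*} [CommRing k] {m : ℕ} [NeZero m] (q : kˣ) (r : Fin m) :
    (varUnit r : (Laurent k m)ˣ) = varZ q (1 + (r : ℕ)) := by
  have := varZ_of (k := k) q r 0
  rw [mul_zero, add_zero] at this
  rw [add_comm, this]
  simp [scal]

/-! ### The level one representation: the families X and Y and the map q_(m) -/

section LevelOne

set_option linter.unusedSectionVars false

variable {k : Type*} [CommRing k] [IsDomain k] (q t : kˣ) (m : ℕ) [NeZero m]

/-- The operator `T_r` of the level one representation that exchanges the variables with indices
`r` and `r + 1`, counted from `0`. -/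
noncomputable def lT (r : ℕ) : Module.End k (Laurent k m) :=
  levelOne q t m (HeckeAlg.simple t m r : HeckeAlg t m)

/-- The operator `Y_r` of the level one representation, counted from `0`. -/
noncomputable def lY (r : ℕ) : Module.End k (Laurent k m) :=
  levelOne q t m (HeckeAlg.Y t m (r + 1) : HeckeAlg t m)

/-- The multiplication by the variable with index `r`, counted from `0`. -/
noncomputable def lX (r : ℕ) : Module.End k (Laurent k m) :=
  LinearMap.mulLeft k ((varZ q (1 + r) : (Laurent k m)ˣ) : Laurent k m)

variable {m}

theorem levelOne_mul (x y : HeckeAlg t m) (F : Laurent k m) :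
    levelOne q t m (x * y) F = levelOne q t m x (levelOne q t m y F) := by
  have : levelOne q t m (x * y) = levelOne q t m x * levelOne q t m y := map_mul _ _ _
  rw [this]; rfl

theorem levelOne_add (x y : HeckeAlg t m) (F : Laurent k m) :
    levelOne q t m (x + y) F = levelOne q t m x F + levelOne q t m y F := by
  have : levelOne q t m (x + y) = levelOne q t m x + levelOne q t m y := map_add _ _ _
  rw [this]; rfl

theorem levelOne_smul (c : k) (x : HeckeAlg t m) (F : Laurent k m) :
    levelOne q t m (c • x) F = c • levelOne q t m x F := by
  have : levelOne q t m (c • x) = c • levelOne q t m x := map_smul (levelOne q t m) c x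
  rw [this]; rfl

theorem levelOne_one (F : Laurent k m) : levelOne q t m (1 : HeckeAlg t m) F = F := by
  have : levelOne q t m (1 : HeckeAlg t m) = 1 := map_one _
  rw [this]; rfl

theorem levelOne_scalar (c : kˣ) (F : Laurent k m) :
    levelOne q t m (HeckeAlg.scalar t m c : HeckeAlg t m) F = (c : k) • F := by
  have : levelOne q t m (HeckeAlg.scalar t m c : HeckeAlg t m) = algebraMap k _ (c : k) :=
    (levelOne q t m).commutes _
  rw [this]; rfl

theorem levelOne_gen (g : HeckeGen m) :
    levelOne q t m (HeckeAlg.gen t g) = levelOneGen q t m g := by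
  rw [levelOne, HeckeAlg.gen]
  refine (RingQuot.liftAlgHom_mkAlgHom_apply k _ _ _).trans ?_
  exact FreeAlgebra.lift_ι_apply _ _

theorem levelOne_Pi (F : Laurent k m) :
    levelOne q t m (HeckeAlg.Pi t m : HeckeAlg t m) F = piFun q F :=
  DFunLike.congr_fun (levelOne_gen q t HeckeGen.Pi) F

theorem lT_apply {r : ℕ} (hr : r + 1 < m) (F : Laurent k m) :
    lT q t m r F = topFun q t ((1 + r : ℤ) : ZMod m) F := by
  rw [lT, HeckeAlg.simple, HeckeAlg.T_val t (by omega : 2 ≤ m), levelOne_gen]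
  rfl

theorem isBernstein_lY : IsBernstein t m (lT q t m) (lY q t m) where
  quad r hr v := by
    rw [lT, ← levelOne_mul]
    refine (congrArg (fun x => levelOne q t m x v) (HeckeAlg.T_sq t (by omega) _)).trans ?_
    rw [levelOne_add, levelOne_smul, levelOne_smul, levelOne_one]
  up r hr v := by
    rw [lT, lY, ← levelOne_mul]
    refine (congrArg (fun x => levelOne q t m x v) (HeckeAlg.simple_mul_Y t hr)).trans ?_
    rw [levelOne_mul, levelOne_add, levelOne_smul, levelOne_one]
    rfl
  down r hr v := by
    rw [lT, lY, lY, ← levelOne_mul]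
    refine (congrArg (fun x => levelOne q t m x v) (HeckeAlg.simple_mul_Y_succ t hr)).trans ?_
    rw [levelOne_add, levelOne_smul, levelOne_mul]
  far r j hr hj h1 h2 v := by
    rw [lT, lY, ← levelOne_mul, ← levelOne_mul]
    exact congrArg (fun x => levelOne q t m x v)
      (congrArg Units.val (HeckeAlg.simple_commute_Y t hr hj h1 h2).eq)

section simple

variable {r : ℕ} (hr : r + 1 < m)
include hr

theorem simple_index_ne_zero : ((1 + r : ℤ) : ZMod m) ≠ 0 := by
  have := HeckeAlg.intCast_ne (m := m) (a := 1 + r) (b := 0) (by omega) (by omega) (by omega)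
  simpa using this

theorem ratio_mul_varZ : (ratio q ((1 + r : ℤ) : ZMod m) : (Laurent k m)ˣ)
    * varZ q (1 + (r + 1 : ℕ)) = varZ q (1 + r) := by
  have e : (1 + (r + 1 : ℕ) : ℤ) = 1 + r + 1 := by push_cast; ring
  rw [ratio_cast, ratioZ, e, inv_mul_cancel_right]

theorem act_simple_varZ (j : ℤ) : act q (sperm m ((1 + r : ℤ) : ZMod m))
    ((varZ q j : (Laurent k m)ˣ) : Laurent k m)
      = (varZ q (sperm m ((1 + r : ℤ) : ZMod m) j) : (Laurent k m)ˣ) :=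
  act_unit_eq q (act_varZ q (sperm_isPer m _) j)

theorem sOp_simple_one : sOp q ((1 + r : ℤ) : ZMod m) (1 : Laurent k m) = 1 := by
  rw [sOp, pref, if_neg (simple_index_ne_zero hr)]
  simp

/-- Since s_r fixes 1, the divided difference vanishes. This makes 1 the common starting vector for
the families X and Y. -/
theorem lT_one : lT q t m r 1 = (t : k) • 1 := by
  rw [lT_apply q t hr]
  apply mul_left_cancel₀ (one_sub_ratio_ne_zero q (show 2 ≤ m by omega) ((1 + r : ℤ) : ZMod m))
  rw [topFun_key q (by omega), sOp_simple_one q hr, Algebra.smul_def]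
  ring

end simple

/-- After multiplication by 1 - X_i X_{i+1}⁻¹, the operator T_i becomes explicit (`topFun_key`), and
each relation is a linear combination of its defining identity. -/
theorem isBernstein_lX : IsBernstein t m (lT q t m) (lX q m) where
  quad := (isBernstein_lY q t).quad
  up r hr F := by
    rw [lT_apply q t hr, lT_apply q t hr]
    have hm : 2 ≤ m := by omega
    apply mul_left_cancel₀ (one_sub_ratio_ne_zero q hm ((1 + r : ℤ) : ZMod m))
    have h1 := topFun_key q hm t ((1 + r : ℤ) : ZMod m) F
    have h2 := congrArg Units.val (ratio_mul_varZ (k := k) q hr)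
    simp only [lX, LinearMap.mulLeft_apply, Units.val_mul] at h2 ⊢
    rw [topFun_key q hm, sOp_mul, act_simple_varZ q hr, sperm_left rfl]
    have e : (1 + (r + 1 : ℕ) : ℤ) = 1 + r + 1 := by push_cast; ring
    rw [e] at h2 ⊢
    simp only [Algebra.smul_def, map_sub, map_one]
    generalize topFun q t _ F = a at *
    linear_combination
      -((varZ q (1 + r + 1) : (Laurent k m)ˣ) : Laurent k m) * h1
      - (algebraMap k (Laurent k m) t - 1) * F * h2
  down r hr F := by
    rw [lT_apply q t hr, lT_apply q t hr]
    have hm : 2 ≤ m := by omega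
    apply mul_left_cancel₀ (one_sub_ratio_ne_zero q hm ((1 + r : ℤ) : ZMod m))
    have h1 := topFun_key q hm t ((1 + r : ℤ) : ZMod m) F
    have h2 := congrArg Units.val (ratio_mul_varZ (k := k) q hr)
    simp only [lX, LinearMap.mulLeft_apply, Units.val_mul] at h2 ⊢
    have e : (1 + (r + 1 : ℕ) : ℤ) = 1 + r + 1 := by push_cast; ring
    rw [topFun_key q hm, sOp_mul, act_simple_varZ q hr, e, sperm_right hm (by push_cast; ring),
      add_sub_cancel_right]
    rw [e] at h2
    simp only [Algebra.smul_def, map_sub, map_one]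
    generalize topFun q t _ F = a at *
    linear_combination
      -((varZ q (1 + r) : (Laurent k m)ˣ) : Laurent k m) * h1
      + (algebraMap k (Laurent k m) t - 1) * F * h2
  far r j hr hj h1 h2 F := by
    rw [lT_apply q t hr, lT_apply q t hr]
    have hm : 2 ≤ m := by omega
    apply mul_left_cancel₀ (one_sub_ratio_ne_zero q hm ((1 + r : ℤ) : ZMod m))
    have h3 := topFun_key q hm t ((1 + r : ℤ) : ZMod m) F
    simp only [lX, LinearMap.mulLeft_apply]
    rw [topFun_key q hm, sOp_mul, act_simple_varZ q hr, sperm_other]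
    · linear_combination -((varZ q (1 + j) : (Laurent k m)ˣ) : Laurent k m) * h3
    · exact HeckeAlg.intCast_ne (by omega) (by omega) (by omega)
    · have := HeckeAlg.intCast_ne (m := m) (a := 1 + j) (b := 1 + r + 1) (by omega) (by omega)
        (by omega)
      simpa using this

theorem levelOne_simple_inv {r : ℕ} (hr : r + 1 < m) (F : Laurent k m) :
    levelOne q t m ((HeckeAlg.simple t m r)⁻¹ : (HeckeAlg t m)ˣ) F = tInv t (lT q t m) r F := by
  apply (isBernstein_lY q t).T_injective hr
  rw [(isBernstein_lY q t).T_tInv hr, lT, ← levelOne_mul, Units.mul_inv, levelOne_one]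

theorem levelOne_descTInv {n : ℕ} (hn : n ≤ m - 1) (F : Laurent k m) :
    levelOne q t m (HeckeAlg.descTInv t m 1 n : (HeckeAlg t m)ˣ) F
      = descInv t (lT q t m) n F := by
  induction n with
  | zero => exact levelOne_one q t F
  | succ n ih =>
    rw [HeckeAlg.descTInv, Units.val_mul, levelOne_mul, ih (by omega), descInv_succ,
      ← levelOne_simple_inv q t (by omega)]

theorem lY_zero (F : Laurent k m) :
    lY q t m 0 F = (t : k) ^ (m - 1) • piFun q (descInv t (lT q t m) (m - 1) F) := by
  have h := congrArg Units.val (HeckeAlg.Y_one_eq t (m := m))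
  rw [lY]
  refine (congrArg (fun x => levelOne q t m x F) h).trans ?_
  have e := HeckeAlg.descTInv_eq t (m := m) 1 (m - 1)
  change levelOne q t m (((_ : (HeckeAlg t m)ˣ) : HeckeAlg t m)) F = _
  rw [← e, Units.val_mul, Units.val_mul, levelOne_mul, levelOne_mul, levelOne_scalar, levelOne_Pi,
    levelOne_descTInv q t le_rfl]
  simp

/-- The definition of Y_1 is solved for Π, so that stability under the T_r and Y_1 gives stability
under Π. -/
theorem piFun_eq (F : Laurent k m) :
    piFun q F = ((t⁻¹ : kˣ) : k) ^ (m - 1) • lY q t m 0 (ascProd (lT q t m) (m - 1) F) := by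
  rw [lY_zero, (isBernstein_lY q t).descInv_ascProd le_rfl, smul_smul, ← mul_pow, Units.inv_mul,
    one_pow, one_smul]

section qMap

variable (F G : Laurent k m)

theorem qMap_apply : qMap q t m F = levelOne q t m (evalY t m F) 1 := rfl

theorem qMap_mul : qMap q t m (F * G) = levelOne q t m (evalY t m F) (qMap q t m G) := by
  rw [qMap_apply, qMap_apply, evalY_mul, levelOne_mul]

theorem qMap_one : qMap q t m 1 = 1 := by
  rw [qMap_apply, evalY_one, levelOne_one]

theorem qMap_varUnit_mul (r : Fin m) :
    qMap q t m (((varUnit r : (Laurent k m)ˣ) : Laurent k m) * F) = lY q t m r (qMap q t m F) := by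
  rw [qMap_mul, evalY_varUnit, lY]

/-- Together with the value at 1, this recursion replaces the definition of q_(m) in the polynomial
arguments below. -/
theorem qMap_lX {r : ℕ} (hr : r < m) : qMap q t m (lX q m r F) = lY q t m r (qMap q t m F) := by
  rw [← qMap_varUnit_mul q t F ⟨r, hr⟩, varUnit_eq_varZ q]
  rfl

theorem qMap_varUnit_inv_mul (r : Fin m) :
    qMap q t m ((((varUnit r)⁻¹ : (Laurent k m)ˣ) : Laurent k m) * F)
      = levelOne q t m ((HeckeAlg.Y t m (r + 1))⁻¹ : (HeckeAlg t m)ˣ) (qMap q t m F) := by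
  conv_rhs => rw [← Units.mul_inv_cancel_left (varUnit r : (Laurent k m)ˣ) F, qMap_varUnit_mul, lY,
    ← levelOne_mul, Units.inv_mul, levelOne_one]

end qMap

/-- Induction on Laurent polynomials through products of variables and their inverses. -/
theorem laurent_induction {p : Laurent k m → Prop} (one : p 1)
    (add : ∀ F G, p F → p G → p (F + G)) (smul : ∀ (c : k) F, p F → p (c • F))
    (mul : ∀ (r : Fin m) F, p F → p ((varUnit r : (Laurent k m)ˣ) * F))
    (inv_mul : ∀ (r : Fin m) F, p F → p (((varUnit r)⁻¹ : (Laurent k m)ˣ) * F))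
    (F : Laurent k m) : p F := by
  -- The units whose multiplication preserves `p` form a submonoid. It contains every monomial as
  -- soon as it contains the variables and their inverses.
  let S : Submonoid (Laurent k m)ˣ :=
    { carrier := {u | ∀ F, p F → p ((u : Laurent k m) * F)}
      one_mem' := fun F hF => by simpa using hF
      mul_mem' := fun {u v} hu hv F hF => by
        rw [Units.val_mul, mul_assoc]; exact hu _ (hv _ hF) }
  have hz : ∀ (r : Fin m) (n : ℤ), varUnit r ^ n ∈ S := by
    intro r n
    obtain ⟨l, rfl | rfl⟩ := n.eq_nat_or_neg
    · rw [zpow_natCast]; exact S.pow_mem (mul r) l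
    · rw [zpow_neg, zpow_natCast, ← inv_pow]; exact S.pow_mem (inv_mul r) l
  induction F using AddMonoidAlgebra.induction_linear with
  | zero => simpa using smul 0 1 one
  | add F G hF hG => exact add F G hF hG
  | single a c =>
    have h1 : (monoUnit a : (Laurent k m)ˣ) ∈ S := by
      rw [monoUnit_eq_prod]; exact S.prod_mem fun r _ => hz r _
    have h2 := smul c _ (h1 1 one)
    simpa [monoUnit] using h2

end LevelOne

/-! ### Polynomials: induction, degrees, embedding in Laurent polynomials -/

section PolyBasics

open MvPolynomial

variable {k : Type*} [CommRing k] {m : ℕ}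

/-- The variable with index `r`, counted from `0`; it is `0` if there is no such variable. -/
noncomputable def pvar (k : Type*) [CommRing k] (m r : ℕ) : MvPolynomial (Fin m) k :=
  if h : r < m then X ⟨r, h⟩ else 0

theorem pvar_of_lt {r : ℕ} (h : r < m) : pvar k m r = X ⟨r, h⟩ := dif_pos h

theorem X_eq_pvar (r : Fin m) : (X r : MvPolynomial (Fin m) k) = pvar k m r :=
  (pvar_of_lt r.2).symm

theorem isHomogeneous_pvar (r : ℕ) : (pvar k m r).IsHomogeneous 1 := by
  unfold pvar
  split_ifs
  · exact isHomogeneous_X _ _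
  · exact isHomogeneous_zero _ _ _

theorem poly_induction {p : MvPolynomial (Fin m) k → Prop} (one : p 1)
    (add : ∀ F G, p F → p G → p (F + G)) (smul : ∀ (c : k) F, p F → p (c • F))
    (mul : ∀ j < m, ∀ F, p F → p (pvar k m j * F)) (F : MvPolynomial (Fin m) k) : p F := by
  induction F using MvPolynomial.induction_on with
  | C a => rw [← mul_one (C a), ← smul_eq_C_mul]; exact smul a 1 one
  | add F G hF hG => exact add F G hF hG
  | mul_X F r hF => rw [mul_comm, X_eq_pvar]; exact mul r r.2 F hF

theorem monomial_induction {p : ℕ → MvPolynomial (Fin m) k → Prop} (const : ∀ c, p 0 (C c))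
    (mul : ∀ j < m, ∀ n F, F.IsHomogeneous n → p n F → p (n + 1) (pvar k m j * F)) (n : ℕ) :
    ∀ (a : Fin m →₀ ℕ) (c : k), a.degree = n → p n (monomial a c) := by
  induction n with
  | zero =>
    intro a c ha
    rw [Finsupp.degree_eq_zero_iff] at ha
    subst ha
    exact const c
  | succ n ih =>
    intro a c ha
    obtain ⟨j, hj⟩ : ∃ j, a j ≠ 0 := by
      by_contra hcon
      push Not at hcon
      have : a = 0 := Finsupp.ext hcon
      simp [this] at ha
    have hle : Finsupp.single j 1 ≤ a := by
      rw [Finsupp.single_le_iff]; exact Nat.one_le_iff_ne_zero.mpr hj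
    have e : a = Finsupp.single j 1 + (a - Finsupp.single j 1) := by
      rw [add_tsub_cancel_of_le hle]
    have hd : (a - Finsupp.single j 1).degree = n := by
      have := congrArg Finsupp.degree e
      rw [map_add, Finsupp.degree_single, ha] at this
      omega
    have e2 : monomial a c = pvar k m j * monomial (a - Finsupp.single j 1) c := by
      rw [← X_eq_pvar, X, monomial_mul, one_mul, ← e]
    rw [e2]
    exact mul j j.2 n _ (isHomogeneous_monomial c hd) (ih _ c hd)

/-- An induction principle for homogeneous polynomials. -/
theorem homogeneous_induction {p : ℕ → MvPolynomial (Fin m) k → Prop} (const : ∀ c, p 0 (C c))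
    (zero : ∀ n, p n 0) (add : ∀ n F G, p n F → p n G → p n (F + G))
    (mul : ∀ j < m, ∀ n F, F.IsHomogeneous n → p n F → p (n + 1) (pvar k m j * F)) {n : ℕ}
    {F : MvPolynomial (Fin m) k} (hF : F.IsHomogeneous n) : p n F := by
  rw [F.as_sum]
  refine Finset.sum_induction _ (p n) (add n) (zero n) fun a ha => ?_
  refine monomial_induction const mul n a _ ?_
  by_contra hcon
  exact (mem_support_iff.mp ha) (hF.coeff_eq_zero hcon)

theorem homogeneousComponent_comm {m' : ℕ} (f : MvPolynomial (Fin m) k →ₗ[k] MvPolynomial (Fin m') k)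
    (hf : ∀ n F, F.IsHomogeneous n → (f F).IsHomogeneous n) (n : ℕ) (F : MvPolynomial (Fin m) k) :
    homogeneousComponent n (f F) = f (homogeneousComponent n F) := by
  have : homogeneousComponent n ∘ₗ f = f ∘ₗ homogeneousComponent n := by
    refine MvPolynomial.linearMap_ext fun a => ?_
    ext1
    have h1 : (monomial a (1 : k)).IsHomogeneous a.degree := isHomogeneous_monomial 1 rfl
    simp only [LinearMap.comp_apply]
    rw [homogeneousComponent_of_mem (hf _ _ h1), homogeneousComponent_of_mem h1]
    split_ifs
    · rfl
    · rw [map_zero]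
  exact LinearMap.congr_fun this F

/-- A surjective linear endomorphism of a polynomial ring that preserves degrees is injective. -/
theorem injective_of_surjective_of_homogeneous
    (f : MvPolynomial (Fin m) k →ₗ[k] MvPolynomial (Fin m) k)
    (hf : ∀ n F, F.IsHomogeneous n → (f F).IsHomogeneous n) (hs : Function.Surjective f) :
    Function.Injective f := by
  have hn : ∀ n F, F.IsHomogeneous n → f F = 0 → F = 0 := by
    intro n F hF h0
    have : Module.Finite k (homogeneousSubmodule (Fin m) k n) :=
      Module.Finite.iff_fg.mpr (homogeneousSubmodule_fg (Fin m) k n)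
    let g : homogeneousSubmodule (Fin m) k n →ₗ[k] homogeneousSubmodule (Fin m) k n :=
      f.restrict fun F hF => hf n F hF
    have hg : Function.Surjective g := by
      rintro ⟨G, hG⟩
      obtain ⟨F, rfl⟩ := hs G
      refine ⟨⟨homogeneousComponent n F, homogeneousComponent_isHomogeneous n F⟩, ?_⟩
      ext1
      change f (homogeneousComponent n F) = f F
      rw [← homogeneousComponent_comm f hf, homogeneousComponent_eq_self hG]
    -- The homogeneous piece is a finite module, and over any commutative ring a surjective
    -- endomorphism of such a module is injective. No field is needed, which matters for the
    -- specialization at q = 1.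
    have hi := OrzechProperty.injective_of_surjective_endomorphism g hg
    have h1 : g ⟨F, hF⟩ = g 0 := by
      ext1
      rw [map_zero]
      exact h0
    exact congrArg Subtype.val (hi h1)
  rw [injective_iff_map_eq_zero]
  intro F h0
  rw [← sum_homogeneousComponent F]
  refine Finset.sum_eq_zero fun n _ => hn n _ (homogeneousComponent_isHomogeneous n F) ?_
  rw [← homogeneousComponent_comm f hf, h0, map_zero]

theorem totalDegree_le_of_homogeneous {m' : ℕ}
    (f : MvPolynomial (Fin m) k →ₗ[k] MvPolynomial (Fin m') k)
    (hf : ∀ n F, F.IsHomogeneous n → (f F).IsHomogeneous n) (F : MvPolynomial (Fin m) k) :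
    (f F).totalDegree ≤ F.totalDegree := by
  conv_lhs => rw [← sum_homogeneousComponent F, map_sum]
  refine totalDegree_finsetSum_le fun n hn => ?_
  refine (hf n _ (homogeneousComponent_isHomogeneous n F)).totalDegree_le.trans ?_
  exact Nat.lt_succ_iff.mp (Finset.mem_range.mp hn)

theorem toLaurent_monomial (a : Fin m →₀ ℕ) (c : k) :
    toLaurent k m (monomial a c) = AddMonoidAlgebra.single (fun i => (a i : ℤ)) c := by
  have h1 := congrArg Units.val (monoUnit_eq_prod (k := k) fun i : Fin m => (a i : ℤ))
  rw [toLaurent, aeval_monomial, Finsupp.prod_fintype _ _ fun i => pow_zero _]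
  simp only [zpow_natCast, Units.coe_prod, Units.val_pow_eq_pow_val] at h1
  rw [← h1]
  simp [monoUnit]

/-- A left inverse of the inclusion of the polynomial ring in the Laurent polynomial ring. -/
noncomputable def fromLaurent (k : Type*) [CommRing k] (m : ℕ) :
    Laurent k m →ₗ[k] MvPolynomial (Fin m) k :=
  (Finsupp.linearCombination k fun a : Fin m → ℤ =>
    monomial (Finsupp.equivFunOnFinite.symm fun i => (a i).toNat) 1) ∘ₗ
      (AddMonoidAlgebra.coeffLinearEquiv k).toLinearMap

theorem fromLaurent_toLaurent (F : MvPolynomial (Fin m) k) :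
    fromLaurent k m (toLaurent k m F) = F := by
  have : fromLaurent k m ∘ₗ (toLaurent k m).toLinearMap = LinearMap.id := by
    refine MvPolynomial.linearMap_ext fun a => ?_
    ext1
    simp only [LinearMap.comp_apply, AlgHom.toLinearMap_apply, toLaurent_monomial, fromLaurent,
      LinearEquiv.coe_coe, LinearMap.id_apply, AddMonoidAlgebra.coeffLinearEquiv_apply,
      AddMonoidAlgebra.coeff_single, Finsupp.linearCombination_single, one_smul, Int.toNat_natCast]
    rw [show (Finsupp.equivFunOnFinite.symm fun i => a i) = a from Finsupp.ext fun _ => rfl]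
  exact LinearMap.congr_fun this F

theorem toLaurent_injective : Function.Injective (toLaurent k m) :=
  Function.LeftInverse.injective fromLaurent_toLaurent

theorem toLaurent_pvar [NeZero m] (q : kˣ) {r : ℕ} (h : r < m) :
    toLaurent k m (pvar k m r) = ((varZ q (1 + r) : (Laurent k m)ˣ) : Laurent k m) := by
  rw [pvar_of_lt h, toLaurent, aeval_X, varUnit_eq_varZ q]

end PolyBasics

/-! ### Transfer of the exchange relations along linear maps -/

section Transfer

variable {k V V' : Type*} [CommRing k] [AddCommGroup V] [Module k V] [AddCommGroup V'] [Module k V']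
  {t : kˣ} {m : ℕ} {T Y : ℕ → Module.End k V} {T' Y' : ℕ → Module.End k V'}

theorem IsBernstein.of_injective (h : IsBernstein t m T' Y') (f : V →ₗ[k] V')
    (hf : Function.Injective f) (hT : ∀ r, r + 1 < m → ∀ v, f (T r v) = T' r (f v))
    (hY : ∀ j, j < m → ∀ v, f (Y j v) = Y' j (f v)) : IsBernstein t m T Y where
  quad r hr v := hf <| by
    rw [hT r hr, hT r hr, h.quad r hr, map_add, map_smul, map_smul, hT r hr]
  up r hr v := hf <| by
    rw [hT r hr, hY r (by omega), h.up r hr, hY _ hr, map_add f, map_smul f, hT r hr]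
  down r hr v := hf <| by
    rw [hT r hr, hY _ hr, h.down r hr, map_add, map_smul, hY _ hr, hY r (by omega), hT r hr]
  far r j hr hj h1 h2 v := hf <| by
    rw [hT r hr, hY _ hj, h.far r j hr hj h1 h2, hY _ hj, hT r hr]

theorem map_tInv (f : V →ₗ[k] V') {r : ℕ} (hT : ∀ v, f (T r v) = T' r (f v)) (v : V) :
    f (tInv t T r v) = tInv t T' r (f v) := by
  rw [tInv_apply, tInv_apply, map_smul, map_add, map_smul, hT]

theorem map_descInv (f : V →ₗ[k] V') (hT : ∀ r, r + 1 < m → ∀ v, f (T r v) = T' r (f v)) {n : ℕ}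
    (hn : n ≤ m - 1) (v : V) : f (descInv t T n v) = descInv t T' n (f v) := by
  induction n with
  | zero => rfl
  | succ n ih =>
    rw [descInv_succ, descInv_succ, map_tInv f (hT n (by omega)), ih (by omega)]

end Transfer

/-! ### The operators on polynomials, and bijectivity of q_(m) there -/

section PolyOps

open MvPolynomial

set_option linter.unusedSectionVars false

variable {k : Type*} [CommRing k] [IsDomain k] (q t : kˣ) (m : ℕ) [NeZero m]

/-- The operator `T_r` on polynomials. -/
noncomputable def pT (r : ℕ) : Module.End k (MvPolynomial (Fin m) k) :=
  fromLaurent k m ∘ₗ lT q t m r ∘ₗ (toLaurent k m).toLinearMap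

/-- The operator `Y_r` on polynomials. -/
noncomputable def pY (r : ℕ) : Module.End k (MvPolynomial (Fin m) k) :=
  fromLaurent k m ∘ₗ lY q t m r ∘ₗ (toLaurent k m).toLinearMap

/-- The map `F ↦ F(Y) • 1` on polynomials. -/
noncomputable def qPoly : Module.End k (MvPolynomial (Fin m) k) :=
  fromLaurent k m ∘ₗ qMap q t m ∘ₗ (toLaurent k m).toLinearMap

/-- The multiplication by the variable with index `r`. -/
noncomputable def pX (k : Type*) [CommRing k] (m r : ℕ) : Module.End k (MvPolynomial (Fin m) k) :=
  LinearMap.mulLeft k (pvar k m r)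

/-- The substitution `F ↦ F(X_2, …, X_m, q⁻¹ X_1)`. -/
noncomputable def shift : MvPolynomial (Fin m) k →ₐ[k] MvPolynomial (Fin m) k :=
  aeval fun r => if (r : ℕ) + 1 < m then pvar k m (r + 1) else C ((q⁻¹ : kˣ) : k) * pvar k m 0

/-- The substitution inverse to `shift`. -/
noncomputable def unshift : MvPolynomial (Fin m) k →ₐ[k] MvPolynomial (Fin m) k :=
  aeval fun r => if (r : ℕ) = 0 then C (q : k) * pvar k m (m - 1) else pvar k m (r - 1)

/-- The operator `Π` on polynomials. -/
noncomputable def pPi : Module.End k (MvPolynomial (Fin m) k) :=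
  LinearMap.mulLeft k (pvar k m 0) ∘ₗ (shift q m).toLinearMap

variable {m}

theorem pPi_apply (F : MvPolynomial (Fin m) k) : pPi q m F = pvar k m 0 * shift q m F := rfl

theorem pX_apply (r : ℕ) (F : MvPolynomial (Fin m) k) : pX k m r F = pvar k m r * F := rfl

theorem pos_m : 0 < m := Nat.pos_of_ne_zero (NeZero.ne m)

theorem shift_pvar {r : ℕ} (hr : r + 1 < m) : shift q m (pvar k m r) = pvar k m (r + 1) := by
  rw [pvar_of_lt (by omega : r < m), shift, aeval_X, if_pos hr]

theorem shift_pvar_last {r : ℕ} (hr : r + 1 = m) :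
    shift q m (pvar k m r) = C ((q⁻¹ : kˣ) : k) * pvar k m 0 := by
  rw [pvar_of_lt (by omega : r < m), shift, aeval_X, if_neg (by simp [hr])]

theorem unshift_pvar_zero : unshift q m (pvar k m 0) = C (q : k) * pvar k m (m - 1) := by
  rw [pvar_of_lt pos_m, unshift, aeval_X, if_pos rfl]

theorem unshift_pvar_succ {r : ℕ} (hr : r + 1 < m) : unshift q m (pvar k m (r + 1)) = pvar k m r := by
  rw [pvar_of_lt hr, unshift, aeval_X, if_neg (by simp)]
  simp

theorem shift_unshift (F : MvPolynomial (Fin m) k) : shift q m (unshift q m F) = F := by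
  have : (shift q m).comp (unshift q m) = AlgHom.id k (MvPolynomial (Fin m) k) := by
    apply MvPolynomial.algHom_ext
    intro r
    rw [AlgHom.comp_apply, X_eq_pvar, AlgHom.id_apply]
    have hm := pos_m (m := m)
    rcases r with ⟨_ | r, hr⟩
    · simp only
      rw [unshift_pvar_zero, map_mul, shift_pvar_last q (by omega), ← algebraMap_eq,
        AlgHom.commutes, ← mul_assoc, ← map_mul, Units.mul_inv, map_one, one_mul]
    · simp only
      rw [unshift_pvar_succ q hr, shift_pvar q hr]
  exact AlgHom.congr_fun this F

theorem toLaurent_shift (F : MvPolynomial (Fin m) k) :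
    toLaurent k m (shift q m F) = act q (fun j => j + 1) (toLaurent k m F) := by
  have : (toLaurent k m).comp (shift q m) = (act q fun j => j + 1).comp (toLaurent k m) := by
    apply MvPolynomial.algHom_ext
    intro r
    have e := act_unit_eq q (act_varZ (k := k) q (shift_isPer m 1) (1 + (r : ℕ)))
    rw [AlgHom.comp_apply, AlgHom.comp_apply, X_eq_pvar, toLaurent_pvar q r.2, e]
    by_cases hr : (r : ℕ) + 1 < m
    · rw [shift_pvar q hr, toLaurent_pvar q hr]
      push_cast
      rw [add_assoc]
    · have hr' : (r : ℕ) + 1 = m := by omega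
      rw [shift_pvar_last q hr', map_mul, toLaurent_pvar q pos_m, ← algebraMap_eq, AlgHom.commutes]
      have e2 : (1 + (r : ℕ) + 1 : ℤ) = 1 + (0 : ℕ) + m * 1 := by
        have : ((r : ℕ) : ℤ) + 1 = m := by exact_mod_cast hr'
        push_cast
        linarith
      rw [e2, varZ_add, Units.val_mul]
      congr 1
      simp [scal]
  exact AlgHom.congr_fun this F

theorem toLaurent_pPi (F : MvPolynomial (Fin m) k) :
    toLaurent k m (pPi q m F) = piFun q (toLaurent k m F) := by
  rw [pPi_apply, map_mul, toLaurent_shift, toLaurent_pvar q pos_m, piFun]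
  simp

theorem toLaurent_pX {r : ℕ} (hr : r < m) (F : MvPolynomial (Fin m) k) :
    toLaurent k m (pX k m r F) = lX q m r (toLaurent k m F) := by
  rw [pX_apply, map_mul, toLaurent_pvar q hr]
  rfl

/-- An operator defined through `fromLaurent` agrees with the Laurent operator only where the latter
yields a polynomial; this isolates that condition. -/
theorem toLaurent_lift (f : Module.End k (Laurent k m)) {F : MvPolynomial (Fin m) k}
    (h : f (toLaurent k m F) ∈ LinearMap.range (toLaurent k m).toLinearMap) :
    toLaurent k m ((fromLaurent k m ∘ₗ f ∘ₗ (toLaurent k m).toLinearMap) F)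
      = f (toLaurent k m F) := by
  obtain ⟨G, hG⟩ := h
  simp only [LinearMap.comp_apply, AlgHom.toLinearMap_apply] at hG ⊢
  rw [← hG, fromLaurent_toLaurent]

theorem lX_mem_range {r : ℕ} (hr : r < m) {F : Laurent k m}
    (hF : F ∈ LinearMap.range (toLaurent k m).toLinearMap) :
    lX q m r F ∈ LinearMap.range (toLaurent k m).toLinearMap := by
  obtain ⟨G, rfl⟩ := hF
  exact ⟨pX k m r G, toLaurent_pX q hr G⟩

/-- The exchange relations with the X_j reduce the polynomiality of T_r F to factors of lower
degree, and finally to the eigenvector 1. -/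
theorem toLaurent_pT {r : ℕ} (hr : r + 1 < m) (F : MvPolynomial (Fin m) k) :
    toLaurent k m (pT q t m r F) = lT q t m r (toLaurent k m F) := by
  apply toLaurent_lift
  have h := isBernstein_lX (k := k) q t (m := m)
  induction F using poly_induction with
  | one => rw [map_one, lT_one q t hr]; exact Submodule.smul_mem _ _ ⟨1, map_one (toLaurent k m)⟩
  | add F G hF hG => rw [map_add, map_add]; exact Submodule.add_mem _ hF hG
  | smul c F hF => rw [map_smul, map_smul]; exact Submodule.smul_mem _ _ hF
  | mul j hj F hF =>
    have hF' : toLaurent k m F ∈ LinearMap.range (toLaurent k m).toLinearMap := ⟨F, rfl⟩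
    rw [← pX_apply, toLaurent_pX q hj]
    by_cases h1 : j = r
    · subst h1
      rw [h.up j hr]
      exact lX_mem_range q hr (Submodule.add_mem _ hF (Submodule.smul_mem _ _ hF'))
    by_cases h2 : j = r + 1
    · subst h2
      rw [h.down r hr]
      exact Submodule.add_mem _ (lX_mem_range q (by omega) hF)
        (Submodule.smul_mem _ _ (lX_mem_range q hr hF'))
    · rw [h.far r j hr hj h1 h2]
      exact lX_mem_range q hj hF

theorem isBernstein_pX : IsBernstein t m (pT q t m) (pX k m) :=
  (isBernstein_lX q t).of_injective (toLaurent k m).toLinearMap toLaurent_injective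
    (fun _ hr => toLaurent_pT q t hr) fun _ hj => toLaurent_pX q hj

/-- Both Π and the T_r⁻¹ preserve polynomials, hence so does Y_0; the recursion Y_{r+1} = t⁻¹ T_r
Y_r T_r does the rest. -/
theorem toLaurent_pY {r : ℕ} (hr : r < m) (F : MvPolynomial (Fin m) k) :
    toLaurent k m (pY q t m r F) = lY q t m r (toLaurent k m F) := by
  apply toLaurent_lift
  induction r generalizing F with
  | zero =>
    have e := map_descInv (t := t) (toLaurent k m).toLinearMap (fun _ hr => toLaurent_pT q t hr)
      le_rfl F
    simp only [AlgHom.toLinearMap_apply] at e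
    rw [lY_zero, ← e, ← toLaurent_pPi]
    exact Submodule.smul_mem _ _ ⟨_, rfl⟩
  | succ r ih =>
    rw [(isBernstein_lY q t).Y_succ hr]
    refine Submodule.smul_mem _ _ ?_
    rw [← toLaurent_pT q t hr]
    obtain ⟨G, hG⟩ := ih (by omega) (pT q t m r F)
    rw [← hG]
    exact ⟨pT q t m r G, toLaurent_pT q t hr G⟩

theorem isBernstein_pY : IsBernstein t m (pT q t m) (pY q t m) :=
  (isBernstein_lY q t).of_injective (toLaurent k m).toLinearMap toLaurent_injective
    (fun _ hr => toLaurent_pT q t hr) fun _ hj => toLaurent_pY q t hj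

theorem toLaurent_qPoly (F : MvPolynomial (Fin m) k) :
    toLaurent k m (qPoly q t m F) = qMap q t m (toLaurent k m F) := by
  apply toLaurent_lift
  induction F using poly_induction with
  | one => rw [map_one, qMap_one]; exact ⟨1, map_one (toLaurent k m)⟩
  | add F G hF hG => rw [map_add, map_add]; exact Submodule.add_mem _ hF hG
  | smul c F hF => rw [map_smul, map_smul]; exact Submodule.smul_mem _ _ hF
  | mul j hj F hF =>
    rw [← pX_apply, toLaurent_pX q hj, qMap_lX q t _ hj]
    obtain ⟨G, hG⟩ := hF
    rw [← hG]
    exact ⟨pY q t m j G, toLaurent_pY q t hj G⟩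

theorem qPoly_one : qPoly q t m 1 = 1 := by
  apply toLaurent_injective
  rw [toLaurent_qPoly, map_one, qMap_one]

theorem qPoly_pX {j : ℕ} (hj : j < m) (F : MvPolynomial (Fin m) k) :
    qPoly q t m (pX k m j F) = pY q t m j (qPoly q t m F) := by
  apply toLaurent_injective
  rw [toLaurent_qPoly, toLaurent_pX q hj, qMap_lX q t _ hj, toLaurent_pY q t hj, toLaurent_qPoly]

theorem pT_one {r : ℕ} (hr : r + 1 < m) : pT q t m r 1 = (t : k) • 1 := by
  apply toLaurent_injective
  rw [toLaurent_pT q t hr, map_one, lT_one q t hr, map_smul, map_one]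

/-- The families X and Y obey the same relations with the T_r and start from the same eigenvector 1.
So commutation with T_r passes from F to X_j F. -/
theorem qPoly_pT {r : ℕ} (hr : r + 1 < m) (F : MvPolynomial (Fin m) k) :
    qPoly q t m (pT q t m r F) = pT q t m r (qPoly q t m F) := by
  induction F using poly_induction with
  | one => rw [pT_one q t hr, map_smul, qPoly_one, pT_one q t hr]
  | add F G hF hG => simp only [map_add, hF, hG]
  | smul c F hF => simp only [map_smul, hF]
  | mul j hj F hF =>
    exact (isBernstein_pX q t).intertwine (isBernstein_pY q t) (qPoly q t m)
      (fun j hj F => qPoly_pX q t hj F) hr hF hj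

theorem pY_zero (F : MvPolynomial (Fin m) k) :
    pY q t m 0 F = (t : k) ^ (m - 1) • pPi q m (descInv t (pT q t m) (m - 1) F) := by
  apply toLaurent_injective
  have e := map_descInv (t := t) (toLaurent k m).toLinearMap (fun _ hr => toLaurent_pT q t hr)
    le_rfl F
  simp only [AlgHom.toLinearMap_apply] at e
  rw [toLaurent_pY q t pos_m, lY_zero, map_smul, toLaurent_pPi, e]

theorem pPi_eq (F : MvPolynomial (Fin m) k) :
    pPi q m F = ((t⁻¹ : kˣ) : k) ^ (m - 1) • pY q t m 0 (ascProd (pT q t m) (m - 1) F) := by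
  rw [pY_zero, (isBernstein_pY q t).descInv_ascProd le_rfl, smul_smul, ← mul_pow, Units.inv_mul,
    one_pow, one_smul]

/-! ### Homogeneity of the operators -/

section Homogeneous

variable {n : ℕ} {F : MvPolynomial (Fin m) k}

theorem isHomogeneous_smul (hF : F.IsHomogeneous n) (c : k) : (c • F).IsHomogeneous n :=
  (homogeneousSubmodule (Fin m) k n).smul_mem c hF

theorem isHomogeneous_pvar_mul (hF : F.IsHomogeneous n) (j : ℕ) :
    (pvar k m j * F).IsHomogeneous (n + 1) := by
  rw [add_comm]; exact (isHomogeneous_pvar j).mul hF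

theorem isHomogeneous_pT {r : ℕ} (hr : r + 1 < m) (hF : F.IsHomogeneous n) :
    (pT q t m r F).IsHomogeneous n := by
  have h := isBernstein_pX (k := k) q t (m := m)
  refine homogeneous_induction (p := fun n F => (pT q t m r F).IsHomogeneous n) ?_ ?_ ?_ ?_ hF
  · intro c
    rw [← mul_one (C c), ← smul_eq_C_mul, map_smul, pT_one q t hr]
    exact isHomogeneous_smul (isHomogeneous_smul (isHomogeneous_one _ _) _) _
  · intro n; rw [map_zero]; exact isHomogeneous_zero _ _ _
  · intro n F G hF hG; rw [map_add]; exact hF.add hG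
  · intro j hj n F hF ih
    rw [← pX_apply]
    by_cases h1 : j = r
    · subst h1
      rw [h.up j hr]
      exact isHomogeneous_pvar_mul (ih.add (isHomogeneous_smul hF _)) _
    by_cases h2 : j = r + 1
    · subst h2
      rw [h.down r hr]
      exact (isHomogeneous_pvar_mul ih _).add (isHomogeneous_smul (isHomogeneous_pvar_mul hF _) _)
    · rw [h.far r j hr hj h1 h2]
      exact isHomogeneous_pvar_mul ih _

theorem isHomogeneous_descInv {l : ℕ} (hl : l ≤ m - 1) (hF : F.IsHomogeneous n) :
    (descInv t (pT q t m) l F).IsHomogeneous n := by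
  induction l with
  | zero => exact hF
  | succ l ih =>
    rw [descInv_succ, tInv_apply]
    exact isHomogeneous_smul ((isHomogeneous_pT q t (by omega) (ih (by omega))).add
      (isHomogeneous_smul (ih (by omega)) _)) _

theorem isHomogeneous_shift (hF : F.IsHomogeneous n) : (shift q m F).IsHomogeneous n := by
  rw [← one_mul n]
  refine hF.aeval _ fun r => ?_
  split_ifs
  · exact isHomogeneous_pvar _
  · exact (isHomogeneous_pvar _).C_mul _

theorem isHomogeneous_unshift (hF : F.IsHomogeneous n) : (unshift q m F).IsHomogeneous n := by
  rw [← one_mul n]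
  refine hF.aeval _ fun r => ?_
  split_ifs
  · exact (isHomogeneous_pvar _).C_mul _
  · exact isHomogeneous_pvar _

theorem isHomogeneous_pY {r : ℕ} (hr : r < m) (hF : F.IsHomogeneous n) :
    (pY q t m r F).IsHomogeneous (n + 1) := by
  induction r generalizing F with
  | zero =>
    rw [pY_zero, pPi_apply]
    exact isHomogeneous_smul (isHomogeneous_pvar_mul
      (isHomogeneous_shift q (isHomogeneous_descInv q t le_rfl hF)) _) _
  | succ r ih =>
    rw [(isBernstein_pY q t).Y_succ hr]
    exact isHomogeneous_smul (isHomogeneous_pT q t hr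
      (ih (by omega) (isHomogeneous_pT q t hr hF))) _

theorem isHomogeneous_qPoly (n : ℕ) (F : MvPolynomial (Fin m) k) (hF : F.IsHomogeneous n) :
    (qPoly q t m F).IsHomogeneous n := by
  refine homogeneous_induction (p := fun n F => (qPoly q t m F).IsHomogeneous n) ?_ ?_ ?_ ?_ hF
  · intro c
    rw [← mul_one (C c), ← smul_eq_C_mul, map_smul, qPoly_one]
    exact isHomogeneous_smul (isHomogeneous_one _ _) _
  · intro n; rw [map_zero]; exact isHomogeneous_zero _ _ _
  · intro n F G hF hG; rw [map_add]; exact hF.add hG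
  · intro j hj n F _ ih
    rw [← pX_apply, qPoly_pX q t hj]
    exact isHomogeneous_pY q t hj ih

end Homogeneous

/-! ### Surjectivity by induction on the degree -/

section Range

variable {F : MvPolynomial (Fin m) k}

theorem pT_mem_range {r : ℕ} (hr : r + 1 < m) (hF : F ∈ LinearMap.range (qPoly q t m)) :
    pT q t m r F ∈ LinearMap.range (qPoly q t m) := by
  obtain ⟨G, rfl⟩ := hF
  exact ⟨pT q t m r G, qPoly_pT q t hr G⟩

theorem ascProd_mem_range {n : ℕ} (hn : n ≤ m - 1) (hF : F ∈ LinearMap.range (qPoly q t m)) :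
    ascProd (pT q t m) n F ∈ LinearMap.range (qPoly q t m) := by
  induction n generalizing F with
  | zero => exact hF
  | succ n ih => exact ih (by omega) (pT_mem_range q t (by omega) hF)

theorem pPi_mem_range (hF : F ∈ LinearMap.range (qPoly q t m)) :
    pPi q m F ∈ LinearMap.range (qPoly q t m) := by
  rw [pPi_eq q t]
  refine Submodule.smul_mem _ _ ?_
  obtain ⟨G, hG⟩ := ascProd_mem_range q t le_rfl hF
  rw [← hG]
  exact ⟨pX k m 0 G, qPoly_pX q t pos_m G⟩

/-- For j = 0, the product X_0 F is Π applied to the unshifted F, which has the same degree. The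
other variables follow from X_{j+1} = t⁻¹ T_j X_j T_j. -/
theorem pX_mem_range {n : ℕ} (ih : ∀ G : MvPolynomial (Fin m) k, G.IsHomogeneous n →
    G ∈ LinearMap.range (qPoly q t m)) {j : ℕ} (hj : j < m) (hF : F.IsHomogeneous n) :
    pX k m j F ∈ LinearMap.range (qPoly q t m) := by
  induction j generalizing F with
  | zero =>
    have := pPi_mem_range q t (ih _ (isHomogeneous_unshift q hF))
    rwa [pPi_apply, shift_unshift] at this
  | succ j ihj =>
    rw [(isBernstein_pX q t).Y_succ hj]
    exact Submodule.smul_mem _ _ (pT_mem_range q t hj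
      (ihj (by omega) (isHomogeneous_pT q t hj hF)))

theorem qPoly_surjective : Function.Surjective (qPoly q t m) := by
  have h : ∀ n (F : MvPolynomial (Fin m) k), F.IsHomogeneous n →
      F ∈ LinearMap.range (qPoly q t m) := by
    intro n
    induction n with
    | zero =>
      intro F hF
      rw [(totalDegree_eq_zero_iff_eq_C).mp ((totalDegree_zero_iff_isHomogeneous _).mpr hF),
        ← mul_one (C _), ← smul_eq_C_mul]
      exact Submodule.smul_mem _ _ ⟨1, qPoly_one q t⟩
    | succ n ih =>
      intro F hF
      rw [F.as_sum]
      refine Submodule.sum_mem _ fun a ha => ?_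
      have hd : a.degree = n + 1 := by
        by_contra hcon
        exact (mem_support_iff.mp ha) (hF.coeff_eq_zero hcon)
      refine monomial_induction (p := fun l G => l = n + 1 → G ∈ LinearMap.range (qPoly q t m))
        (fun c hc => by omega) ?_ (n + 1) a _ hd rfl
      intro j hj l G hG _ hl
      obtain rfl : l = n := by omega
      exact pX_mem_range q t ih hj hG
  intro F
  rw [← sum_homogeneousComponent F]
  exact Submodule.sum_mem (LinearMap.range (qPoly q t m)) fun n _ => h n _
    (homogeneousComponent_isHomogeneous n F)

theorem qPoly_injective : Function.Injective (qPoly q t m) :=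
  injective_of_surjective_of_homogeneous _ (isHomogeneous_qPoly q t) (qPoly_surjective q t)

end Range

end PolyOps

/-! ### Intertwining through inverse variables -/

section Cancel

variable {k V V' : Type*} [CommRing k] [AddCommGroup V] [Module k V] [AddCommGroup V'] [Module k V']
  {t : kˣ} {m : ℕ} {T Y : ℕ → Module.End k V} {T' Y' : ℕ → Module.End k V'}

/-- The converse of `intertwine`: in each exchange relation the outer Y' can be cancelled. It is
what allows inverse variables in the Laurent case. -/
theorem IsBernstein.intertwine_of_injective (h : IsBernstein t m T Y) (h' : IsBernstein t m T' Y')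
    (f : V →ₗ[k] V') (hf : ∀ j < m, ∀ v, f (Y j v) = Y' j (f v))
    (hY : ∀ j < m, Function.Injective (Y' j)) {r j : ℕ} (hr : r + 1 < m) (hj : j < m) {v : V}
    (hv : f (T r (Y j v)) = T' r (f (Y j v))) : f (T r v) = T' r (f v) := by
  by_cases h1 : j = r
  · subst h1
    rw [h.up j hr, hf _ hr, hf _ hj, h'.up j hr] at hv
    have := hY _ hr hv
    rwa [map_add, map_smul, add_left_inj] at this
  by_cases h2 : j = r + 1
  · subst h2
    rw [h.down r hr, hf _ hj, h'.down r hr, map_add, map_smul, hf _ (by omega), hf _ hj,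
      add_left_inj] at hv
    exact hY r (by omega) hv
  rw [h.far r j hr hj h1 h2, hf _ hj, hf _ hj, h'.far r j hr hj h1 h2] at hv
  exact hY j hj hv

end Cancel

/-! ### Bijectivity of q_(m) on Laurent polynomials -/

section LaurentBijective

set_option linter.unusedSectionVars false

variable {k : Type*} [CommRing k] {m : ℕ}

theorem single_mem_range_toLaurent {a : Fin m → ℤ} (ha : ∀ i, 0 ≤ a i) (c : k) :
    AddMonoidAlgebra.single a c ∈ LinearMap.range (toLaurent k m).toLinearMap := by
  refine ⟨MvPolynomial.monomial (Finsupp.equivFunOnFinite.symm fun i => (a i).toNat) c, ?_⟩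
  rw [AlgHom.toLinearMap_apply, toLaurent_monomial]
  congr 1
  funext i
  simp [ha i]

theorem exists_mul_mem_range_toLaurent (F : Laurent k m) : ∃ N : ℕ, ∀ N' : ℕ, N ≤ N' →
    ((monoUnit fun _ => (N' : ℤ) : (Laurent k m)ˣ) : Laurent k m) * F
      ∈ LinearMap.range (toLaurent k m).toLinearMap := by
  induction F using AddMonoidAlgebra.induction_linear with
  | zero => exact ⟨0, fun N' _ => by rw [mul_zero]; exact Submodule.zero_mem _⟩
  | add F G hF hG =>
    obtain ⟨N, hN⟩ := hF
    obtain ⟨N₂, hN₂⟩ := hG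
    refine ⟨max N N₂, fun N' h => ?_⟩
    rw [mul_add]
    exact Submodule.add_mem _ (hN N' (by omega)) (hN₂ N' (by omega))
  | single a c =>
    refine ⟨∑ i, (a i).natAbs, fun N' h => ?_⟩
    change AddMonoidAlgebra.single _ _ * _ ∈ _
    rw [AddMonoidAlgebra.single_mul_single]
    refine single_mem_range_toLaurent (fun i => ?_) _
    have := Finset.single_le_sum (f := fun i => (a i).natAbs) (fun _ _ => Nat.zero_le _)
      (Finset.mem_univ i)
    simp only [Pi.add_apply] at this ⊢
    omega

variable [IsDomain k] (q t : kˣ) [NeZero m]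

/-- The kernel is stable under multiplication by Laurent polynomials, so a power of X_1 ⋯ X_m moves
an element of it into the polynomial ring. -/
theorem qMap_injective : Function.Injective (qMap q t m) := by
  rw [injective_iff_map_eq_zero]
  intro F hF
  obtain ⟨N, hN⟩ := exists_mul_mem_range_toLaurent F
  obtain ⟨G, hG⟩ := hN N le_rfl
  rw [AlgHom.toLinearMap_apply] at hG
  have h1 : qPoly q t m G = 0 := by
    apply toLaurent_injective
    rw [toLaurent_qPoly, hG, qMap_mul, hF, map_zero, map_zero]
  have h2 : G = 0 := qPoly_injective q t (h1.trans (map_zero _).symm)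
  rw [h2, map_zero] at hG
  exact (Units.mul_right_eq_zero _).mp hG.symm

theorem lT_qMap {r : ℕ} (hr : r + 1 < m) (F : Laurent k m) :
    qMap q t m (lT q t m r F) = lT q t m r (qMap q t m F) := by
  have hf : ∀ j < m, ∀ F, qMap q t m (lX q m j F) = lY q t m j (qMap q t m F) :=
    fun j hj F => qMap_lX q t F hj
  have hX : ∀ (j : Fin m) (F : Laurent k m),
      ((varUnit j : (Laurent k m)ˣ) : Laurent k m) * F = lX q m j F := fun j F => by
    rw [varUnit_eq_varZ q]; rfl
  induction F using laurent_induction with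
  | one => rw [lT_one q t hr, map_smul, qMap_one, lT_one q t hr]
  | add F G hF hG => simp only [map_add, hF, hG]
  | smul c F hF => simp only [map_smul, hF]
  | mul j F hF =>
    rw [hX]
    exact (isBernstein_lX q t).intertwine (isBernstein_lY q t) _ hf hr hF j.2
  | inv_mul j F hF =>
    refine (isBernstein_lX q t).intertwine_of_injective (isBernstein_lY q t) _ hf ?_ hr j.2 ?_
    · intro j _
      refine Function.LeftInverse.injective
        (g := levelOne q t m ((HeckeAlg.Y t m (j + 1))⁻¹ : (HeckeAlg t m)ˣ)) fun F => ?_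
      rw [lY, ← levelOne_mul, Units.inv_mul, levelOne_one]
    · rw [← hX, Units.mul_inv_cancel_left]
      exact hF

/-- Translation by m scales each variable by q⁻¹, so monomials are eigenvectors. -/
theorem act_period_single (a : Fin m → ℤ) (c : k) :
    ∃ c' : k, act q (fun j => j + m) (AddMonoidAlgebra.single a c) = AddMonoidAlgebra.single a c' := by
  have h1 : ∀ r : Fin m, Units.map ((act q fun j => j + m : Laurent k m →ₐ[k] Laurent k m) :
      Laurent k m →* Laurent k m) (varUnit r) = scal q⁻¹ * varUnit r := by
    intro r
    rw [varUnit_eq_varZ q, act_varZ q (shift_isPer m m)]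
    have := varZ_add (k := k) (m := m) q (1 + (r : ℕ)) 1
    simpa using this
  have h2 : Units.map ((act q fun j => j + m : Laurent k m →ₐ[k] Laurent k m) :
      Laurent k m →* Laurent k m) (monoUnit a) = (∏ r, scal (q⁻¹ ^ a r)) * monoUnit a := by
    rw [monoUnit_eq_prod, map_prod, ← Finset.prod_mul_distrib]
    refine Finset.prod_congr rfl fun r _ => ?_
    rw [map_zpow, h1, mul_zpow]
    congr 1
    exact (map_zpow (Units.map (algebraMap k (Laurent k m)).toMonoidHom) _ _).symm
  have h3 : (∏ r, scal (q⁻¹ ^ a r) : (Laurent k m)ˣ) = scal (∏ r, q⁻¹ ^ a r) :=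
    (map_prod (Units.map (algebraMap k (Laurent k m)).toMonoidHom) _ _).symm
  rw [h3] at h2
  have h4 := congrArg Units.val h2
  have h5 : (AddMonoidAlgebra.single a c : Laurent k m) = c • AddMonoidAlgebra.single a 1 := by simp
  refine ⟨c * ((∏ r, q⁻¹ ^ a r : kˣ) : k), ?_⟩
  rw [h5, map_smul]
  change c • ((Units.map ((act q fun j => j + m : Laurent k m →ₐ[k] Laurent k m) :
      Laurent k m →* Laurent k m) (monoUnit a) : (Laurent k m)ˣ) : Laurent k m) = _
  rw [h4, Units.val_mul]
  generalize (∏ r, q⁻¹ ^ a r : kˣ) = u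
  simp [scal, monoUnit, AddMonoidAlgebra.single_mul_single]

theorem piFun_iterate (n : ℕ) (F : Laurent k m) : (piFun q)^[n] F
    = ((∏ i ∈ Finset.range n, varZ q (1 + (i : ℕ)) : (Laurent k m)ˣ) : Laurent k m)
      * act q (fun j => j + n) F := by
  induction n generalizing F with
  | zero =>
    have : (fun j : ℤ => j + (0 : ℕ)) = id := by funext j; simp
    rw [this, act_id]; simp
  | succ n ih =>
    rw [Function.iterate_succ_apply, ih, piFun, map_mul, act_comp q (shift_isPer m n),
      ← mul_assoc, Finset.prod_range_succ, Units.val_mul,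
      act_unit_eq q (act_varZ q (shift_isPer m n) 1)]
    congr 2
    refine congrArg (act q) (funext fun j => ?_)
    simp only [Function.comp]
    push_cast
    ring

/-- Up to a scalar, m applications of Π multiply a monomial by X_1 ⋯ X_m. This brings every Laurent
monomial into the polynomial ring. -/
theorem piFun_iterate_single (a : Fin m → ℤ) (c : k) : ∃ c' : k,
    (piFun q)^[m] (AddMonoidAlgebra.single a c) = AddMonoidAlgebra.single (fun i => a i + 1) c' := by
  obtain ⟨c', hc'⟩ := act_period_single q a c
  refine ⟨c', ?_⟩
  have h1 : (∏ i ∈ Finset.range m, varZ q (1 + (i : ℕ)) : (Laurent k m)ˣ)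
      = monoUnit fun _ => 1 := by
    rw [monoUnit_eq_prod, ← Fin.prod_univ_eq_prod_range (fun i => varZ q (1 + (i : ℕ)))]
    refine Finset.prod_congr rfl fun r _ => ?_
    rw [zpow_one, varUnit_eq_varZ q]
  rw [piFun_iterate, hc', h1]
  change AddMonoidAlgebra.single _ _ * _ = _
  rw [AddMonoidAlgebra.single_mul_single, one_mul]
  congr 1
  funext i
  exact add_comm _ _

/-- Solving Y_1 G = Π F gives F = t^{m-1} T_{m-1}⁻¹ ⋯ T_1⁻¹ G with G = Y_1⁻¹ Π F, and the range is
stable under Y_1⁻¹ and the T_r⁻¹. -/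
theorem mem_range_of_piFun_mem {F : Laurent k m} (hF : piFun q F ∈ LinearMap.range (qMap q t m)) :
    F ∈ LinearMap.range (qMap q t m) := by
  have hT : ∀ r, r + 1 < m → ∀ G ∈ LinearMap.range (qMap q t m),
      tInv t (lT q t m) r G ∈ LinearMap.range (qMap q t m) := by
    rintro r hr _ ⟨G, rfl⟩
    exact ⟨tInv t (lT q t m) r G, map_tInv _ (fun v => lT_qMap q t hr v) G⟩
  have hD : ∀ n ≤ m - 1, ∀ G ∈ LinearMap.range (qMap q t m),
      descInv t (lT q t m) n G ∈ LinearMap.range (qMap q t m) := by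
    intro n hn G hG
    induction n with
    | zero => exact hG
    | succ n ih => exact hT n (by omega) _ (ih (by omega))
  set G := levelOne q t m ((HeckeAlg.Y t m (0 + 1))⁻¹ : (HeckeAlg t m)ˣ) (piFun q F) with hG
  have hGm : G ∈ LinearMap.range (qMap q t m) := by
    obtain ⟨H, hH⟩ := hF
    rw [hG, ← hH]
    exact ⟨_, qMap_varUnit_inv_mul q t H ⟨0, pos_m⟩⟩
  have h1 : lY q t m 0 G = piFun q F := by
    rw [lY, hG, ← levelOne_mul, Units.mul_inv, levelOne_one]
  rw [lY_zero, ← piFun_smul] at h1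
  have h2 := congrArg (piInvFun q) h1
  rw [piInvFun_piFun, piInvFun_piFun] at h2
  rw [← h2]
  exact Submodule.smul_mem _ _ (hD _ le_rfl _ hGm)

theorem qMap_surjective : Function.Surjective (qMap q t m) := by
  have hpoly : LinearMap.range (toLaurent k m).toLinearMap ≤ LinearMap.range (qMap q t m) := by
    rintro _ ⟨G, rfl⟩
    obtain ⟨F, rfl⟩ := qPoly_surjective q t G
    exact ⟨_, (toLaurent_qPoly q t F).symm⟩
  have hiter : ∀ n (F : Laurent k m), (piFun q)^[n] F ∈ LinearMap.range (qMap q t m) →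
      F ∈ LinearMap.range (qMap q t m) := by
    intro n
    induction n with
    | zero => exact fun F h => h
    | succ n ih =>
      intro F h
      rw [Function.iterate_succ_apply] at h
      exact mem_range_of_piFun_mem q t (ih _ h)
  -- `N` bounds how negative the exponents are; each block of m applications of Π lowers this bound
  -- by one.
  have hmono : ∀ (N : ℕ) (a : Fin m → ℤ) (c : k), (∀ i, 0 ≤ a i + N) →
      AddMonoidAlgebra.single a c ∈ LinearMap.range (qMap q t m) := by
    intro N
    induction N with
    | zero => exact fun a c h => hpoly (single_mem_range_toLaurent (by simpa using h) c)
    | succ N ih =>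
      intro a c h
      obtain ⟨c', hc'⟩ := piFun_iterate_single q a c
      refine hiter m _ ?_
      rw [hc']
      refine ih _ _ fun i => ?_
      have := h i
      push_cast at this
      linarith
  intro F
  change F ∈ LinearMap.range (qMap q t m)
  induction F using AddMonoidAlgebra.induction_linear with
  | zero => exact Submodule.zero_mem _
  | add F G hF hG => exact Submodule.add_mem _ hF hG
  | single a c =>
    refine hmono (∑ i, (a i).natAbs) a c fun i => ?_
    have := Finset.single_le_sum (f := fun i => (a i).natAbs) (fun _ _ => Nat.zero_le _)
      (Finset.mem_univ i)
    omega

theorem evalY_injective : Function.Injective (evalY t m : Laurent k m → HeckeAlg t m) := by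
  intro F G h
  -- The Hecke algebra does not involve q, so any unit may serve as the parameter of the
  -- representation.
  apply qMap_injective 1 t
  rw [qMap_apply, qMap_apply, h]

theorem map_range_toLaurent :
    (LinearMap.range (toLaurent k m).toLinearMap).map (qMap q t m)
      = LinearMap.range (toLaurent k m).toLinearMap := by
  ext F
  constructor
  · rintro ⟨_, ⟨G, rfl⟩, rfl⟩
    exact ⟨qPoly q t m G, toLaurent_qPoly q t G⟩
  · rintro ⟨G, rfl⟩
    obtain ⟨F, rfl⟩ := qPoly_surjective q t G
    exact ⟨_, ⟨F, rfl⟩, (toLaurent_qPoly q t F).symm⟩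

end LaurentBijective

/-! ### Compatibility with base change and truncation -/

section Specialize

set_option linter.unusedSectionVars false

open MvPolynomial

variable {k k' : Type*} [CommRing k] [IsDomain k] [CommRing k'] [IsDomain k'] {q t : kˣ}
  {q' t' : k'ˣ} {m m' : ℕ} [NeZero m] [NeZero m']

/-- A ring homomorphism that maps the variables to the variables, or to `0` where there is no such
variable. -/
structure IsSpecialization (φ : k →+* k') (θ : MvPolynomial (Fin m) k →+* MvPolynomial (Fin m') k') :
    Prop where
  le : m' ≤ m
  map_C : ∀ c, θ (C c) = C (φ c)
  map_pvar : ∀ j < m, θ (pvar k m j) = pvar k' m' j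

variable {φ : k →+* k'} {θ : MvPolynomial (Fin m) k →+* MvPolynomial (Fin m') k'}

theorem pvar_of_le {k : Type*} [CommRing k] {m j : ℕ} (h : m ≤ j) : pvar k m j = 0 :=
  dif_neg (by omega)

namespace IsSpecialization

variable (h : IsSpecialization φ θ)
include h

theorem map_smul' (c : k) (F : MvPolynomial (Fin m) k) : θ (c • F) = φ c • θ F := by
  rw [smul_eq_C_mul, map_mul, h.map_C, smul_eq_C_mul]

theorem map_pX {j : ℕ} (hj : j < m) (F : MvPolynomial (Fin m) k) :
    θ (pX k m j F) = pX k' m' j (θ F) := by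
  rw [pX_apply, map_mul, h.map_pvar j hj, pX_apply]

/-- A T_r that involves only surviving variables commutes past the others, so a killed variable
gives zero on both sides. -/
theorem map_pT (ht : φ t = t') {r : ℕ} (hr : r + 1 < m') (F : MvPolynomial (Fin m) k) :
    θ (pT q t m r F) = pT q' t' m' r (θ F) := by
  have hle := h.le
  have hm : r + 1 < m := by omega
  have hB := isBernstein_pX (k := k) q t (m := m)
  have hB' := isBernstein_pX (k := k') q' t' (m := m')
  induction F using poly_induction with
  | one => rw [pT_one q t hm, h.map_smul', map_one, pT_one q' t' hr, ht]
  | add F G hF hG => simp only [map_add, hF, hG]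
  | smul c F hF => simp only [_root_.map_smul, h.map_smul', hF]
  | mul j hj F hF =>
    rw [← pX_apply, h.map_pX hj]
    by_cases h1 : j = r
    · subst h1
      rw [hB.up j hm, h.map_pX hm, hB'.up j hr, map_add, h.map_smul', hF, map_sub, map_one, ht]
    by_cases h2 : j = r + 1
    · subst h2
      rw [hB.down r hm, map_add, h.map_pX (by omega), hB'.down r hr, h.map_smul', hF, map_sub,
        map_one, ht, h.map_pX hm]
    rw [hB.far r j hm hj h1 h2, h.map_pX hj, hF]
    by_cases hj' : j < m'
    · rw [hB'.far r j hr hj' h1 h2]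
    · rw [pX_apply, pX_apply, pvar_of_le (by omega), zero_mul, zero_mul, map_zero]

theorem map_tInv (ht : φ t = t') {r : ℕ} (hr : r + 1 < m') (F : MvPolynomial (Fin m) k) :
    θ (tInv t (pT q t m) r F) = tInv t' (pT q' t' m') r (θ F) := by
  have hinv : φ ((t⁻¹ : kˣ) : k) = ((t'⁻¹ : k'ˣ) : k') := by
    have h1 : t' = Units.map (φ : k →* k') t := Units.ext ht.symm
    rw [h1, ← map_inv]; rfl
  rw [tInv_apply, tInv_apply, h.map_smul', map_add, h.map_smul', h.map_pT ht hr, hinv, map_sub,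
    map_one, ht]

theorem map_descInv (ht : φ t = t') {n : ℕ} (hn : n ≤ m' - 1) (F : MvPolynomial (Fin m) k) :
    θ (descInv t (pT q t m) n F) = descInv t' (pT q' t' m') n (θ F) := by
  induction n with
  | zero => rfl
  | succ n ih => rw [descInv_succ, h.map_tInv ht (by omega), ih (by omega), descInv_succ]

/-- The number of variables and the parameter q enter only through Y_0; the recursion transports the
compatibility to the other surviving Y_r. -/
theorem map_pY (ht : φ t = t')
    (h0 : ∀ F, θ (pY q t m 0 F) = pY q' t' m' 0 (θ F)) {r : ℕ} (hr : r < m')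
    (F : MvPolynomial (Fin m) k) : θ (pY q t m r F) = pY q' t' m' r (θ F) := by
  have hle := h.le
  have hinv : φ ((t⁻¹ : kˣ) : k) = ((t'⁻¹ : k'ˣ) : k') := by
    have h1 : t' = Units.map (φ : k →* k') t := Units.ext ht.symm
    rw [h1, ← map_inv]; rfl
  induction r generalizing F with
  | zero => exact h0 F
  | succ r ih =>
    rw [(isBernstein_pY q t).Y_succ (by omega), (isBernstein_pY q' t').Y_succ hr, h.map_smul', hinv,
      h.map_pT ht hr, ih (by omega), h.map_pT ht hr]

/-- Every value of Y_r is divisible by X_r: this is visible for Y_0, which ends with Π, and the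
recursion moves the factor X_r to X_{r+1}. -/
theorem map_pY_eq_zero {r : ℕ} (hr : m' ≤ r) (hrm : r < m) (F : MvPolynomial (Fin m) k) :
    θ (pY q t m r F) = 0 := by
  have hdvd : ∀ (r : ℕ), r < m → ∀ F, ∃ G, pY q t m r F = pX k m r G := by
    intro r
    induction r with
    | zero =>
      intro _ F
      refine ⟨(t : k) ^ (m - 1) • shift q m (descInv t (pT q t m) (m - 1) F), ?_⟩
      rw [pY_zero, pPi_apply, _root_.map_smul, pX_apply]
    | succ r ih =>
      intro hr F
      obtain ⟨G, hG⟩ := ih (by omega) (pT q t m r F)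
      rw [(isBernstein_pY q t).Y_succ hr, hG, (isBernstein_pX q t).up r hr, ← _root_.map_smul]
      exact ⟨_, rfl⟩
  obtain ⟨G, hG⟩ := hdvd r hrm F
  rw [hG, h.map_pX hrm, pX_apply, pvar_of_le hr, zero_mul]

theorem map_qPoly (ht : φ t = t')
    (h0 : ∀ F, θ (pY q t m 0 F) = pY q' t' m' 0 (θ F)) (F : MvPolynomial (Fin m) k) :
    θ (qPoly q t m F) = qPoly q' t' m' (θ F) := by
  induction F using poly_induction with
  | one => rw [qPoly_one, map_one, qPoly_one]
  | add F G hF hG => simp only [map_add, hF, hG]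
  | smul c F hF => simp only [_root_.map_smul, h.map_smul', hF]
  | mul j hj F hF =>
    rw [← pX_apply, h.map_pX hj, qPoly_pX q t hj]
    by_cases hj' : j < m'
    · rw [h.map_pY ht h0 hj', hF, qPoly_pX q' t' hj']
    · rw [h.map_pY_eq_zero (by omega) hj, pX_apply, pvar_of_le (by omega), zero_mul, map_zero]

end IsSpecialization

theorem map_pPi_of_map {φ : k →+* k'} (hq : φ q = q') (F : MvPolynomial (Fin m) k) :
    map φ (pPi q m F) = pPi q' m (map φ F) := by
  have hinv : φ ((q⁻¹ : kˣ) : k) = ((q'⁻¹ : k'ˣ) : k') := by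
    have h1 : q' = Units.map (φ : k →* k') q := Units.ext hq.symm
    rw [h1, ← map_inv]; rfl
  have hX : ∀ j < m, map φ (pvar k m j) = pvar k' m j := fun j hj => by
    rw [pvar_of_lt hj, pvar_of_lt hj, map_X]
  have h1 : (map φ).comp ((shift q m : MvPolynomial (Fin m) k →ₐ[k] MvPolynomial (Fin m) k) :
      MvPolynomial (Fin m) k →+* MvPolynomial (Fin m) k)
      = ((shift q' m : MvPolynomial (Fin m) k' →ₐ[k'] MvPolynomial (Fin m) k') :
      MvPolynomial (Fin m) k' →+* MvPolynomial (Fin m) k').comp (map φ) := by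
    apply MvPolynomial.ringHom_ext
    · intro c
      simp only [RingHom.comp_apply, RingHom.coe_coe, ← algebraMap_eq, AlgHom.commutes]
      simp only [algebraMap_eq, map_C]
      rw [← algebraMap_eq, AlgHom.commutes]
    · intro r
      simp only [RingHom.comp_apply, RingHom.coe_coe]
      rw [X_eq_pvar, hX r r.2]
      by_cases hr : (r : ℕ) + 1 < m
      · rw [shift_pvar q hr, shift_pvar q' hr, hX _ hr]
      · have hr' : (r : ℕ) + 1 = m := by omega
        rw [shift_pvar_last q hr', shift_pvar_last q' hr', map_mul, hX _ pos_m, map_C, hinv]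
  rw [pPi_apply, pPi_apply, map_mul, hX _ pos_m]
  congr 1
  exact RingHom.congr_fun h1 F

theorem isSpecialization_map (φ : k →+* k') :
    IsSpecialization φ (map φ : MvPolynomial (Fin m) k →+* MvPolynomial (Fin m) k') where
  le := le_rfl
  map_C c := by rw [map_C]
  map_pvar j hj := by rw [pvar_of_lt hj, pvar_of_lt hj, map_X]

/-- The map `F ↦ F(Y) • 1` commutes with the base change. -/
theorem map_qPoly_map {φ : k →+* k'} (hq : φ q = q') (ht : φ t = t') (F : MvPolynomial (Fin m) k) :
    map φ (qPoly q t m F) = qPoly q' t' m (map φ F) := by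
  have h := isSpecialization_map (m := m) φ
  refine h.map_qPoly ht (fun F => ?_) F
  rw [pY_zero, h.map_smul', map_pPi_of_map hq, h.map_descInv ht le_rfl, pY_zero, map_pow, ht]

theorem trunc_pvar (j : ℕ) (hj : j < m) : trunc k m m' (pvar k m j) = pvar k m' j := by
  rw [pvar_of_lt hj, trunc, aeval_X]
  rfl

theorem isSpecialization_trunc (hm : m' ≤ m) : IsSpecialization (RingHom.id k)
    (trunc k m m' : MvPolynomial (Fin m) k →+* MvPolynomial (Fin m') k) where
  le := hm
  map_C c := (trunc k m m').commutes c
  map_pvar j hj := trunc_pvar j hj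

theorem pPi_pX {j : ℕ} (hj : j + 1 < m) (F : MvPolynomial (Fin m) k) :
    pPi q m (pX k m j F) = pX k m (j + 1) (pPi q m F) := by
  rw [pPi_apply, pX_apply, map_mul, shift_pvar q hj, pX_apply, pPi_apply, mul_left_comm]

theorem pPi_pX_last {j : ℕ} (hj : j + 1 = m) (F : MvPolynomial (Fin m) k) :
    pPi q m (pX k m j F) = ((q⁻¹ : kˣ) : k) • pX k m 0 (pPi q m F) := by
  rw [pPi_apply, pX_apply, map_mul, shift_pvar_last q hj, pX_apply, pPi_apply, smul_eq_C_mul]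
  ring

/-- The substitution in Π sends the last variable to q⁻¹ X_0, and which variable is last changes
under truncation. The factor T_n⁻¹ makes up for this, because it exchanges the two last variables up
to terms that truncation kills. -/
theorem trunc_pPi_tInv {n : ℕ} (F : MvPolynomial (Fin (n + 1 + 1)) k) :
    trunc k (n + 1 + 1) (n + 1) ((t : k) • pPi q (n + 1 + 1)
      (tInv t (pT q t (n + 1 + 1)) n F)) = pPi q (n + 1) (trunc k (n + 1 + 1) (n + 1) F) := by
  have hs := isSpecialization_trunc (k := k) (m := n + 1 + 1) (m' := n + 1) (by omega)
  have hB := isBernstein_pX (k := k) q t (m := n + 1 + 1)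
  have hX : ∀ {j : ℕ} (hj : j < n + 1 + 1) F, trunc k (n + 1 + 1) (n + 1) (pX k _ j F)
      = pX k _ j (trunc k (n + 1 + 1) (n + 1) F) := fun hj F => hs.map_pX hj F
  have h0 : ∀ F : MvPolynomial (Fin (n + 1)) k, pX k (n + 1) (n + 1) F = 0 := fun F => by
    rw [pX_apply, pvar_of_le le_rfl, zero_mul]
  have hr : n + 1 < n + 1 + 1 := by omega
  induction F using poly_induction with
  | one =>
    rw [tInv_eigen (pT_one q t hr), map_smul (pPi q (n + 1 + 1)), smul_smul, Units.mul_inv, one_smul, pPi_apply,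
      pPi_apply, map_one, map_one, map_one, mul_one, mul_one, trunc_pvar _ (by omega)]
  | add F G hF hG => simp only [map_add, smul_add, hF, hG]
  | smul c F hF =>
    rw [map_smul (tInv t _ n), map_smul (pPi q (n + 1 + 1)), smul_comm, map_smul (trunc k _ _), hF,
      map_smul (trunc k _ _), map_smul (pPi q (n + 1))]
  | mul j hj F hF =>
    rw [← pX_apply, hX hj]
    rcases Nat.lt_or_ge j n with h1 | h1
    · rw [hB.tInv_far hr hj (by omega) (by omega), pPi_pX (by omega), ← map_smul, hX (by omega), hF,
        pPi_pX (by omega)]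
    rcases Nat.eq_or_lt_of_le h1 with h2 | h2
    -- In the larger ring Π sends X_{n+1} to q⁻¹ X_0, as it sends X_n in the smaller one. The
    -- correction term of T_n⁻¹ X_n acquires the factor X_{n+1} under Π and is truncated away.
    · subst h2
      rw [hB.tInv_Y hr, map_add, map_smul (pPi q (n + 1 + 1)), pPi_pX (by omega : n + 1 < n + 1 + 1),
        pPi_pX_last (by omega : n + 1 + 1 = n + 1 + 1), pPi_pX_last (by omega : n + 1 = n + 1), smul_add,
        map_add, smul_comm, ← map_smul (pX k (n + 1 + 1) 0), map_smul (trunc k _ _), hX (by omega), hF,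
        map_smul (trunc k _ _), map_smul (trunc k _ _), hX hr, h0, smul_zero, smul_zero, add_zero]
    -- Here T_n⁻¹ turns the killed variable into X_n, which Π turns back into it, so both sides
    -- vanish.
    · obtain rfl : j = n + 1 := by omega
      rw [hB.tInv_Y_succ hr, map_smul (pPi q (n + 1 + 1)), pPi_pX (by omega : n + 1 < n + 1 + 1),
        map_smul (trunc k _ _), map_smul (trunc k _ _), hX hr,
        h0, h0, map_zero, smul_zero, smul_zero]

/-- With one more variable, Y_0 has one more factor t T_n⁻¹ next to Π, and `trunc_pPi_tInv` absorbs
it. -/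
theorem trunc_qPoly_succ {n : ℕ} (F : MvPolynomial (Fin (n + 1 + 1)) k) :
    trunc k (n + 1 + 1) (n + 1) (qPoly q t (n + 1 + 1) F)
      = qPoly q t (n + 1) (trunc k (n + 1 + 1) (n + 1) F) := by
  have hs := isSpecialization_trunc (k := k) (m := n + 1 + 1) (m' := n + 1) (by omega)
  refine hs.map_qPoly (t := t) (t' := t) rfl (fun F => ?_) F
  have h1 := hs.map_descInv (q := q) (q' := q) (t := t) (t' := t) rfl (n := n) (by omega) F
  have h2 := trunc_pPi_tInv (q := q) (t := t) (descInv t (pT q t (n + 1 + 1)) n F)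
  simp only [RingHom.coe_coe] at h1 ⊢
  rw [pY_zero, pY_zero]
  simp only [Nat.add_sub_cancel]
  rw [← h1, ← h2, descInv_succ, pow_succ, mul_smul, map_smul]

theorem trunc_trunc {m'' : ℕ} [NeZero m''] (h1 : m'' ≤ m') (F : MvPolynomial (Fin m) k) :
    trunc k m' m'' (trunc k m m' F) = trunc k m m'' F := by
  have : (trunc k m' m'').comp (trunc k m m') = trunc k m m'' := by
    apply MvPolynomial.algHom_ext
    intro r
    rw [AlgHom.comp_apply, X_eq_pvar, trunc_pvar _ r.2, trunc_pvar _ r.2]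
    by_cases hr : (r : ℕ) < m'
    · rw [trunc_pvar _ hr]
    · rw [pvar_of_le (by omega), pvar_of_le (by omega), map_zero]
  exact AlgHom.congr_fun this F

theorem trunc_self (F : MvPolynomial (Fin m) k) : trunc k m m F = F := by
  have : trunc k m m = AlgHom.id k _ := by
    apply MvPolynomial.algHom_ext
    intro r
    rw [X_eq_pvar, trunc_pvar _ r.2]; rfl
  exact AlgHom.congr_fun this F

theorem trunc_qPoly_add (n d : ℕ) (F : MvPolynomial (Fin (n + d + 1)) k) :
    trunc k (n + d + 1) (n + 1) (qPoly q t (n + d + 1) F)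
      = qPoly q t (n + 1) (trunc k (n + d + 1) (n + 1) F) := by
  induction d with
  | zero => exact (trunc_self _).trans (congrArg _ (trunc_self _).symm)
  | succ d ih =>
    have h1 := trunc_qPoly_succ (q := q) (t := t) (n := n + d) F
    have h2 := ih (trunc k (n + d + 1 + 1) (n + d + 1) F)
    rw [← h1, trunc_trunc (by omega), trunc_trunc (by omega)] at h2
    exact h2

/-- The map `F ↦ F(Y) • 1` commutes with the truncations. -/
theorem trunc_qPoly (hm : m' ≤ m) (F : MvPolynomial (Fin m) k) :
    trunc k m m' (qPoly q t m F) = qPoly q t m' (trunc k m m' F) := by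
  obtain ⟨n, rfl⟩ : ∃ n, m' = n + 1 := ⟨m' - 1, by have := pos_m (m := m'); omega⟩
  obtain ⟨d, rfl⟩ : ∃ d, m = n + d + 1 := ⟨m - n - 1, by omega⟩
  exact trunc_qPoly_add n d F

end Specialize

/-! ### Symmetric polynomials as common eigenvectors of the T_r -/

section Symmetric

set_option linter.unusedSectionVars false

open MvPolynomial

variable {k : Type*} [CommRing k] [IsDomain k] (q t : kˣ) {m : ℕ} [NeZero m]

/-- The exchange of the variables with indices `r` and `r + 1`. -/
noncomputable def swapVar {r : ℕ} (hr : r + 1 < m) :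
    MvPolynomial (Fin m) k →ₐ[k] MvPolynomial (Fin m) k :=
  rename (Equiv.swap (⟨r, by omega⟩ : Fin m) ⟨r + 1, hr⟩)

section

variable {r : ℕ} (hr : r + 1 < m)

theorem swapVar_left : swapVar hr (pvar k m r) = pvar k m (r + 1) := by
  rw [pvar_of_lt (by omega : r < m), pvar_of_lt hr, swapVar, rename_X, Equiv.swap_apply_left]

theorem swapVar_right : swapVar hr (pvar k m (r + 1)) = pvar k m r := by
  rw [pvar_of_lt (by omega : r < m), pvar_of_lt hr, swapVar, rename_X, Equiv.swap_apply_right]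

theorem swapVar_far {j : ℕ} (hj : j < m) (h1 : j ≠ r) (h2 : j ≠ r + 1) :
    swapVar hr (pvar k m j) = pvar k m j := by
  rw [pvar_of_lt hj, swapVar, rename_X, Equiv.swap_apply_of_ne_of_ne]
  · simpa using h1
  · simpa using h2

/-- `(X_{r+1} - X_r) T_r F = (X_{r+1} - t X_r) s_r F + (t - 1) X_{r+1} F`. -/
theorem pT_key (F : MvPolynomial (Fin m) k) :
    (pvar k m (r + 1) - pvar k m r) * pT q t m r F
      = (pvar k m (r + 1) - C (t : k) * pvar k m r) * swapVar hr F
        + C ((t : k) - 1) * pvar k m (r + 1) * F := by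
  have h := isBernstein_pX (k := k) q t (m := m)
  induction F using poly_induction with
  | one =>
    rw [pT_one q t hr, map_one, smul_eq_C_mul, map_sub, map_one]
    ring
  | add F G hF hG =>
    rw [map_add, map_add]
    linear_combination hF + hG
  | smul c F hF =>
    rw [map_smul, map_smul, smul_eq_C_mul, smul_eq_C_mul, smul_eq_C_mul]
    linear_combination C c * hF
  | mul j hj F hF =>
    rw [← pX_apply]
    by_cases h1 : j = r
    · subst h1
      rw [h.up j hr, pX_apply, pX_apply, map_mul, swapVar_left, smul_eq_C_mul, map_sub, map_one] at *
      rw [map_sub, map_one] at *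
      linear_combination pvar k m (j + 1) * hF
    by_cases h2 : j = r + 1
    · subst h2
      rw [h.down r hr, pX_apply, pX_apply, map_mul, swapVar_right, smul_eq_C_mul]
      linear_combination pvar k m r * hF
    · rw [h.far r j hr hj h1 h2, pX_apply, pX_apply, map_mul, swapVar_far hr hj h1 h2]
      linear_combination pvar k m j * hF

include hr in
theorem pvar_succ_sub_ne_zero (c : k) : pvar k m (r + 1) - C c * pvar k m r ≠ 0 := by
  intro h0
  have h1 := congrArg (eval fun i : Fin m => if (i : ℕ) = r + 1 then (1 : k) else 0) h0
  rw [pvar_of_lt (by omega : r < m), pvar_of_lt hr] at h1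
  simp at h1

/-- The formula `pT_key` amounts to (X_{r+1} - X_r)(T_r F - t F) = (X_{r+1} - t X_r)(s_r F - F), and
neither linear factor is zero. -/
theorem pT_eq_smul_iff (F : MvPolynomial (Fin m) k) :
    pT q t m r F = (t : k) • F ↔ swapVar hr F = F := by
  have h := pT_key q t hr F
  rw [map_sub, map_one] at h
  constructor
  · intro h1
    rw [h1, smul_eq_C_mul] at h
    apply mul_left_cancel₀ (pvar_succ_sub_ne_zero hr (t : k))
    linear_combination -h
  · intro h1
    rw [h1] at h
    have h2 := pvar_succ_sub_ne_zero hr (1 : k)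
    rw [map_one, one_mul] at h2
    apply mul_left_cancel₀ h2
    rw [smul_eq_C_mul]
    linear_combination h

end

/-- The permutations that fix F form a submonoid, and the adjacent transpositions generate the whole
symmetric group. In this form symmetry is visibly preserved by any injective map that commutes with
the T_r. -/
theorem isSymmetric_iff (F : MvPolynomial (Fin m) k) :
    F.IsSymmetric ↔ ∀ r, r + 1 < m → pT q t m r F = (t : k) • F := by
  constructor
  · intro h r hr
    exact (pT_eq_smul_iff q t hr F).mpr (h _)
  · intro h
    obtain ⟨n, rfl⟩ : ∃ n, m = n + 1 := ⟨m - 1, by have := pos_m (m := m); omega⟩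
    let S : Submonoid (Equiv.Perm (Fin (n + 1))) :=
      { carrier := {σ | rename σ F = F}
        one_mem' := by
          change rename (id : Fin (n + 1) → Fin (n + 1)) F = F
          rw [rename_id_apply]
        mul_mem' := fun {σ τ} hσ hτ => by
          change rename (σ ∘ τ) F = F
          rw [← rename_rename, show rename τ F = F from hτ]
          exact hσ }
    have hS : S = ⊤ := by
      rw [eq_top_iff, ← Equiv.Perm.mclosure_swap_castSucc_succ n, Submonoid.closure_le]
      rintro _ ⟨i, rfl⟩
      have hi : (i : ℕ) + 1 < n + 1 := by omega
      exact (pT_eq_smul_iff q t hi F).mp (h i hi)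
    intro σ
    have : σ ∈ S := by rw [hS]; trivial
    exact this

/-- The map `F ↦ F(Y) • 1` preserves and reflects symmetric polynomials. -/
theorem qPoly_isSymmetric_iff (F : MvPolynomial (Fin m) k) :
    (qPoly q t m F).IsSymmetric ↔ F.IsSymmetric := by
  rw [isSymmetric_iff q t, isSymmetric_iff q t]
  refine forall_congr' fun r => forall_congr' fun hr => ?_
  rw [← qPoly_pT q t hr, ← map_smul]
  exact (qPoly_injective q t).eq_iff

/-! ### Linearity over symmetric polynomials at q = 1 -/

section One

variable {G : MvPolynomial (Fin m) k} (hG : G.IsSymmetric) (F : MvPolynomial (Fin m) k)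
include hG

theorem pT_symm_mul {r : ℕ} (hr : r + 1 < m) : pT q t m r (G * F) = G * pT q t m r F := by
  have h2 := pvar_succ_sub_ne_zero hr (1 : k)
  rw [map_one, one_mul] at h2
  apply mul_left_cancel₀ h2
  have hs : swapVar hr G = G := hG _
  rw [pT_key q t hr, map_mul, hs]
  linear_combination -G * pT_key q t hr F

theorem descInv_symm_mul {n : ℕ} (hn : n ≤ m - 1) :
    descInv t (pT q t m) n (G * F) = G * descInv t (pT q t m) n F := by
  induction n with
  | zero => rfl
  | succ n ih =>
    rw [descInv_succ, descInv_succ, ih (by omega), tInv_apply, tInv_apply,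
      pT_symm_mul q t hG _ (by omega), mul_smul_comm, mul_add, mul_smul_comm]

/-- At q = 1 the substitution in Π is a cyclic permutation of the variables. -/
theorem shift_one_symm : shift 1 m G = G := by
  have h1 : shift (1 : kˣ) m = rename (Equiv.addRight (1 : Fin m)) := by
    apply MvPolynomial.algHom_ext
    intro r
    rw [rename_X, X_eq_pvar, X_eq_pvar]
    have e : ((Equiv.addRight (1 : Fin m) r : Fin m) : ℕ) = ((r : ℕ) + 1) % m := by
      simp [Fin.val_add]
    rw [e]
    by_cases hr : (r : ℕ) + 1 < m
    · rw [shift_pvar 1 hr, Nat.mod_eq_of_lt hr]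
    · have hr' : (r : ℕ) + 1 = m := by omega
      rw [shift_pvar_last 1 hr', hr', Nat.mod_self]
      simp
  rw [h1]
  exact hG _

theorem pY_one_symm_mul {r : ℕ} (hr : r < m) :
    pY 1 t m r (G * F) = G * pY 1 t m r F := by
  induction r generalizing F with
  | zero =>
    rw [pY_zero, pY_zero, descInv_symm_mul 1 t hG F le_rfl, pPi_apply, map_mul, shift_one_symm hG,
      pPi_apply, mul_smul_comm, mul_left_comm]
  | succ r ih =>
    rw [(isBernstein_pY 1 t).Y_succ hr, (isBernstein_pY 1 t).Y_succ hr, pT_symm_mul 1 t hG _ hr,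
      ih _ (by omega), pT_symm_mul 1 t hG _ hr, mul_smul_comm]

omit hG in
/-- At `q = 1`, the map `F ↦ F(Y) • 1` is multiplicative in the presence of a symmetric factor. -/
theorem qPoly_one_mul (hG : (qPoly 1 t m G).IsSymmetric) :
    qPoly 1 t m (F * G) = qPoly 1 t m F * qPoly 1 t m G := by
  induction F using poly_induction with
  | one => rw [one_mul, qPoly_one, one_mul]
  | add F F' hF hF' => rw [add_mul, map_add, hF, hF', map_add, add_mul]
  | smul c F hF => rw [smul_mul_assoc, map_smul, hF, map_smul, smul_mul_assoc]
  | mul j hj F hF =>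
    rw [mul_assoc, ← pX_apply, ← pX_apply, qPoly_pX 1 t hj, qPoly_pX 1 t hj, hF, mul_comm,
      pY_one_symm_mul t hG _ hj, mul_comm]

end One

end Symmetric

/-! ### Square-free monomials are eigenvectors of q_(m) -/

section Elementary

set_option linter.unusedSectionVars false

open MvPolynomial

variable {k : Type*} [CommRing k] [IsDomain k] (q t : kˣ) {m : ℕ} [NeZero m]

/-- The composition `T_{n-1} ⋯ T_0`. -/
noncomputable def descEnd {V : Type*} [AddCommGroup V] [Module k V] (T : ℕ → Module.End k V) :
    ℕ → Module.End k V
  | 0 => 1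
  | n + 1 => T n * descEnd T n

theorem levelOne_descT (n : ℕ) (F : Laurent k m) :
    levelOne q t m (HeckeAlg.descT t m 1 n : HeckeAlg t m) F = descEnd (lT q t m) n F := by
  induction n with
  | zero => exact levelOne_one q t F
  | succ n ih => rw [HeckeAlg.descT, Units.val_mul, levelOne_mul, ih]; rfl

theorem levelOne_descTInv_of_eigen {i : ℕ} {F : Laurent k m}
    (hF : ∀ j, i ≤ j → j + 1 < m → lT q t m j F = (t : k) • F) {n : ℕ} (hn : i + n + 1 ≤ m) :
    levelOne q t m (HeckeAlg.descTInv t m ((i + 1 : ℕ) : ℤ) n : (HeckeAlg t m)ˣ) F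
      = ((t⁻¹ : kˣ) : k) ^ n • F := by
  induction n with
  | zero => rw [pow_zero, one_smul]; exact levelOne_one q t F
  | succ n ih =>
    have e : ((((i + 1 : ℕ) : ℤ) + n : ℤ) : ZMod m) = ((1 + (i + n : ℕ) : ℤ) : ZMod m) := by
      congr 1; push_cast; ring
    rw [HeckeAlg.descTInv, Units.val_mul, levelOne_mul, ih (by omega), map_smul, e,
      levelOne_simple_inv q t (by omega), tInv_eigen (hF _ (by omega) (by omega)), smul_smul,
      pow_succ]

/-- The inverse generators to the right of Π contribute a power of t⁻¹ that the normalization of Y_i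
cancels. -/
theorem lY_of_eigen {i : ℕ} (hi : i < m) {F : Laurent k m}
    (hF : ∀ j, i ≤ j → j + 1 < m → lT q t m j F = (t : k) • F) :
    lY q t m i F = descEnd (lT q t m) i (piFun q F) := by
  rw [lY, HeckeAlg.Y, Units.val_mul, Units.val_mul, Units.val_mul, levelOne_mul, levelOne_mul,
    levelOne_mul, levelOne_scalar, levelOne_descTInv_of_eigen q t hF (by omega), levelOne_Pi,
    Nat.add_sub_cancel, levelOne_descT, piFun_smul, map_smul, smul_smul, Units.val_pow_eq_pow_val,
    ← mul_pow, Units.mul_inv, one_pow, one_smul]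

theorem pY_of_eigen {i : ℕ} (hi : i < m) {F : MvPolynomial (Fin m) k}
    (hF : ∀ j, i ≤ j → j + 1 < m → pT q t m j F = (t : k) • F) :
    pY q t m i F = descEnd (pT q t m) i (pPi q m F) := by
  have h1 : ∀ n < m, ∀ F, toLaurent k m (descEnd (pT q t m) n F)
      = descEnd (lT q t m) n (toLaurent k m F) := by
    intro n hn F
    induction n with
    | zero => rfl
    | succ n ih =>
      refine (toLaurent_pT q t hn _).trans ?_
      rw [ih (by omega)]; rfl
  apply toLaurent_injective
  rw [toLaurent_pY q t hi, h1 i hi, toLaurent_pPi]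
  refine lY_of_eigen q t hi fun j h1 h2 => ?_
  rw [← toLaurent_pT q t h2, hF j h1 h2, map_smul]

theorem pT_prod_mul {r : ℕ} (hr : r + 1 < m) {S : Finset ℕ} {f : ℕ → ℕ}
    (hf : ∀ j ∈ S, f j < m ∧ f j ≠ r ∧ f j ≠ r + 1) (F : MvPolynomial (Fin m) k) :
    pT q t m r ((∏ j ∈ S, pvar k m (f j)) * F) = (∏ j ∈ S, pvar k m (f j)) * pT q t m r F := by
  induction S using Finset.induction_on with
  | empty => simp
  | insert a S ha ih =>
    obtain ⟨h1, h2, h3⟩ := hf a (Finset.mem_insert_self _ _)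
    rw [Finset.prod_insert ha, mul_assoc, ← pX_apply, (isBernstein_pX q t).far r _ hr h1 h2 h3,
      ih fun j hj => hf j (Finset.mem_insert_of_mem hj), pX_apply, mul_assoc]

theorem pT_pvar_mul_pvar {r : ℕ} (hr : r + 1 < m) :
    pT q t m r (pvar k m r * pvar k m (r + 1)) = (t : k) • (pvar k m r * pvar k m (r + 1)) := by
  rw [pT_eq_smul_iff q t hr, map_mul, swapVar_left, swapVar_right, mul_comm]

theorem pT_pvar {r : ℕ} (hr : r + 1 < m) : pT q t m r (pvar k m r) = pvar k m (r + 1) := by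
  have := (isBernstein_pX (k := k) q t (m := m)).up r hr 1
  rw [pT_one q t hr, ← add_smul, add_sub_cancel, one_smul, pX_apply, mul_one, pX_apply, mul_one]
    at this
  exact this

/-- The variable X_n travels upwards. If n is not in J, then T_n turns X_n into X_{n+1}. If n is in
J, then X_n X_{n+1} occurs, an eigenvector with eigenvalue t; its factor X_n stays behind for n in
J, and X_{n+1} travels on. -/
theorem descEnd_prod {i : ℕ} (hi : i < m) {J : Finset ℕ} (hJ : ∀ j ∈ J, j < i) {n : ℕ} (hn : n ≤ i) :
    descEnd (pT q t m) n (pvar k m 0 * ∏ j ∈ J, pvar k m (j + 1))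
      = (t : k) ^ (J.filter (· < n)).card • ((∏ j ∈ J.filter (· < n), pvar k m j) *
        ((∏ j ∈ J.filter (n ≤ ·), pvar k m (j + 1)) * pvar k m n)) := by
  induction n with
  | zero =>
    simp only [Nat.not_lt_zero, Finset.filter_false, Finset.card_empty, pow_zero, one_smul,
      Finset.prod_empty, one_mul, Nat.zero_le, Finset.filter_true]
    exact mul_comm _ _
  | succ n ih =>
    have hr : n + 1 < m := by omega
    change pT q t m n (descEnd (pT q t m) n _) = _
    rw [ih (by omega), map_smul, pT_prod_mul q t hr (f := fun j => j)]
    swap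
    · intro j hj
      have h1 := (Finset.mem_filter.mp hj).2
      have h2 := hJ j (Finset.mem_filter.mp hj).1
      omega
    by_cases hnJ : n ∈ J
    · have e1 : J.filter (· < n + 1) = insert n (J.filter (· < n)) := by
        ext j; simp only [Finset.mem_filter, Finset.mem_insert]
        constructor
        · rintro ⟨h1, h2⟩; rcases Nat.lt_succ_iff_lt_or_eq.mp h2 with h | h
          · exact Or.inr ⟨h1, h⟩
          · exact Or.inl h
        · rintro (rfl | ⟨h1, h2⟩)
          · exact ⟨hnJ, by omega⟩
          · exact ⟨h1, by omega⟩
      have e2 : J.filter (n ≤ ·) = insert n (J.filter (n + 1 ≤ ·)) := by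
        ext j; simp only [Finset.mem_filter, Finset.mem_insert]
        constructor
        · rintro ⟨h1, h2⟩; rcases Nat.eq_or_lt_of_le h2 with h | h
          · exact Or.inl h.symm
          · exact Or.inr ⟨h1, h⟩
        · rintro (rfl | ⟨h1, h2⟩)
          · exact ⟨hnJ, le_rfl⟩
          · exact ⟨h1, by omega⟩
      have n1 : n ∉ J.filter (· < n) := by simp
      have n2 : n ∉ J.filter (n + 1 ≤ ·) := by simp
      rw [e1, e2, Finset.prod_insert n1, Finset.prod_insert n2, Finset.card_insert_of_notMem n1]
      rw [show pvar k m (n + 1) * (∏ j ∈ J.filter (n + 1 ≤ ·), pvar k m (j + 1)) * pvar k m n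
        = (∏ j ∈ J.filter (n + 1 ≤ ·), pvar k m (j + 1)) * (pvar k m n * pvar k m (n + 1)) by ring,
        pT_prod_mul q t hr (f := fun j => j + 1), pT_pvar_mul_pvar q t hr, mul_smul_comm,
        mul_smul_comm, smul_smul, pow_succ]
      · congr 1
        ring
      · intro j hj
        have h1 := (Finset.mem_filter.mp hj).2
        have h2 := hJ j (Finset.mem_filter.mp hj).1
        omega
    · have e1 : J.filter (· < n + 1) = J.filter (· < n) := by
        refine Finset.filter_congr fun j hj => ?_
        have : j ≠ n := fun h => hnJ (h ▸ hj)
        omega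
      have e2 : J.filter (n ≤ ·) = J.filter (n + 1 ≤ ·) := by
        refine Finset.filter_congr fun j hj => ?_
        have : j ≠ n := fun h => hnJ (h ▸ hj)
        omega
      rw [e1, e2, pT_prod_mul q t hr (f := fun j => j + 1), pT_pvar q t hr]
      intro j hj
      have h1 := (Finset.mem_filter.mp hj).2
      have h2 := hJ j (Finset.mem_filter.mp hj).1
      omega

theorem pY_prod {i : ℕ} (hi : i < m) {J : Finset ℕ} (hJ : ∀ j ∈ J, j < i) :
    pY q t m i (∏ j ∈ J, pvar k m j)
      = (t : k) ^ J.card • (pvar k m i * ∏ j ∈ J, pvar k m j) := by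
  have h1 : ∀ j, i ≤ j → j + 1 < m → pT q t m j (∏ j ∈ J, pvar k m j)
      = (t : k) • ∏ j ∈ J, pvar k m j := by
    intro j h1 h2
    have := pT_prod_mul q t h2 (S := J) (f := fun j => j) (fun l hl => by
      have := hJ l hl
      omega) 1
    rw [pT_one q t h2, mul_smul_comm, mul_one] at this
    exact this
  have h2 : pPi q m (∏ j ∈ J, pvar k m j) = pvar k m 0 * ∏ j ∈ J, pvar k m (j + 1) := by
    rw [pPi_apply, map_prod]
    congr 1
    exact Finset.prod_congr rfl fun j hj => shift_pvar q (by have := hJ j hj; omega)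
  have e1 : J.filter (· < i) = J := Finset.filter_true_of_mem hJ
  have e2 : J.filter (i ≤ ·) = ∅ := Finset.filter_false_of_mem fun j hj => by
    have := hJ j hj; omega
  rw [pY_of_eigen q t hi h1, h2, descEnd_prod q t hi hJ le_rfl, e1, e2, Finset.prod_empty, one_mul,
    mul_comm]

/-- The square-free monomials are eigenvectors of `F ↦ F(Y) • 1`. -/
theorem qPoly_prod (I : Finset ℕ) (hI : ∀ i ∈ I, i < m) :
    qPoly q t m (∏ i ∈ I, pvar k m i)
      = (t : k) ^ (I.card * (I.card - 1) / 2) • ∏ i ∈ I, pvar k m i := by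
  -- The largest index is split off, so that Y_i meets only variables of smaller index, as `pY_prod`
  -- requires.
  induction I using Finset.induction_on_max with
  | empty => simp [qPoly_one]
  | insert i J hJ ih =>
    have hi : i ∉ J := fun h => lt_irrefl _ (hJ i h)
    have him := hI i (Finset.mem_insert_self _ _)
    have e : J.card * (J.card - 1) / 2 + J.card = (J.card + 1) * (J.card + 1 - 1) / 2 := by
      have := Nat.triangle_succ J.card
      omega
    rw [Finset.prod_insert hi, ← pX_apply, qPoly_pX q t him,
      ih fun j hj => hI j (Finset.mem_insert_of_mem hj), map_smul, pY_prod q t him hJ, smul_smul,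
      Finset.card_insert_of_notMem hi, ← pow_add, pX_apply, e]

theorem qPoly_esymm (r : ℕ) : qPoly q t m (esymm (Fin m) k r)
    = (t : k) ^ (r * (r - 1) / 2) • esymm (Fin m) k r := by
  rw [esymm, map_sum, Finset.smul_sum]
  refine Finset.sum_congr rfl fun s hs => ?_
  have h1 : (∏ i ∈ s, X i : MvPolynomial (Fin m) k)
      = ∏ j ∈ s.map Fin.valEmbedding, pvar k m j := by
    rw [Finset.prod_map]
    exact Finset.prod_congr rfl fun i _ => X_eq_pvar i
  have h2 := qPoly_prod q t (s.map Fin.valEmbedding) (m := m) (fun i hi => by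
    obtain ⟨j, _, rfl⟩ := Finset.mem_map.mp hi
    exact j.2)
  rw [Finset.card_map, (Finset.mem_powersetCard.mp hs).2] at h2
  rw [h1, h2]

end Elementary

/-! ### Generating functions of proper colourings and the action of T_i -/

section Colouring

variable {k V : Type*} [CommRing k] [AddCommGroup V] [Module k V]

/-- The colour `x` is used by none of the vertices `e l, …, l - 1`. -/
def IsFree (e : ℕ → ℕ) (l : ℕ) (κ : ℕ → ℕ) (x : ℕ) : Prop := ∀ j ∈ Finset.Ico (e l) l, κ j ≠ x

instance (e : ℕ → ℕ) (l : ℕ) (κ : ℕ → ℕ) (x : ℕ) : Decidable (IsFree e l κ x) :=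
  inferInstanceAs (Decidable (∀ j ∈ Finset.Ico (e l) l, κ j ≠ x))

/-- The number of vertices among `e l, …, l - 1` whose colour exceeds `x`. -/
def exceed (e : ℕ → ℕ) (l : ℕ) (κ : ℕ → ℕ) (x : ℕ) : ℕ :=
  ((Finset.Ico (e l) l).filter fun j => x < κ j).card

/-- The sum of the vectors `t^d Y_{κ l} ⋯ Y_{κ (l + s - 1)} v₀` over the extensions of a colouring `κ`
of the vertices below `l` to proper colourings of the vertices below `l + s`, where `d` is the number
of descents at the new vertices. -/
noncomputable def colourSum (t : kˣ) (m : ℕ) (Y : ℕ → Module.End k V) (v₀ : V) (e : ℕ → ℕ) :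
    ℕ → ℕ → (ℕ → ℕ) → V
  | 0, _, _ => v₀
  | s + 1, l, κ => ∑ x ∈ Finset.range m, if IsFree e l κ x then
      (t : k) ^ exceed e l κ x • Y x (colourSum t m Y v₀ e s (l + 1) (Function.update κ l x)) else 0

theorem map_colourSum {V' : Type*} [AddCommGroup V'] [Module k V'] (t : kˣ) {m : ℕ}
    {Y : ℕ → Module.End k V} {Y' : ℕ → Module.End k V'} (f : V →ₗ[k] V')
    (hf : ∀ j < m, ∀ v, f (Y j v) = Y' j (f v)) (v₀ : V) (e : ℕ → ℕ) (s l : ℕ) (κ : ℕ → ℕ) :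
    f (colourSum t m Y v₀ e s l κ) = colourSum t m Y' (f v₀) e s l κ := by
  induction s generalizing l κ with
  | zero => rfl
  | succ s ih =>
    rw [colourSum, colourSum, map_sum]
    refine Finset.sum_congr rfl fun x hx => ?_
    split_ifs with h
    · rw [map_smul, hf x (Finset.mem_range.mp hx), ih]
    · exact map_zero f

theorem isFree_congr {e : ℕ → ℕ} {l : ℕ} {κ κ' : ℕ → ℕ} (h : ∀ j ∈ Finset.Ico (e l) l, κ j = κ' j)
    (x : ℕ) : IsFree e l κ x ↔ IsFree e l κ' x :=
  forall_congr' fun j => forall_congr' fun hj => by rw [h j hj]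

theorem exceed_congr {e : ℕ → ℕ} {l : ℕ} {κ κ' : ℕ → ℕ} (h : ∀ j ∈ Finset.Ico (e l) l, κ j = κ' j)
    (x : ℕ) : exceed e l κ x = exceed e l κ' x := by
  rw [exceed, exceed, Finset.filter_congr fun j hj => by rw [h j hj]]

theorem sum_range_eq_of_pair {M : Type*} [AddCommMonoid M] {m i : ℕ} (hi : i + 1 < m) {f g : ℕ → M}
    (h : ∀ x < m, x ≠ i → x ≠ i + 1 → f x = g x) (h' : f i + f (i + 1) = g i + g (i + 1)) :
    ∑ x ∈ Finset.range m, f x = ∑ x ∈ Finset.range m, g x := by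
  have h1 : i ∈ Finset.range m := Finset.mem_range.mpr (by omega)
  have h2 : i + 1 ∈ (Finset.range m).erase i :=
    Finset.mem_erase.mpr ⟨by omega, Finset.mem_range.mpr hi⟩
  rw [← Finset.add_sum_erase _ f h1, ← Finset.add_sum_erase _ g h1, ← Finset.add_sum_erase _ f h2,
    ← Finset.add_sum_erase _ g h2, ← add_assoc, h', add_assoc]
  congr 2
  refine Finset.sum_congr rfl fun x hx => ?_
  simp only [Finset.mem_erase, Finset.mem_range] at hx
  exact h x hx.2.2 hx.2.1 hx.1

/-- The exchange of the colours `i` and `i + 1`. -/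
def swapColour (i : ℕ) (κ : ℕ → ℕ) (j : ℕ) : ℕ := Equiv.swap i (i + 1) (κ j)

theorem swapColour_swapColour (i : ℕ) (κ : ℕ → ℕ) : swapColour i (swapColour i κ) = κ :=
  funext fun _ => Equiv.swap_apply_self _ _ _

theorem swapColour_update (i l x : ℕ) (κ : ℕ → ℕ) : swapColour i (Function.update κ l x)
    = Function.update (swapColour i κ) l (Equiv.swap i (i + 1) x) := by
  funext j
  unfold swapColour
  by_cases h : j = l
  · subst h; simp
  · simp [h]

theorem swapColour_of_ne {i : ℕ} {κ : ℕ → ℕ} {j : ℕ} (h1 : κ j ≠ i) (h2 : κ j ≠ i + 1) :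
    swapColour i κ j = κ j := Equiv.swap_apply_of_ne_of_ne h1 h2

theorem isFree_swapColour (e : ℕ → ℕ) (l i x : ℕ) (κ : ℕ → ℕ) :
    IsFree e l (swapColour i κ) x ↔ IsFree e l κ (Equiv.swap i (i + 1) x) := by
  refine forall_congr' fun j => forall_congr' fun _ => not_congr ?_
  rw [swapColour, ← Equiv.eq_symm_apply, Equiv.symm_swap]

theorem lt_swapColour_iff {i x : ℕ} (h1 : x ≠ i) {κ : ℕ → ℕ} {j : ℕ} :
    x < swapColour i κ j ↔ x < κ j := by
  rw [swapColour, Equiv.swap_apply_def]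
  split_ifs <;> omega

theorem exceed_swapColour {i x : ℕ} (h1 : x ≠ i) (e : ℕ → ℕ) (l : ℕ) (κ : ℕ → ℕ) :
    exceed e l (swapColour i κ) x = exceed e l κ x := by
  rw [exceed, exceed, Finset.filter_congr fun _ _ => lt_swapColour_iff h1]

theorem exceed_of_isFree_succ {e : ℕ → ℕ} {l i : ℕ} {κ : ℕ → ℕ} (h : IsFree e l κ (i + 1)) :
    exceed e l κ i = exceed e l κ (i + 1) := by
  rw [exceed, exceed]
  congr 1
  refine Finset.filter_congr fun j hj => ?_
  have := h j hj
  omega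

theorem exceed_of_mem {e : ℕ → ℕ} {l i : ℕ} {κ : ℕ → ℕ}
    (hinj : Set.InjOn κ (Finset.Ico (e l) l)) {j : ℕ} (hj : j ∈ Finset.Ico (e l) l)
    (h : κ j = i + 1) : exceed e l κ i = exceed e l κ (i + 1) + 1 := by
  rw [exceed, exceed]
  have : (Finset.Ico (e l) l).filter (fun j => i < κ j)
      = insert j ((Finset.Ico (e l) l).filter fun j => i + 1 < κ j) := by
    ext a
    rw [Finset.mem_insert, Finset.mem_filter, Finset.mem_filter]
    constructor
    · rintro ⟨h1, h2⟩
      by_cases h3 : κ a = i + 1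
      · exact Or.inl (hinj h1 hj (h3.trans h.symm))
      · exact Or.inr ⟨h1, by omega⟩
    · rintro (rfl | ⟨h1, h2⟩)
      · exact ⟨hj, by omega⟩
      · exact ⟨h1, by omega⟩
  rw [this, Finset.card_insert_of_notMem]
  simp [h]

/-- As `e` is monotone, the window of earlier neighbours of l + 1 lies in that of l together with l.
Windows thus remain cliques with distinct colours. -/
theorem injOn_update {e : ℕ → ℕ} (he : Monotone e) {l x : ℕ} {κ : ℕ → ℕ}
    (hinj : Set.InjOn κ (Finset.Ico (e l) l)) (hx : IsFree e l κ x) :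
    Set.InjOn (Function.update κ l x) (Finset.Ico (e (l + 1)) (l + 1)) := by
  have h0 : e l ≤ e (l + 1) := he (Nat.le_succ l)
  intro a ha b hb hab
  simp only [Finset.coe_Ico, Set.mem_Ico] at ha hb
  by_cases h1 : a = l <;> by_cases h2 : b = l
  · rw [h1, h2]
  · subst h1
    rw [Function.update_self, Function.update_of_ne h2] at hab
    exact absurd hab.symm (hx b (Finset.mem_Ico.mpr (by omega)))
  · subst h2
    rw [Function.update_self, Function.update_of_ne h1] at hab
    exact absurd hab (hx a (Finset.mem_Ico.mpr (by omega)))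
  · rw [Function.update_of_ne h1, Function.update_of_ne h2] at hab
    exact hinj (by simp only [Finset.coe_Ico, Set.mem_Ico]; omega)
      (by simp only [Finset.coe_Ico, Set.mem_Ico]; omega) hab

theorem injOn_swapColour {e : ℕ → ℕ} {l i : ℕ} {κ : ℕ → ℕ}
    (hinj : Set.InjOn κ (Finset.Ico (e l) l)) :
    Set.InjOn (swapColour i κ) (Finset.Ico (e l) l) :=
  fun _ ha _ hb hab => hinj ha hb ((Equiv.swap i (i + 1)).injective hab)

variable {t : kˣ} {m : ℕ} {Y : ℕ → Module.End k V} {v₀ : V} {e : ℕ → ℕ} (he : Monotone e)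
include he

/-- Only the colours in the current window matter: later windows start no further back. -/
theorem colourSum_congr {s l : ℕ} {κ κ' : ℕ → ℕ} (h : ∀ j ∈ Finset.Ico (e l) l, κ j = κ' j) :
    colourSum t m Y v₀ e s l κ = colourSum t m Y v₀ e s l κ' := by
  induction s generalizing l κ κ' with
  | zero => rfl
  | succ s ih =>
    rw [colourSum, colourSum]
    refine Finset.sum_congr rfl fun x _ => ?_
    have h1 : colourSum t m Y v₀ e s (l + 1) (Function.update κ l x)
        = colourSum t m Y v₀ e s (l + 1) (Function.update κ' l x) := by
      refine ih fun j hj => ?_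
      have h0 : e l ≤ e (l + 1) := he (Nat.le_succ l)
      have hj := Finset.mem_Ico.mp hj
      by_cases h2 : j = l
      · subst h2; simp
      · rw [Function.update_of_ne h2, Function.update_of_ne h2]
        exact h j (Finset.mem_Ico.mpr (by omega))
    simp only [isFree_congr h, exceed_congr h, h1]

variable {T : ℕ → Module.End k V} (hB : IsBernstein t m T Y)
  (hv : ∀ i, i + 1 < m → T i v₀ = (t : k) • v₀)
include hB hv

/-- The action of `T_i` on the sums of colourings: if the colour `i` occurs, then it has to be
followed by the colour `i + 1`. -/
theorem T_colourSum {i : ℕ} (hi : i + 1 < m) (s : ℕ) {l : ℕ} {κ : ℕ → ℕ}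
    (hinj : Set.InjOn κ (Finset.Ico (e l) l))
    (hok : ∀ j ∈ Finset.Ico (e l) l, κ j = i → ∃ j' ∈ Finset.Ioo j l, κ j' = i + 1) :
    T i (colourSum t m Y v₀ e s l κ) = (t : k) • colourSum t m Y v₀ e s l (swapColour i κ) := by
  induction s generalizing l κ with
  | zero => exact hv i hi
  | succ s ih =>
    have h0 : e l ≤ e (l + 1) := he (Nat.le_succ l)
    rw [colourSum, colourSum, map_sum, Finset.smul_sum]
    -- For a new colour other than i and i + 1, T_i commutes with Y_x and the induction applies. The
    -- two remaining terms have to be treated together.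
    apply sum_range_eq_of_pair hi
    · intro x hx h1 h2
      have hsw : Equiv.swap i (i + 1) x = x := Equiv.swap_apply_of_ne_of_ne h1 h2
      simp only [isFree_swapColour, exceed_swapColour h1, hsw]
      split_ifs with hf
      · have h3 := swapColour_update i l x κ
        rw [hsw] at h3
        rw [map_smul, hB.far i x hi hx h1 h2, ih (injOn_update he hinj hf), h3, map_smul, smul_comm]
        intro j hj hji
        have hj := Finset.mem_Ico.mp hj
        by_cases hjl : j = l
        · subst hjl; simp [h1] at hji
        · rw [Function.update_of_ne hjl] at hji
          obtain ⟨j', hj', h4⟩ := hok j (Finset.mem_Ico.mpr (by omega)) hji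
          have hj' := Finset.mem_Ioo.mp hj'
          exact ⟨j', Finset.mem_Ioo.mpr (by omega), by rw [Function.update_of_ne (by omega), h4]⟩
      · rw [map_zero, smul_zero]
    · have hl : Equiv.swap i (i + 1) i = i + 1 := Equiv.swap_apply_left _ _
      have hr : Equiv.swap i (i + 1) (i + 1) = i := Equiv.swap_apply_right _ _
      simp only [isFree_swapColour, hl, hr]
      -- If i is taken, then by `hok` so is i + 1, and both pairs of terms vanish.
      by_cases hfi : IsFree e l κ i
      swap
      · have hfi' : ¬ IsFree e l κ (i + 1) := by
          intro h
          apply hfi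
          intro j hj hji
          obtain ⟨j', hj', h4⟩ := hok j hj hji
          have h5 := Finset.mem_Ioo.mp hj'
          have h6 := Finset.mem_Ico.mp hj
          exact h j' (Finset.mem_Ico.mpr (by omega)) h4
        simp [hfi, hfi']
      set w := colourSum t m Y v₀ e s (l + 1) (Function.update κ l i) with hw
      set u := colourSum t m Y v₀ e s (l + 1) (Function.update (swapColour i κ) l (i + 1)) with hu
      have hfs : IsFree e l (swapColour i κ) (i + 1) := by rwa [isFree_swapColour, hr]
      -- In `u` the last vertex has colour i + 1, so the hypothesis of the induction holds whatever
      -- came before.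
      have hu1 : T i u = (t : k) • w := by
        rw [hu, ih (injOn_update he (injOn_swapColour hinj) hfs), swapColour_update, hr,
          swapColour_swapColour]
        intro j hj hji
        have hj := Finset.mem_Ico.mp hj
        have hjl : j ≠ l := by
          rintro rfl
          simp at hji
        exact ⟨l, Finset.mem_Ioo.mpr (by omega), by simp⟩
      -- In `w` the last vertex has colour i, so the induction does not apply; the quadratic
      -- relation and `hu1` give the value instead.
      have hw1 : T i w = ((t : k) - 1) • w + u := by
        apply hB.T_injective hi
        have h1 := hB.quad i hi u
        have h2 := hB.quad i hi w
        rw [hu1, map_smul] at h1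
        rw [h2, map_add, map_smul, hu1, add_comm]
      have hyw : T i (Y i w) = Y (i + 1) u := by
        rw [hB.up i hi, hw1]
        congr 1
        module
      -- If both colours are free, the swap does not change the window, and Y_i w + Y_{i+1} u is an
      -- eigenvector of T_i. Otherwise one term survives on each side, and the vertex of colour i +
      -- 1 is the extra descent that accounts for the factor t.
      by_cases hfi' : IsFree e l κ (i + 1)
      · have hκ : ∀ j ∈ Finset.Ico (e l) l, swapColour i κ j = κ j :=
          fun j hj => swapColour_of_ne (hfi j hj) (hfi' j hj)
        have hup : ∀ x, colourSum t m Y v₀ e s (l + 1) (Function.update (swapColour i κ) l x)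
            = colourSum t m Y v₀ e s (l + 1) (Function.update κ l x) := by
          intro x
          refine colourSum_congr he fun j hj => ?_
          have hj := Finset.mem_Ico.mp hj
          by_cases h2 : j = l
          · subst h2; simp
          · rw [Function.update_of_ne h2, Function.update_of_ne h2]
            exact hκ j (Finset.mem_Ico.mpr (by omega))
        rw [if_pos hfi, if_pos hfi', if_pos hfi, if_pos hfi', exceed_congr hκ, exceed_congr hκ,
          exceed_of_isFree_succ hfi', hup i, ← hup (i + 1), ← hu, ← hw, map_smul, map_smul, hyw,
          hB.down i hi, hu1, map_smul]
        module
      · obtain ⟨j, hj, hj1⟩ : ∃ j ∈ Finset.Ico (e l) l, κ j = i + 1 := by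
          by_contra! h
          exact hfi' h
        rw [if_pos hfi, if_neg hfi', if_neg hfi', if_pos hfi, map_zero, add_zero, smul_zero,
          zero_add, exceed_swapColour (by omega), exceed_of_mem hinj hj hj1, map_smul, hyw, smul_smul,
          pow_succ']

theorem T_colourSum_zero {i : ℕ} (hi : i + 1 < m) (s : ℕ) (κ : ℕ → ℕ) :
    T i (colourSum t m Y v₀ e s 0 κ) = (t : k) • colourSum t m Y v₀ e s 0 κ := by
  rw [T_colourSum he hB hv hi s (by simp) (by simp)]
  congr 1
  exact colourSum_congr he (by simp)

end Colouring

/-! ### A telescoping sum of inverse generators -/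

section Staircase

variable {k V : Type*} [CommRing k] [AddCommGroup V] [Module k V] {t : kˣ} {m : ℕ}
  {T Y : ℕ → Module.End k V} (hB : IsBernstein t m T Y)
include hB

/-- The vectors `T_j⁻¹ ⋯ T_0⁻¹ Y_0 b_0`, for vectors with `T_i b_{i+1} = t b_i` and `T_i b_x = t b_x` for
`x < i`. -/
theorem descInv_Y_zero {N : ℕ} (hN : N ≤ m) {b : ℕ → V}
    (h1 : ∀ i, i + 1 < N → T i (b (i + 1)) = (t : k) • b i)
    (h2 : ∀ i x, i + 1 < N → x < i → T i (b x) = (t : k) • b x) {j : ℕ} (hj : j < N) :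
    descInv t T j (Y 0 (b 0)) = ((t⁻¹ : kˣ) : k) ^ j •
      (Y j (b j) + (1 - (t : k)) • ∑ x ∈ Finset.range j, Y x (b x)) := by
  have htu : (t : k) * ((t⁻¹ : kˣ) : k) = 1 := Units.mul_inv t
  induction j with
  | zero => simp [descInv]
  | succ j ih =>
    have hr : j + 1 < m := by omega
    have h3 : tInv t T j (b j) = ((t⁻¹ : kˣ) : k) • b (j + 1) := by
      have := congrArg (fun v => ((t⁻¹ : kˣ) : k) • tInv t T j v) (h1 j hj)
      simp only [map_smul, hB.tInv_T hr, smul_smul, Units.inv_mul, one_smul] at this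
      exact this.symm
    have h4 : tInv t T j (∑ x ∈ Finset.range j, Y x (b x))
        = ((t⁻¹ : kˣ) : k) • ∑ x ∈ Finset.range j, Y x (b x) := by
      rw [map_sum, Finset.smul_sum]
      refine Finset.sum_congr rfl fun x hx => ?_
      have hx := Finset.mem_range.mp hx
      rw [hB.tInv_far hr (by omega) (by omega) (by omega), tInv_eigen (h2 j x hj hx), map_smul]
    rw [descInv_succ, ih (by omega), map_smul, map_add, map_smul, h4, hB.tInv_Y hr, h3, map_smul,
      Finset.sum_range_succ]
    generalize ∑ x ∈ Finset.range j, Y x (b x) = S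
    generalize ((t⁻¹ : kˣ) : k) = u at *
    rw [pow_succ, ← smul_smul]
    congr 1
    linear_combination (norm := module) htu • Y j (b j)

/-- The terms telescope: passing from M to M + 1 multiplies the old sum by t, and the new term adds
1 - t times that sum besides Y_{M+1} b_{M+1}. -/
theorem sum_descInv_Y_zero {N : ℕ} (hN : N ≤ m) {b : ℕ → V}
    (h1 : ∀ i, i + 1 < N → T i (b (i + 1)) = (t : k) • b i)
    (h2 : ∀ i x, i + 1 < N → x < i → T i (b x) = (t : k) • b x) {M : ℕ} (hM : M < N) :
    (t : k) ^ M • ∑ j ∈ Finset.range (M + 1), descInv t T j (Y 0 (b 0))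
      = ∑ x ∈ Finset.range (M + 1), Y x (b x) := by
  induction M with
  | zero => simp [descInv]
  | succ M ih =>
    rw [Finset.sum_range_succ, descInv_Y_zero hB hN h1 h2 hM, smul_add, smul_smul, ← mul_pow,
      Units.mul_inv, one_pow, one_smul, pow_succ', mul_smul, ih (by omega),
      Finset.sum_range_succ _ (M + 1)]
    module

end Staircase

/-! ### Adding one vertex: colourings whose latest vertices have the top colours -/

section Stair

variable {k V : Type*} [CommRing k] [AddCommGroup V] [Module k V]

/-- The colouring of the vertices below `l` whose last colours are `m - 1, m - 2, …`. -/
def stair (m l j : ℕ) : ℕ := m - (l - j)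

/-- The cycle `m - 1 ↦ p ↦ p + 1 ↦ ⋯ ↦ m - 1`. -/
def cyc (m p v : ℕ) : ℕ := if v = m - 1 then p else if p ≤ v then v + 1 else v

variable {t : kˣ} {m : ℕ} {Y : ℕ → Module.End k V} {v₀ : V} {e : ℕ → ℕ}

/-- The window of l uses exactly the top colours, as many as it has vertices. So the free colours
form an initial segment, each of them below all colours of the window. -/
theorem isFree_stair {l x : ℕ} (hx : x < m) : IsFree e l (stair m l) x ↔ x < m - (l - e l) := by
  constructor
  · intro h
    by_contra hcon
    refine h (l - (m - x)) (Finset.mem_Ico.mpr (by omega)) ?_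
    unfold stair
    omega
  · intro h j hj
    have := Finset.mem_Ico.mp hj
    unfold stair
    omega

theorem exceed_stair {l x : ℕ} (hx : x < m - (l - e l)) : exceed e l (stair m l) x = l - e l := by
  rw [exceed, Finset.filter_true_of_mem, Nat.card_Ico]
  intro j hj
  have := Finset.mem_Ico.mp hj
  unfold stair
  omega

theorem injOn_stair {l : ℕ} (h : l - e l ≤ m) : Set.InjOn (stair m l) (Finset.Ico (e l) l) := by
  intro a ha b hb hab
  simp only [Finset.coe_Ico, Set.mem_Ico] at ha hb
  unfold stair at hab
  omega

variable (he : Monotone e) {T : ℕ → Module.End k V} (hB : IsBernstein t m T Y)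
  (hv : ∀ i, i + 1 < m → T i v₀ = (t : k) • v₀)
include he hB hv

/-- The vertex l starts with the top colour. Applying T_{m-2}, T_{m-3}, … lowers its colour step by
step and raises each colour it meets, with a factor t at each step. `T_colourSum` applies because l
is last in its window. -/
theorem ascProd_colourSum (s : ℕ) {l : ℕ} (hl : e l ≤ l) (hd : l - e l < m) {c : ℕ}
    (hc : c ≤ m - 1) :
    ascProd T (m - 1) (colourSum t m Y v₀ e s (l + 1) (stair m (l + 1)))
      = (t : k) ^ c • ascProd T (m - 1 - c)
        (colourSum t m Y v₀ e s (l + 1) (cyc m (m - 1 - c) ∘ stair m (l + 1))) := by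
  have h0 : e l ≤ e (l + 1) := he (Nat.le_succ l)
  induction c with
  | zero =>
    rw [pow_zero, one_smul, Nat.sub_zero]
    congr 1
    refine colourSum_congr he fun j hj => ?_
    have hj := Finset.mem_Ico.mp hj
    simp only [Function.comp, cyc, stair]
    grind
  | succ c ih =>
    obtain ⟨p, hp⟩ : ∃ p, m - 1 - c = p + 1 := ⟨m - 1 - c - 1, by omega⟩
    have hp' : m - 1 - (c + 1) = p := by omega
    rw [ih (by omega), hp, hp', ascProd_succ, T_colourSum he hB hv (by omega), map_smul, smul_smul,
      pow_succ]
    · congr 2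
      refine colourSum_congr he fun j hj => ?_
      have hj := Finset.mem_Ico.mp hj
      simp only [swapColour, Function.comp, cyc, stair, Equiv.swap_apply_def]
      grind
    · intro a ha b hb hab
      simp only [Finset.coe_Ico, Set.mem_Ico] at ha hb
      simp only [Function.comp, cyc, stair] at hab
      grind
    · intro j hj hjp
      have hj := Finset.mem_Ico.mp hj
      refine ⟨l, Finset.mem_Ioo.mpr ⟨?_, by omega⟩, ?_⟩
      · simp only [Function.comp, cyc, stair] at hjp
        grind
      · simp only [Function.comp, cyc, stair]
        grind

/-- The colours i and i + 1 are free in the window of l, so only the colour of l changes, and the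
colour i does not occur before the exchange. These are the relations that the telescoping sum
requires. -/
theorem T_colourSum_stair {i x y s l : ℕ} (hi : i + 1 < m - (l - e l)) (hy : y ≤ i + 1) (hyi : y ≠ i)
    (hx : Equiv.swap i (i + 1) y = x) :
    T i (colourSum t m Y v₀ e s (l + 1) (Function.update (stair m l) l y))
      = (t : k) • colourSum t m Y v₀ e s (l + 1) (Function.update (stair m l) l x) := by
  have h0 : e l ≤ e (l + 1) := he (Nat.le_succ l)
  rw [T_colourSum he hB hv (by omega) s
    (injOn_update he (injOn_stair (by omega)) ((isFree_stair (by omega)).mpr (by omega))),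
    swapColour_update, hx]
  · congr 1
    refine colourSum_congr he fun j hj => ?_
    have hj := Finset.mem_Ico.mp hj
    by_cases h2 : j = l
    · subst h2; simp
    · rw [Function.update_of_ne h2, Function.update_of_ne h2, swapColour_of_ne] <;>
        (unfold stair; omega)
  · intro j hj hji
    have hj := Finset.mem_Ico.mp hj
    by_cases h2 : j = l
    · subst h2
      rw [Function.update_self] at hji
      exact absurd hji hyi
    · rw [Function.update_of_ne h2] at hji
      unfold stair at hji
      omega

/-- The product T_0 ⋯ T_{m-2} takes the colour of l from the top to 0, which restores the staircase
before l; the sum of the T_j⁻¹ ⋯ T_0⁻¹ Y_0 then distributes l over all free colours. -/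
theorem sum_descInv_colourSum (s : ℕ) {l : ℕ} (hl : e l ≤ l) :
    ∑ j ∈ Finset.range (m - (l - e l)), descInv t T j (Y 0 (ascProd T (m - 1)
        (colourSum t m Y v₀ e s (l + 1) (stair m (l + 1)))))
      = colourSum t m Y v₀ e (s + 1) l (stair m l) := by
  have h0 : e l ≤ e (l + 1) := he (Nat.le_succ l)
  have h1 : colourSum t m Y v₀ e (s + 1) l (stair m l) = (t : k) ^ (l - e l) •
      ∑ x ∈ Finset.range (m - (l - e l)),
        Y x (colourSum t m Y v₀ e s (l + 1) (Function.update (stair m l) l x)) := by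
    rw [colourSum, Finset.smul_sum]
    symm
    refine Finset.sum_subset_zero_on_sdiff (Finset.range_mono (by omega)) ?_ ?_
    · intro x hx
      simp only [Finset.mem_sdiff, Finset.mem_range] at hx
      rw [if_neg (by rw [isFree_stair hx.1]; exact hx.2)]
    · intro x hx
      have hx := Finset.mem_range.mp hx
      rw [if_pos ((isFree_stair (by omega)).mpr hx), exceed_stair hx]
  rw [h1]
  -- If the window has at least m vertices, no colour is free and both sums are empty.
  obtain hd | hd := Nat.lt_or_ge (l - e l) m
  swap
  · rw [Nat.sub_eq_zero_of_le hd]; simp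
  obtain ⟨M, hM⟩ : ∃ M, m - (l - e l) = M + 1 := ⟨m - (l - e l) - 1, by omega⟩
  have h2 : ascProd T (m - 1) (colourSum t m Y v₀ e s (l + 1) (stair m (l + 1)))
      = (t : k) ^ (m - 1) •
        colourSum t m Y v₀ e s (l + 1) (Function.update (stair m l) l 0) := by
    rw [ascProd_colourSum he hB hv s hl hd le_rfl, Nat.sub_self]
    congr 1
    refine colourSum_congr he fun j hj => ?_
    have hj := Finset.mem_Ico.mp hj
    by_cases h2 : j = l
    · subst h2
      simp [cyc, stair]
    · rw [Function.update_of_ne h2]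
      simp only [Function.comp, cyc, stair]
      grind
  have h3 := sum_descInv_Y_zero hB (N := M + 1) (by omega)
    (b := fun x => colourSum t m Y v₀ e s (l + 1) (Function.update (stair m l) l x))
    (fun i hi => T_colourSum_stair he hB hv (by omega) le_rfl (by omega)
      (Equiv.swap_apply_right _ _))
    (fun i x hi hx => T_colourSum_stair he hB hv (by omega) (by omega) (by omega)
      (Equiv.swap_apply_of_ne_of_ne (by omega) (by omega))) (Nat.lt_succ_self M)
  -- The factor t^(l - e l) counts the descents at l and t^M comes from the telescoping; together
  -- they are the t^(m - 1) produced by T_0 ⋯ T_{m-2}.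
  rw [hM, ← h3, h2, smul_smul, ← pow_add, show l - e l + M = m - 1 by omega, Finset.smul_sum]
  refine Finset.sum_congr rfl fun j _ => ?_
  rw [map_smul, map_smul]

end Stair

/-! ### The element S_e applied to 1 -/

section Hecke

set_option linter.unusedSectionVars false

variable {k : Type*} [CommRing k] [IsDomain k] (q t : kˣ) {m : ℕ} [NeZero m]

theorem HeckeAlg.Pi_mul_descTInv (a : ℤ) (n : ℕ) :
    HeckeAlg.Pi t m * HeckeAlg.descTInv t m a n
      = HeckeAlg.descTInv t m (a + 1) n * HeckeAlg.Pi t m := by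
  induction n with
  | zero => exact (mul_one _).trans (one_mul _).symm
  | succ n ih =>
    have h := HeckeAlg.Pi_mul_T t ((a + n : ℤ) : ZMod m)
    have e : ((a + 1 + n : ℤ) : ZMod m) = ((a + n : ℤ) : ZMod m) + 1 := by push_cast; ring
    rw [HeckeAlg.descTInv, HeckeAlg.descTInv, e, mul_assoc, ← ih, ← mul_assoc, ← mul_assoc]
    congr 1
    rw [mul_inv_eq_iff_eq_mul, mul_assoc, h, inv_mul_cancel_left]

theorem sum_slide {A : Type*} [Ring A] {p : A} {s : Finset ℕ} {f g : ℕ → A}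
    (h : ∀ n, p * f n = g n * p) : p * ∑ n ∈ s, f n = (∑ n ∈ s, g n) * p := by
  rw [Finset.mul_sum, Finset.sum_mul]
  exact Finset.sum_congr rfl fun n _ => h n

theorem pow_slide {A : Type*} [Ring A] {p : A} {f : ℕ → A} (h : ∀ n, p * f n = f (n + 1) * p)
    (n : ℕ) : p ^ n * f 0 = f n * p ^ n := by
  induction n with
  | zero => rw [pow_zero, one_mul, mul_one]
  | succ n ih => rw [pow_succ', mul_assoc, ih, ← mul_assoc, h, mul_assoc]

theorem slide_step {A : Type*} [Ring A] {p a b c : A} {n : ℕ} (h : p ^ n * a = b * p ^ n) :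
    c * b * p ^ (n + 1) = c * p ^ n * (a * p) := by
  rw [mul_assoc c (p ^ n), ← mul_assoc (p ^ n), h, pow_succ]
  simp only [mul_assoc]

theorem HeckeAlg.Pi_mul_S (i e : ℤ) :
    (HeckeAlg.Pi t m : HeckeAlg t m) * HeckeAlg.S t m i e
      = HeckeAlg.S t m (i + 1) (e + 1) * (HeckeAlg.Pi t m : HeckeAlg t m) := by
  unfold HeckeAlg.S
  by_cases h : i - m ≤ e
  · rw [if_pos h, if_pos (by omega), show (m : ℤ) + (e + 1) - (i + 1) + 1 = m + e - i + 1 by ring]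
    exact sum_slide fun n => congrArg Units.val (HeckeAlg.Pi_mul_descTInv t i n)
  · rw [if_neg h, if_neg (by omega)]
    exact (mul_zero _).trans (zero_mul _).symm

/-- Conjugation by Π raises both indices of S by one, so each S can be brought to one that starts
with T_1⁻¹ and acts right after a single Π. -/
theorem HeckeAlg.Pi_pow_mul_S (e : ℤ) (n : ℕ) :
    (HeckeAlg.Pi t m : HeckeAlg t m) ^ n * HeckeAlg.S t m 1 (e - n)
      = HeckeAlg.S t m (n + 1) e * (HeckeAlg.Pi t m : HeckeAlg t m) ^ n := by
  have h := pow_slide (p := (HeckeAlg.Pi t m : HeckeAlg t m))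
    (f := fun i : ℕ => HeckeAlg.S t m (i + 1) (e - n + i)) (fun i => by
      have := HeckeAlg.Pi_mul_S t (m := m) (i + 1) (e - n + i)
      rw [show e - n + (i : ℤ) + 1 = e - n + ((i + 1 : ℕ) : ℤ) by push_cast; ring] at this
      exact_mod_cast this) n
  simpa using h

theorem levelOne_sum {ι : Type*} (s : Finset ι) (x : ι → HeckeAlg t m) (F : Laurent k m) :
    levelOne q t m (∑ i ∈ s, x i) F = ∑ i ∈ s, levelOne q t m (x i) F := by
  have : levelOne q t m (∑ i ∈ s, x i) = ∑ i ∈ s, levelOne q t m (x i) := map_sum _ _ _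
  rw [this, LinearMap.sum_apply]

theorem levelOne_S {e l : ℕ} (hl : e ≤ l) (F : Laurent k m) :
    levelOne q t m (HeckeAlg.S t m 1 ((e : ℤ) - l)) F
      = ∑ j ∈ Finset.range (m - (l - e)), descInv t (lT q t m) j F := by
  have h1 : HeckeAlg.S t m 1 ((e : ℤ) - l)
      = ∑ j ∈ Finset.range (m - (l - e)), (HeckeAlg.descTInv t m 1 j : HeckeAlg t m) := by
    unfold HeckeAlg.S
    have h2 : ((m : ℤ) + (e - l) - 1 + 1).toNat = m - (l - e) := by omega
    rw [h2]
    split_ifs with h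
    · rfl
    -- The convention that S vanishes for small e agrees with the truncated subtraction of natural
    -- numbers.
    · have h3 : m - (l - e) = 0 := by omega
      rw [h3]
      rfl
  rw [h1, levelOne_sum]
  refine Finset.sum_congr rfl fun j hj => ?_
  have := Finset.mem_range.mp hj
  exact levelOne_descTInv q t (by omega) F

variable {e : ℕ → ℕ} (he : Monotone e) (hle : ∀ l, e l ≤ l)
include he hle

/-- Writing Π as t^{1-m} Y_0 T_0 ⋯ T_{m-2} turns this into `sum_descInv_colourSum`: one factor S Π
prepends the vertex l. -/
theorem levelOne_S_mul_Pi (s l : ℕ) :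
    (t : k) ^ (m - 1) • levelOne q t m (HeckeAlg.S t m 1 ((e l : ℤ) - l) * HeckeAlg.Pi t m)
      (colourSum t m (lY q t m) 1 e s (l + 1) (stair m (l + 1)))
      = colourSum t m (lY q t m) 1 e (s + 1) l (stair m l) := by
  rw [← sum_descInv_colourSum he (isBernstein_lY q t) (fun i hi => lT_one q t hi) s (hle l),
    levelOne_mul, levelOne_Pi, levelOne_S q t (hle l), piFun_eq, Finset.smul_sum]
  refine Finset.sum_congr rfl fun j _ => ?_
  rw [map_smul, smul_smul, ← mul_pow, Units.mul_inv, one_pow, one_smul]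

theorem levelOne_prod_S (n s : ℕ) :
    (t : k) ^ (n * (m - 1)) • levelOne q t m
      ((List.ofFn fun r : Fin n => HeckeAlg.S t m ((r : ℤ) + 1) (e r)).prod *
        (HeckeAlg.Pi t m : HeckeAlg t m) ^ n) (colourSum t m (lY q t m) 1 e s n (stair m n))
      = colourSum t m (lY q t m) 1 e (n + s) 0 (stair m 0) := by
  induction n generalizing s with
  | zero =>
    rw [Nat.zero_mul, pow_zero, one_smul, Nat.zero_add]
    refine Eq.trans (congrArg (fun x : HeckeAlg t m => levelOne q t m x _) ?_) (levelOne_one q t _)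
    exact (congrArg (List.prod [] * ·) (pow_zero _)).trans (mul_one _)
  | succ n ih =>
    -- The last factor S is slid through n of the factors Π. It acts first and adds vertex n; the
    -- remaining product has the same form with n factors.
    have h1 : (List.ofFn fun r : Fin (n + 1) => HeckeAlg.S t m ((r : ℤ) + 1) (e r)).prod *
        (HeckeAlg.Pi t m : HeckeAlg t m) ^ (n + 1)
        = (List.ofFn fun r : Fin n => HeckeAlg.S t m ((r : ℤ) + 1) (e r)).prod *
          (HeckeAlg.Pi t m : HeckeAlg t m) ^ n *
          (HeckeAlg.S t m 1 ((e n : ℤ) - n) * HeckeAlg.Pi t m) := by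
      refine Eq.trans ?_ (slide_step (HeckeAlg.Pi_pow_mul_S t (e n) n))
      refine congrArg (· * (HeckeAlg.Pi t m : HeckeAlg t m) ^ (n + 1)) ?_
      rw [List.ofFn_succ', List.prod_concat]
      rfl
    rw [h1, levelOne_mul, Nat.succ_mul, pow_add, mul_smul, ← map_smul, levelOne_S_mul_Pi q t he hle,
      ih, Nat.add_right_comm n 1 s, Nat.add_assoc]

/-- The vector `S_e • 1` is the image of a generating function of colourings. -/
theorem levelOne_SE (n : ℕ) (κ : ℕ → ℕ) :
    levelOne q t m (HeckeAlg.SE t m fun r : Fin n => e r) 1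
      = toLaurent k m (qPoly q t m (colourSum t m (pX k m) 1 e n 0 κ)) := by
  have h := levelOne_prod_S q t he hle n 0 (m := m)
  rw [HeckeAlg.SE, levelOne_smul]
  refine h.trans ?_
  have h1 := map_colourSum t (qPoly q t m) (fun j hj F => qPoly_pX q t hj F) 1 e n 0 κ
  have h2 := map_colourSum t (toLaurent k m).toLinearMap (fun j hj F => toLaurent_pY q t hj F)
    1 e n 0 κ
  rw [qPoly_one] at h1
  rw [h1, Nat.add_zero]
  refine Eq.trans ?_ h2.symm
  rw [AlgHom.toLinearMap_apply, map_one]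
  -- At l = 0 the window is empty, so the initial colouring is irrelevant.
  exact colourSum_congr he (by simp)

end Hecke

/-! ### The recursive generating function as a sum over colourings -/

section Expansion

open MvPolynomial

variable {k : Type*} [CommRing k] (t : kˣ) {m : ℕ} (e : ℕ → ℕ)

/-- The extension of a colouring `c` of the vertices below `l` by the colours `κ 0, κ 1, …`. -/
def extColour {s : ℕ} (l : ℕ) (κ : Fin s → Fin m) (c : ℕ → ℕ) (j : ℕ) : ℕ :=
  if j < l then c j else if h : j - l < s then κ ⟨j - l, h⟩ else 0

/-- The contribution of the vertex `l` to the weight of a colouring. -/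
noncomputable def vertexWeight (m l : ℕ) (c : ℕ → ℕ) : MvPolynomial (Fin m) k :=
  if IsFree e l c (c l) then C ((t : k) ^ exceed e l c (c l)) else 0

theorem extColour_cons {s l : ℕ} (x : Fin m) (κ : Fin s → Fin m) (c : ℕ → ℕ) :
    extColour l (Fin.cons x κ : Fin (s + 1) → Fin m) c
      = extColour (l + 1) κ (Function.update c l x) := by
  funext j
  unfold extColour
  rcases Nat.lt_trichotomy j l with h | h | h
  · rw [if_pos h, if_pos (by omega), Function.update_of_ne (by omega)]
  · subst h
    rw [if_neg (lt_irrefl _), if_pos (by omega), Function.update_self, dif_pos (by omega)]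
    simp
  · rw [if_neg (by omega), if_neg (by omega)]
    by_cases hs : j - (l + 1) < s
    · rw [dif_pos hs, dif_pos (by omega)]
      have h1 : (⟨j - l, by omega⟩ : Fin (s + 1)) = Fin.succ ⟨j - (l + 1), hs⟩ :=
        Fin.ext (by simp; omega)
      rw [h1, Fin.cons_succ]
    · rw [dif_neg hs, dif_neg (by omega)]

/-- Unrolling the recursion splits off the first colour. A colour clash is encoded by a zero weight,
and the weight of a vertex does not see later colours because its window precedes it. -/
theorem colourSum_eq_sum (s l : ℕ) (c : ℕ → ℕ) :
    colourSum t m (pX k m) 1 e s l c = ∑ κ : Fin s → Fin m, ∏ r : Fin s,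
      (vertexWeight t e m (l + r) (extColour l κ c) * X (κ r)) := by
  induction s generalizing l c with
  | zero => simp [colourSum]
  | succ s ih =>
    rw [colourSum, ← Fin.sum_univ_eq_sum_range (fun x : ℕ => if IsFree e l c x then
      (t : k) ^ exceed e l c x •
        pX k m x (colourSum t m (pX k m) 1 e s (l + 1) (Function.update c l x)) else 0) m,
      ← (Fin.consEquiv fun _ : Fin (s + 1) => Fin m).sum_comp, Fintype.sum_prod_type]
    refine Finset.sum_congr rfl fun x _ => ?_
    have h1 : ∀ κ : Fin s → Fin m, ∏ r : Fin (s + 1),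
        (vertexWeight t e m (l + r) (extColour l (Fin.cons x κ : Fin (s + 1) → Fin m) c)
          * X ((Fin.cons x κ : Fin (s + 1) → Fin m) r))
        = (vertexWeight t e m l (Function.update c l x) * X x) * ∏ r : Fin s,
          (vertexWeight t e m (l + 1 + r) (extColour (l + 1) κ (Function.update c l x))
            * X (κ r)) := by
      intro κ
      rw [Fin.prod_univ_succ, extColour_cons]
      congr 1
      · have h2 : ∀ j < l + 1, extColour (l + 1) κ (Function.update c l x) j
            = Function.update c l x j := fun j hj => if_pos hj
        have h3 : ∀ j ∈ Finset.Ico (e l) l, extColour (l + 1) κ (Function.update c l x) j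
            = Function.update c l x j := fun j hj => h2 j (by
          have := Finset.mem_Ico.mp hj
          omega)
        simp only [Fin.val_zero, Nat.add_zero, Fin.cons_zero, vertexWeight, isFree_congr h3,
          exceed_congr h3, h2 l (Nat.lt_succ_self l)]
      · refine Finset.prod_congr rfl fun r _ => ?_
        rw [Fin.cons_succ, Fin.val_succ, show l + ((r : ℕ) + 1) = l + 1 + r by omega]
    refine Eq.trans ?_ (Finset.sum_congr rfl fun κ _ => (h1 κ).symm)
    rw [← Finset.mul_sum, ← ih]
    have h3 : ∀ j ∈ Finset.Ico (e l) l, Function.update c l (x : ℕ) j = c j := fun j hj =>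
      Function.update_of_ne (by have := Finset.mem_Ico.mp hj; omega) _ _
    simp only [vertexWeight, isFree_congr h3, exceed_congr h3, Function.update_self, smul_eq_C_mul]
    split_ifs
    · rw [X_eq_pvar, mul_assoc]
      rfl
    · simp

end Expansion

/-! ### Comparison with the chromatic quasisymmetric function -/

section Chromatic

open MvPolynomial

variable {k : Type*} [CommRing k] (t : kˣ) {m n : ℕ} (e : ℕ → ℕ)

theorem extColour_zero (κ : Fin n → Fin m) (c : ℕ → ℕ) (v : Fin n) :
    extColour 0 κ c v = κ v := by
  simp [extColour]

theorem isProper_iff (κ : Fin n → Fin m) (c : ℕ → ℕ) :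
    IsProper (unitIntervalGraph fun r : Fin n => e r) κ
      ↔ ∀ r : Fin n, IsFree e r (extColour 0 κ c) (extColour 0 κ c r) := by
  constructor
  · intro h r j hj
    have hj := Finset.mem_Ico.mp hj
    have h1 := h ⟨j, by omega⟩ r ⟨Nat.lt_succ_of_le hj.1, hj.2⟩
    rw [extColour_zero, extColour_zero κ c ⟨j, by omega⟩]
    exact fun h2 => h1 (Fin.ext h2)
  · intro h v w hvw h1
    refine h w v (Finset.mem_Ico.mpr ⟨Nat.le_of_lt_succ hvw.1, hvw.2⟩) ?_
    rw [extColour_zero, extColour_zero, h1]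

/-- The recursion counts descents, while the chromatic function counts ascents; reversing the order
of the colours exchanges the two. -/
theorem asc_rev (κ : Fin n → Fin m) (c : ℕ → ℕ) :
    asc (unitIntervalGraph fun r : Fin n => e r) (Fin.rev ∘ κ)
      = ∑ r : Fin n, exceed e r (extColour 0 κ c) (extColour 0 κ c r) := by
  classical
  rw [asc, Set.ncard_eq_toFinset_card', Set.toFinset_ofPred, Finset.card_filter,
    Fintype.sum_prod_type_right]
  refine Finset.sum_congr rfl fun r _ => ?_
  have h1 : ((Finset.Ico (e r) (r : ℕ)).filter
      fun j => extColour 0 κ c r < extColour 0 κ c j)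
      = (Finset.range n).filter fun j => e r ≤ j ∧ j < r ∧ extColour 0 κ c r < extColour 0 κ c j := by
    ext j
    simp only [Finset.mem_filter, Finset.mem_Ico, Finset.mem_range]
    have := r.2
    constructor
    · rintro ⟨⟨a, b⟩, d⟩; exact ⟨by omega, a, b, d⟩
    · rintro ⟨_, a, b, d⟩; exact ⟨⟨a, b⟩, d⟩
  rw [exceed, h1, Finset.card_filter, ← Fin.sum_univ_eq_sum_range
    (fun j => if e r ≤ j ∧ j < r ∧ extColour 0 κ c r < extColour 0 κ c j then 1 else 0) n]
  refine Finset.sum_congr rfl fun v _ => ?_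
  simp only [extColour_zero]
  refine if_congr ?_ rfl rfl
  simp only [unitIntervalGraph, Function.comp, Fin.rev_lt_rev, Nat.lt_succ_iff, and_assoc]
  rfl

theorem rename_rev_chromQS (m : ℕ+) (c : ℕ → ℕ) :
    rename Fin.rev ((chromQS (t : k) (unitIntervalGraph fun r : Fin n => e r)).1 m)
      = colourSum t m (pX k m) 1 e n 0 c := by
  classical
  rw [colourSum_eq_sum]
  unfold chromQS
  dsimp only
  rw [map_sum, Finset.sum_filter]
  apply Finset.sum_equiv ((Equiv.refl (Fin n)).arrowCongr Fin.revPerm)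
  · intro κ
    constructor <;> intro _ <;> simp
  intro κ _
  obtain ⟨κ', rfl⟩ : ∃ κ' : Fin n → Fin m, κ = Fin.rev ∘ κ' :=
    ⟨Fin.rev ∘ κ, funext fun v => (Fin.rev_rev _).symm⟩
  have h1 : ((Equiv.refl (Fin n)).arrowCongr Fin.revPerm) (Fin.rev ∘ κ') = κ' :=
    funext fun v => Fin.rev_rev _
  have h2 : IsProper (unitIntervalGraph fun r : Fin n => e r) (Fin.rev ∘ κ')
      ↔ ∀ r : Fin n, IsFree e r (extColour 0 κ' c) (extColour 0 κ' c r) := by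
    rw [← isProper_iff]
    exact forall_congr' fun v => forall_congr' fun w => imp_congr_right fun _ =>
      not_congr Fin.rev_injective.eq_iff
  rw [h1]
  simp only [Nat.zero_add]
  split_ifs with h
  · have h3 := h2.mp h
    rw [map_mul, map_prod, asc_rev e κ' c, Finset.prod_mul_distrib]
    simp only [rename_X, Function.comp, Fin.rev_rev, vertexWeight, if_pos (h3 _), map_pow, rename_C,
      Finset.prod_pow_eq_pow_sum]
  · obtain ⟨r, hr⟩ := not_forall.mp fun h3 => h (h2.mpr h3)
    symm
    exact Finset.prod_eq_zero (Finset.mem_univ r) (by rw [vertexWeight, if_neg hr, zero_mul])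

variable [IsDomain k] {e} (he : Monotone e)
include he

/-- This is `T_colourSum` with an empty window, for the family X. The parameter q plays no role in
the T_r on polynomials and is set to 1. -/
theorem colourSum_isSymmetric [NeZero m] (n : ℕ) (c : ℕ → ℕ) :
    (colourSum t m (pX k m) 1 e n 0 c).IsSymmetric :=
  (isSymmetric_iff 1 t _).mpr fun _ hi => T_colourSum_zero he (isBernstein_pX 1 t)
    (fun _ hi => pT_one 1 t hi) hi n c

/-- Symmetry makes the reversal of the variables harmless, so ascents and descents give the same
function. -/
theorem chromQS_eq_colourSum (m : ℕ+) (c : ℕ → ℕ) :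
    (chromQS (t : k) (unitIntervalGraph fun r : Fin n => e r)).1 m
      = colourSum t m (pX k m) 1 e n 0 c := by
  have h1 := rename_rev_chromQS t e m c (n := n)
  have h2 : rename Fin.rev (colourSum t m (pX k m) 1 e n 0 c)
      = colourSum t m (pX k m) 1 e n 0 c :=
    colourSum_isSymmetric t he n c Fin.revPerm
  rw [← h1, rename_rename, show (Fin.rev ∘ Fin.rev : Fin m → Fin m) = id from
    funext Fin.rev_rev, rename_id_apply] at h2
  rw [h2, h1]

theorem chromQS_mem_Lam : chromQS (t : k) (unitIntervalGraph fun r : Fin n => e r) ∈ Lam k := by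
  intro m
  rw [chromQS_eq_colourSum t he m 0]
  exact colourSum_isSymmetric t he n 0

theorem levelOne_SE_one (q : kˣ) (hle : ∀ l, e l ≤ l) (m : ℕ+) :
    levelOne q t m (HeckeAlg.SE t m fun r : Fin n => e r) 1 = toLaurent k m
      (qPoly q t m ((chromQS (t : k) (unitIntervalGraph fun r : Fin n => e r)).1 m)) := by
  rw [chromQS_eq_colourSum t he m 0, levelOne_SE q t he hle n 0]

end Chromatic

theorem IsE.exists_extension {n : ℕ} {e : Fin n → ℕ} (he : IsE e) :
    ∃ f : ℕ → ℕ, Monotone f ∧ (∀ l, f l ≤ l) ∧ e = fun r : Fin n => f r := by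
  -- Beyond n the value l gives empty windows. Monotonicity persists because e(r) ≤ r below n.
  refine ⟨fun l => if h : l < n then e ⟨l, h⟩ else l, ?_, ?_, ?_⟩
  · intro a b hab
    have h1 := fun h : a < n => he.1 ⟨a, h⟩
    dsimp only at h1 ⊢
    split_ifs with h2 h3
    · exact he.2 hab
    · have := h1 h2
      omega
    · omega
    · exact hab
  · intro l
    dsimp only
    split_ifs with h
    · exact Nat.le_of_lt_succ (he.1 ⟨l, h⟩)
    · exact le_rfl
  · funext r
    simp

/-! ### Passage to the projective limit -/

section Limit

variable {k : Type*} [CommRing k] [IsDomain k] (q t : kˣ)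

/-- The map `F ↦ F(Y) • 1` on polynomials, as a linear isomorphism. -/
noncomputable def qPolyEquiv (m : ℕ) [NeZero m] :
    MvPolynomial (Fin m) k ≃ₗ[k] MvPolynomial (Fin m) k :=
  LinearEquiv.ofBijective (qPoly q t m) ⟨qPoly_injective q t, qPoly_surjective q t⟩

theorem qPoly_qPolyEquiv_symm (m : ℕ) [NeZero m] (F : MvPolynomial (Fin m) k) :
    qPoly q t m ((qPolyEquiv q t m).symm F) = F := (qPolyEquiv q t m).apply_symm_apply F

/-- The homogeneous component of the preimage has the same image, so it is the preimage. This keeps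
the degrees bounded when the inverse is taken in the limit. -/
theorem isHomogeneous_qPolyEquiv_symm {m : ℕ} [NeZero m] (n : ℕ) (F : MvPolynomial (Fin m) k)
    (hF : F.IsHomogeneous n) : ((qPolyEquiv q t m).symm F).IsHomogeneous n := by
  have h : MvPolynomial.homogeneousComponent n ((qPolyEquiv q t m).symm F)
      = (qPolyEquiv q t m).symm F := by
    apply qPoly_injective q t
    rw [← homogeneousComponent_comm _ (isHomogeneous_qPoly q t), qPoly_qPolyEquiv_symm,
      MvPolynomial.homogeneousComponent_of_mem hF, if_pos rfl]
  rw [← h]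
  exact MvPolynomial.homogeneousComponent_isHomogeneous n _

theorem trunc_qPolyEquiv_symm {m m' : ℕ} [NeZero m] [NeZero m'] (h : m' ≤ m)
    (F : MvPolynomial (Fin m) k) :
    trunc k m m' ((qPolyEquiv q t m).symm F) = (qPolyEquiv q t m').symm (trunc k m m' F) := by
  apply qPoly_injective q t
  rw [← trunc_qPoly h, qPoly_qPolyEquiv_symm, qPoly_qPolyEquiv_symm]

/-- The limit of the maps `F ↦ F(Y) • 1`. -/
noncomputable def qLimit : QInf k ≃ₗ[k] QInf k where
  toFun F := ⟨fun m => qPoly q t m (F.1 m),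
    fun m' m h => (trunc_qPoly (m := m) (m' := m') h.le _).trans (congrArg _ (F.2.1 m' m h)),
    F.2.2.imp fun _ hD m =>
      (totalDegree_le_of_homogeneous _ (isHomogeneous_qPoly q t) _).trans (hD m)⟩
  invFun F := ⟨fun m => (qPolyEquiv q t m).symm (F.1 m),
    fun m' m h => (trunc_qPolyEquiv_symm q t (m := m) (m' := m') h.le _).trans (congrArg _ (F.2.1 m' m h)),
    F.2.2.imp fun _ hD m => (totalDegree_le_of_homogeneous (qPolyEquiv q t m).symm.toLinearMap
      (isHomogeneous_qPolyEquiv_symm q t) _).trans (hD m)⟩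
  map_add' F G := Subtype.ext (funext fun m => map_add (qPoly q t m) (F.1 m) (G.1 m))
  map_smul' c F := Subtype.ext (funext fun m => map_smul (qPoly q t m) c (F.1 m))
  left_inv F := Subtype.ext (funext fun m => (qPolyEquiv q t m).symm_apply_apply (F.1 m))
  right_inv F := Subtype.ext (funext fun m => (qPolyEquiv q t m).apply_symm_apply (F.1 m))

theorem qLimit_mem_Lam_iff (F : QInf k) : qLimit q t F ∈ Lam k ↔ F ∈ Lam k :=
  forall_congr' fun m => qPoly_isSymmetric_iff q t (F.1 m)

theorem qLimit_symm_mem_Lam {F : QInf k} (hF : F ∈ Lam k) : (qLimit q t).symm F ∈ Lam k := by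
  rw [← qLimit_mem_Lam_iff q t, LinearEquiv.apply_symm_apply]
  exact hF

theorem qStar_mem_Lam {F G : QInf k} (hF : F ∈ Lam k) (hG : G ∈ Lam k) :
    qStar (qLimit q t) F G ∈ Lam k :=
  (qLimit_mem_Lam_iff q t _).mpr
    ((Lam k).mul_mem (qLimit_symm_mem_Lam q t hF) (qLimit_symm_mem_Lam q t hG))

theorem qLimit_one : qLimit q t 1 = 1 := Subtype.ext (funext fun _ => qPoly_one q t)

theorem qLimit_elemSymm (r : ℕ) :
    qLimit q t (elemSymm k r) = (t : k) ^ (r * (r - 1) / 2) • elemSymm k r :=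
  Subtype.ext (funext fun _ => qPoly_esymm q t r)

omit [IsDomain k] in
theorem elemSymm_mem_Lam (r : ℕ) : elemSymm k r ∈ Lam k :=
  fun _ => MvPolynomial.esymm_isSymmetric _ _ r

theorem foldr_qStar_mem_Lam (L : List ℕ) :
    (L.map (elemSymm k)).foldr (qStar (qLimit q t)) 1 ∈ Lam k := by
  induction L with
  | nil => exact (Lam k).one_mem
  | cons r L ih => exact qStar_mem_Lam q t (elemSymm_mem_Lam r) ih

/-- Each e_r is an eigenvector of q, so its preimage is a multiple of e_r, and the eigenvalues
accumulate along the product. -/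
theorem qLimit_prod_elemSymm (L : List ℕ) :
    qLimit q t (L.map (elemSymm k)).prod = (t : k) ^ (L.map fun r => r * (r - 1) / 2).sum •
      (L.map (elemSymm k)).foldr (qStar (qLimit q t)) 1 := by
  induction L with
  | nil => simp [qLimit_one]
  | cons r L ih =>
    have h1 := congrArg (qLimit q t).symm (qLimit_elemSymm q t r)
    have h2 := congrArg (qLimit q t).symm ih
    rw [LinearEquiv.symm_apply_apply, map_smul] at h1 h2
    rw [List.map_cons, List.prod_cons, List.map_cons, List.sum_cons, List.foldr_cons]
    conv_lhs => rw [h1, h2]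
    rw [smul_mul_smul_comm, map_smul, ← pow_add]
    rfl

end Limit

/-! ### Specialization of the transported product -/

section Specialization

open MvPolynomial

variable {R K K' : Type*} [CommRing R] [IsDomain R] [CommRing K] [IsDomain K] [CommRing K']
  [IsDomain K'] {φ : R →+* K} {ψ : R →+* K'} {q t : Rˣ} {qK tK : Kˣ} {tK' : K'ˣ}

/-- If `φ` is a base change and `ψ` is a specialization with `q ↦ 1`, then the transported product with
a symmetric factor specializes to the usual product. -/
theorem exists_map_eq_qPoly_mul (hq : φ q = qK) (ht : φ t = tK) (hq' : ψ q = 1) (ht' : ψ t = tK')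
    (hφ : Function.Injective φ) {m : ℕ} [NeZero m] {f g : MvPolynomial (Fin m) K}
    {F G : MvPolynomial (Fin m) R} (hf : qPoly qK tK m f = map φ F) (hg : qPoly qK tK m g = map φ G)
    (hG : (map φ G).IsSymmetric) :
    ∃ P, qPoly qK tK m (f * g) = map φ P ∧ map ψ P = map ψ (F * G) := by
  -- The map is already surjective over `R`, so the preimages, and hence their product, have
  -- coefficients in `R`.
  obtain ⟨F, rfl⟩ := qPoly_surjective q t F
  obtain ⟨G, rfl⟩ := qPoly_surjective q t G
  have hq1 : ψ q = ((1 : K'ˣ) : K') := by rw [hq', Units.val_one]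
  rw [map_qPoly_map hq ht] at hf hg
  have hG' : (qPoly q t m G).IsSymmetric := fun σ => map_injective φ hφ (by
    rw [map_rename]; exact hG σ)
  have hG1 : (qPoly 1 tK' m (map ψ G)).IsSymmetric := by
    rw [← map_qPoly_map hq1 ht']
    exact hG'.map ψ
  refine ⟨qPoly q t m (F * G), ?_, ?_⟩
  · rw [qPoly_injective qK tK hf, qPoly_injective qK tK hg, ← map_mul, map_qPoly_map hq ht]
  · rw [map_qPoly_map hq1 ht', map_mul (map ψ), map_mul (map ψ), map_qPoly_map hq1 ht',
      map_qPoly_map hq1 ht', qPoly_one_mul tK' (map ψ F) hG1]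

end Specialization

/-! ### Functions regular at q = 1 and the value of the product there -/

section AtOne

open MvPolynomial

theorem RegularAtOne.eval₂_ne_zero {c : Qqt} (hc : RegularAtOne c) :
    Polynomial.eval₂ (RingHom.id Qt) 1 c.denom ≠ 0 := by
  rw [Polynomial.eval₂_id]
  exact hc

theorem RegularAtOne.of_dvd {c : Qqt} {p : Polynomial Qt} (h : c.denom ∣ p) (hp : p.eval 1 ≠ 0) :
    RegularAtOne c := fun h0 => hp (Polynomial.eval_eq_zero_of_dvd_of_eval_eq_zero h h0)

theorem RegularAtOne.mul {a b : Qqt} (ha : RegularAtOne a) (hb : RegularAtOne b) :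
    RegularAtOne (a * b) :=
  .of_dvd (RatFunc.denom_mul_dvd a b) (by rw [Polynomial.eval_mul]; exact mul_ne_zero ha hb)

theorem RegularAtOne.add {a b : Qqt} (ha : RegularAtOne a) (hb : RegularAtOne b) :
    RegularAtOne (a + b) :=
  .of_dvd (RatFunc.denom_add_dvd a b) (by rw [Polynomial.eval_mul]; exact mul_ne_zero ha hb)

theorem regularAtOne_C (c : Qt) : RegularAtOne (RatFunc.C c) := by
  rw [RegularAtOne, RatFunc.denom_C, Polynomial.eval_one]
  exact one_ne_zero

/-- The ring of elements without pole at `q = 1`. -/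
noncomputable def regularSubring : Subring Qqt where
  carrier := {c | RegularAtOne c}
  mul_mem' := .mul
  add_mem' := .add
  one_mem' := by
    change RegularAtOne 1
    rw [← map_one (RatFunc.C : Qt →+* Qqt)]; exact regularAtOne_C 1
  zero_mem' := by
    change RegularAtOne 0
    rw [← map_zero (RatFunc.C : Qt →+* Qqt)]; exact regularAtOne_C 0
  neg_mem' {c} hc := by
    change RegularAtOne (-c)
    rw [← neg_one_mul, ← map_one (RatFunc.C : Qt →+* Qqt), ← map_neg]
    exact (regularAtOne_C _).mul hc

/-- The specialization at `q = 1`. -/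
noncomputable def regularSpec : regularSubring →+* Qt where
  toFun c := valueAtOne c
  map_one' := RatFunc.eval_one _ _
  map_zero' := RatFunc.eval_zero _ _
  map_mul' a b := RatFunc.eval_mul _ _ (RegularAtOne.eval₂_ne_zero a.2) (RegularAtOne.eval₂_ne_zero b.2)
  map_add' a b := RatFunc.eval_add _ _ (RegularAtOne.eval₂_ne_zero a.2) (RegularAtOne.eval₂_ne_zero b.2)

theorem regularAtOne_qv : RegularAtOne (qv : Qqt) := by
  change RegularAtOne RatFunc.X
  rw [RegularAtOne, RatFunc.denom_X, Polynomial.eval_one]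
  exact one_ne_zero

theorem regularAtOne_qv_inv : RegularAtOne ((qv⁻¹ : Qqtˣ) : Qqt) := by
  rw [Units.val_inv_eq_inv_val]
  change RegularAtOne (RatFunc.X)⁻¹
  refine .of_dvd (RatFunc.denom_inv_dvd RatFunc.X_ne_zero) ?_
  rw [RatFunc.num_X, Polynomial.eval_X]
  exact one_ne_zero

theorem regularAtOne_tv_inv : RegularAtOne ((tv⁻¹ : Qqtˣ) : Qqt) := by
  rw [Units.val_inv_eq_inv_val]
  change RegularAtOne (RatFunc.C RatFunc.X)⁻¹
  rw [← map_inv₀]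
  exact regularAtOne_C _

/-- The parameter `q`, as a unit of the ring of elements without pole at `q = 1`. -/
noncomputable def qReg : regularSubringˣ where
  val := ⟨qv, regularAtOne_qv⟩
  inv := ⟨(qv⁻¹ : Qqtˣ), regularAtOne_qv_inv⟩
  val_inv := Subtype.ext qv.mul_inv
  inv_val := Subtype.ext qv.inv_mul

/-- The parameter `t`, as a unit of the ring of elements without pole at `q = 1`. -/
noncomputable def tReg : regularSubringˣ where
  val := ⟨tv, regularAtOne_C _⟩
  inv := ⟨(tv⁻¹ : Qqtˣ), regularAtOne_tv_inv⟩
  val_inv := Subtype.ext tv.mul_inv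
  inv_val := Subtype.ext tv.inv_mul

theorem exists_map_subtype_eq {σ : Type*} {F : MvPolynomial σ Qqt}
    (hF : ∀ d, RegularAtOne (F.coeff d)) : ∃ P, F = map regularSubring.subtype P := by
  have h : F ∈ Set.range (map (σ := σ) regularSubring.subtype) := by
    rw [mem_range_map_iff_coeffs_subset]
    intro c hc
    obtain ⟨d, _, rfl⟩ := mem_coeffs_iff.mp hc
    exact ⟨⟨_, hF d⟩, rfl⟩
  exact h.imp fun _ h => h.symm

/-- The general specialization argument is applied over the ring of functions regular at q = 1, with
its inclusion in ℚ(q,t) as base change and evaluation at q = 1 as specialization. Both q and t are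
units of that ring. -/
theorem qStar_atOne_of_right {F G : QInf Qqt} (hG : G ∈ Lam Qqt) (hF1 : QInf.RegularAtOne F)
    (hG1 : QInf.RegularAtOne G) : QInf.RegularAtOne (qStar (qLimit qv tv) F G) ∧
      QInf.AgreeAtOne (qStar (qLimit qv tv) F G) (F * G) := by
  have key : ∀ m : ℕ+, ∃ P : MvPolynomial (Fin m) regularSubring,
      (qStar (qLimit qv tv) F G).1 m = map regularSubring.subtype P ∧
        ∃ P', (F * G).1 m = map regularSubring.subtype P' ∧ map regularSpec P = map regularSpec P' := by
    intro m
    obtain ⟨A, hA⟩ := exists_map_subtype_eq (hF1 m)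
    obtain ⟨B, hB⟩ := exists_map_subtype_eq (hG1 m)
    have hB' : (map regularSubring.subtype B).IsSymmetric := hB ▸ hG m
    obtain ⟨P, hP, hP'⟩ := exists_map_eq_qPoly_mul (φ := regularSubring.subtype) (ψ := regularSpec)
      (q := qReg) (t := tReg) (qK := qv) (tK := tv)
      (tK' := Units.mk0 (RatFunc.X : Qt) RatFunc.X_ne_zero) rfl rfl (RatFunc.eval_X _ _) (RatFunc.eval_C _ _)
      regularSubring.subtype_injective
      ((qPoly_qPolyEquiv_symm qv tv m _).trans hA) ((qPoly_qPolyEquiv_symm qv tv m _).trans hB) hB'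
    refine ⟨P, hP, A * B, ?_, hP'⟩
    rw [map_mul, ← hA, ← hB]
    rfl
  constructor
  · intro m d
    obtain ⟨P, hP, -⟩ := key m
    rw [hP, coeff_map]
    exact (P.coeff d).2
  · intro m d
    obtain ⟨P, hP, P', hP', h⟩ := key m
    have h1 : regularSpec (P.coeff d) = regularSpec (P'.coeff d) := by
      rw [← coeff_map, ← coeff_map, h]
    rw [hP, hP', coeff_map, coeff_map]
    exact h1

theorem qStar_comm {k : Type*} [CommRing k] (φ : QInf k ≃ₗ[k] QInf k) (F G : QInf k) :
    qStar φ F G = qStar φ G F := by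
  rw [qStar, qStar, mul_comm]

theorem qStar_assoc {k : Type*} [CommRing k] (φ : QInf k ≃ₗ[k] QInf k) (F G H : QInf k) :
    qStar φ (qStar φ F G) H = qStar φ F (qStar φ G H) := by
  simp only [qStar, LinearEquiv.symm_apply_apply, mul_assoc]

theorem qStar_atOne {F G : QInf Qqt} (h : F ∈ Lam Qqt ∨ G ∈ Lam Qqt) (hF1 : QInf.RegularAtOne F)
    (hG1 : QInf.RegularAtOne G) : QInf.RegularAtOne (qStar (qLimit qv tv) F G) ∧
      QInf.AgreeAtOne (qStar (qLimit qv tv) F G) (F * G) := by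
  rcases h with h | h
  · rw [qStar_comm, mul_comm]
    exact qStar_atOne_of_right h hG1 hF1
  · exact qStar_atOne_of_right h hF1 hG1

end AtOne

end QTChrom

theorem theoremB :
    (∀ m : ℕ+,
      (Function.Injective (evalY tv (m : ℕ)) ∧
        ∀ F G, evalY tv (m : ℕ) (F * G)
          = evalY tv (m : ℕ) F * evalY tv (m : ℕ) G) ∧
      Function.Bijective (qMap qv tv (m : ℕ)) ∧
      (LinearMap.range (toLaurent Qqt (m : ℕ)).toLinearMap).map
          (qMap qv tv (m : ℕ))
        = LinearMap.range (toLaurent Qqt (m : ℕ)).toLinearMap) ∧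
    (∀ m' m : ℕ+, m' < m → ∀ F : MvPolynomial (Fin m) Qqt,
      ∃ G : MvPolynomial (Fin m) Qqt,
        qMap qv tv (m : ℕ) (toLaurent _ _ F)
          = toLaurent _ _ G ∧
        qMap qv tv (m' : ℕ)
            (toLaurent _ _ (trunc _ m m' F))
          = toLaurent _ _ (trunc _ m m' G)) ∧
    ∃ qlim : QInf Qqt ≃ₗ[Qqt] QInf Qqt,
      (∀ (F : QInf Qqt) (m : ℕ+),
        toLaurent _ _ ((qlim F).1 m)
          = qMap qv tv (m : ℕ) (toLaurent _ _ (F.1 m))) ∧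
      ((∀ F G, qStar qlim F G = qStar qlim G F) ∧
        (∀ F G H, qStar qlim (qStar qlim F G) H
          = qStar qlim F (qStar qlim G H)) ∧
        (∀ F ∈ Lam Qqt, ∀ G ∈ Lam Qqt,
          qStar qlim F G ∈ Lam Qqt) ∧
        (∀ F G, F ∈ Lam Qqt ∨ G ∈ Lam Qqt →
          QInf.RegularAtOne F → QInf.RegularAtOne G →
          QInf.RegularAtOne (qStar qlim F G) ∧
            QInf.AgreeAtOne (qStar qlim F G) (F * G))) ∧
      (∀ (n : ℕ) (e : Fin n → ℕ), IsE e →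
        ∃ XΓ ∈ Lam Qqt,
          (∀ m : ℕ+, toLaurent _ _ (XΓ.1 m)
            = levelOne qv tv (m : ℕ)
                (HeckeAlg.SE tv (m : ℕ) e) 1) ∧
          XΓ = qlim (chromQS (tv : Qqt) (unitIntervalGraph e))) ∧
      (∀ (n : ℕ) (lam : n.Partition),
        elemPartStar qlim lam ∈ Lam Qqt ∧
        qlim (elemPart Qqt lam)
          = (tv : Qqt) ^ ((lam.parts.map fun r => r * (r - 1) / 2).sum) •
              elemPartStar qlim lam) := by
  refine ⟨fun m => ⟨⟨evalY_injective tv, evalY_mul tv m⟩,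
    ⟨qMap_injective qv tv, qMap_surjective qv tv⟩, map_range_toLaurent qv tv⟩,
    fun m' m h F => ⟨qPoly qv tv m F, (toLaurent_qPoly qv tv F).symm, ?_⟩,
    qLimit qv tv, fun F m => toLaurent_qPoly qv tv (F.1 m),
    ⟨qStar_comm _, qStar_assoc _, fun F hF G hG => qStar_mem_Lam qv tv hF hG,
      fun F G h => qStar_atOne h⟩, fun n e he => ?_, fun n lam => ⟨foldr_qStar_mem_Lam qv tv _, ?_⟩⟩
  · rw [← toLaurent_qPoly, trunc_qPoly (m := m) (m' := m') h.le]
  · obtain ⟨f, hf, hle, rfl⟩ := he.exists_extension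
    exact ⟨_, (qLimit_mem_Lam_iff qv tv _).mpr (chromQS_mem_Lam tv hf),
      fun m => (levelOne_SE_one tv hf qv hle m).symm, rfl⟩
  · rw [elemPart, qLimit_prod_elemSymm, elemPartStar, ← Multiset.sum_coe, ← Multiset.map_coe,
      Multiset.sort_eq]
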